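/- Theorem 5.1 (thm:limit). Fix an integer $L\ge 2$. For a finite word $\lambda=\lambda_1\cdots\lambda_n$ in the alphabet $\Lambda=\{0,\dots,L-1\}^2$ let $Q(\lambda)\subset[0,1]^2$ be the closed square of side $L^{-n}$ with bottom-left corner $\sum_{m=1}^n\lambda_mL^{-m}$. A grid model is a random set $\mathfrak X\subset\Lambda$ with $\mathbb E\,\#\mathfrak X=L$. It is uniform if $\mathbb P[a\in\mathfrak X]=1/L$ for every $a\in\Lambda$, and non-degenerate if it is neither the case that almost surely $\mathfrak X$ contains exactly one cell $(i,j)$ in each column $i$, nor that almost surely it contains exactly one cell $(i,j)$ in each row $j$. Let $(\mathfrak X_\lambda)_\lambda$, indexed by all finite words, be independent copies of $\mathfrak X$ and set $\mathcal S_0=\{\text{empty word}\}$, $\mathcal S_{n+1}=\{\lambda a:\lambda\in\mathcal S_n,\ a\in\mathfrak X_\lambda\}$, $S_n=\bigcup_{\lambda\in\mathcal S_n}Q(\lambda)$, $Z_n=L^{-n}\#\mathcal S_n$. For $\theta\in[0,\pi]$ let $\operatorname{proj}_\theta(x,y)=-x\sin\theta+y\cos\theta$, let $\ell(\theta,t)=\operatorname{proj}_\theta^{-1}(t)$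 be the line of direction $(\cos\theta,\sin\theta)$ through $t(-\sin\theta,\cos\theta)$, write $|\cdot|$ for one-dimensional Lebesgue measure (on $\mathbb R$ and on lines), and let $\operatorname{Fav}(K)=\int_0^\pi|\operatorname{proj}_\theta K|\,d\theta$. For a non-degenerate uniform grid model, put $$V(\theta)=\int_{\mathbb R}\operatorname{Var}\bigl(L\,|\ell(\theta,t)\cap S_1|\bigr)\,dt .$$ Then $V(\theta)>0$ for every $\theta\in[0,\pi]$, the function $2/V$ is integrable on $[0,\pi]$, and $$\lim_{n\to\infty}n\,\mathbb E|\operatorname{proj}_\theta S_n|=\frac{2}{V(\theta)}\quad\text{uniformly in }\theta\in[0,\pi],\qquad \lim_{n\to\infty}n\,\mathbb E[\operatorname{Fav}(S_n)]=\int_0^\pi\frac{2}{V(\theta)}\,d\theta .$$ Moreover, almost surely the martingale $Z_n$ converges to a finite limit $Z$ and $$\lim_{n\to\infty}n\operatorname{Fav}(S_n)=Z\int_0^\pi\frac{2}{V(\theta)}\,d\theta .$$ -/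

import Mathlib

open MeasureTheory ProbabilityTheory Filter Topology Set

noncomputable section

namespace RandomGrid

/-- The alphabet `Λ`: a pair `(i, j)` stands for the cell in column `i` and row `j` of the
`L × L` grid (indices start at `0`). -/
abbrev Cell (L : ℕ) : Type := Fin L × Fin L

/-- A selection of distinct cells of the `L × L` grid. -/
abbrev Config (L : ℕ) : Type := Finset (Cell L)

/-- A grid model: the law of a random selection of cells of the `L × L` grid, `L ≥ 2`, whose
expected number of selected cells is `L`. -/
structure GridModel (L : ℕ) where
  two_le : 2 ≤ L
  law : PMF (Config L)
  mean_card : ∫ A, (A.card : ℝ) ∂law.toMeasure = L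

namespace GridModel

variable {L : ℕ}

/-- Every cell is selected with probability `1 / L`. -/
def Uniform (M : GridModel L) : Prop :=
  ∀ c : Cell L, M.law.toMeasure.real {A | c ∈ A} = 1 / (L : ℝ)

/-- Almost surely exactly one cell is selected in each column. -/
def VerticallyDegenerate (M : GridModel L) : Prop :=
  ∀ᵐ A ∂M.law.toMeasure, ∀ i : Fin L, ∃! j : Fin L, (i, j) ∈ A

/-- Almost surely exactly one cell is selected in each row. -/
def HorizontallyDegenerate (M : GridModel L) : Prop :=
  ∀ᵐ A ∂M.law.toMeasure, ∀ j : Fin L, ∃! i : Fin L, (i, j) ∈ A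

def NonDegenerate (M : GridModel L) : Prop :=
  ¬ M.VerticallyDegenerate ∧ ¬ M.HorizontallyDegenerate

end GridModel

section Geometry

variable {L : ℕ}

/-- Bottom-left corner of the square with address `λ₁ ⋯ λₙ`, i.e. `∑ₘ λₘ L⁻ᵐ`. -/
def corner : List (Cell L) → ℝ × ℝ
  | [] => (0, 0)
  | a :: w => (((a.1 : ℕ) + (corner w).1) / (L : ℝ), ((a.2 : ℕ) + (corner w).2) / (L : ℝ))

/-- The closed grid square of side `L⁻ⁿ` with address `w`, where `n` is the length of `w`. -/
def square (w : List (Cell L)) : Set (ℝ × ℝ) :=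
  Icc (corner w).1 ((corner w).1 + 1 / (L : ℝ) ^ w.length) ×ˢ
    Icc (corner w).2 ((corner w).2 + 1 / (L : ℝ) ^ w.length)

/-- Addresses of the squares of generation `n`, when `x w` is the set of cells selected inside
the square with address `w`. -/
def squares (x : List (Cell L) → Config L) : ℕ → Finset (List (Cell L))
  | 0 => {[]}
  | n + 1 => (squares x n).biUnion fun w => (x w).image fun a => w ++ [a]

/-- The set `Sₙ`, the union of the squares of generation `n`. -/
def stage (x : List (Cell L) → Config L) (n : ℕ) : Set (ℝ × ℝ) :=
  ⋃ w ∈ squares x n, square w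

/-- Signed coordinate along `(-sin θ, cos θ)`: the orthogonal projection whose fibres are the
lines of direction `(cos θ, sin θ)`. -/
def proj (θ : ℝ) (p : ℝ × ℝ) : ℝ := -p.1 * Real.sin θ + p.2 * Real.cos θ

/-- Length of the projection of `K`. -/
def projLength (θ : ℝ) (K : Set (ℝ × ℝ)) : ℝ := volume.real (proj θ '' K)

/-- Favard length. -/
def Fav (K : Set (ℝ × ℝ)) : ℝ := ∫ θ in (0 : ℝ)..Real.pi, projLength θ K

/-- Unit-speed parametrization of the line `ℓ(θ, t)`, the fibre of `proj θ` over `t`. -/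
def linePoint (θ t s : ℝ) : ℝ × ℝ :=
  (-t * Real.sin θ + s * Real.cos θ, t * Real.cos θ + s * Real.sin θ)

/-- Length of the intersection of `K` with the line `ℓ(θ, t)`. -/
def chordLength (θ t : ℝ) (K : Set (ℝ × ℝ)) : ℝ := volume.real {s : ℝ | linePoint θ t s ∈ K}

end Geometry

section Construction

variable {L : ℕ} {Ω : Type*} [MeasurableSpace Ω]

/-- The selections `X w`, one for each address `w`, are independent realizations of the model. -/
structure IsGridProcess (M : GridModel L) (X : List (Cell L) → Ω → Config L) (P : Measure Ω) :
    Prop where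
  hasLaw : ∀ w, HasLaw (X w) M.law.toMeasure P
  indep : iIndepFun X P

/-- The random set `Sₙ`. -/
def S (X : List (Cell L) → Ω → Config L) (n : ℕ) (ω : Ω) : Set (ℝ × ℝ) :=
  stage (fun w => X w ω) n

/-- The martingale `Zₙ = L⁻ⁿ |𝒮ₙ|`. -/
def Zseq (X : List (Cell L) → Ω → Config L) (n : ℕ) (ω : Ω) : ℝ :=
  ((squares (fun w => X w ω) n).card : ℝ) / (L : ℝ) ^ n

/-- The limit `Z` of `Zₙ` (meaningful at the `ω` where the limit exists). -/
def Zlim (X : List (Cell L) → Ω → Config L) (ω : Ω) : ℝ :=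
  limUnder atTop fun n => Zseq X n ω

/-- `V(θ) = ∫ Var(L |ℓ(θ, t) ∩ S₁|) dt`. -/
def V (X : List (Cell L) → Ω → Config L) (P : Measure Ω) (θ : ℝ) : ℝ :=
  ∫ t : ℝ, variance (fun ω => (L : ℝ) * chordLength θ t (S X 1 ω)) P

end Construction

end RandomGrid

end

/-! Fix a direction `θ`, and let `f n t` be the probability that the line `ℓ(θ, t)` meets the stage
of generation `n`; the expected length of the projection is `∫ f n`. Splitting the tree at its root
gives `f (n + 1) = hitOp (f n)` (`hitProb_succ`). To first order `hitOp` is the linear,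
mass-preserving operator `avgOp`, which fixes the chord-length density `h = unitChord θ` of the unit
square; the second-order loss is `pairOp`. If `f n ≈ c n • h`, the coefficients obey `c (n + 1) ≈ c
n - m (c n)^2` with `m = ∫ pairOp h`, hence `n c n → 1 / m`. In the integrated variance the diagonal
terms cancel against the square of the mean, so `V = 2 m` (`IsGridProcess.V_eq`) and the limit is `2
/ V`.

The heuristic becomes exact as follows. Iterating `avgOp` contracts translations by `L` at each step
(`avgOp_iterate_shift`). This gives decay of correlations, so ergodic sums of `K` terms of `pairOp
h` equal `K m h` up to an `L¹` error of order `√K`. Hence `K` generations turn `c h` into `c / (1 +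
c K m) h` with small error, and since `hitOp` does not expand `L¹` distances the blocks can be
chained (`exists_integral_abs_evolution_le`). By monotonicity this already bounds `∫ f n` from
below.

For the upper bound the solution must first be brought below a multiple of `h` of order `1 / n`. The
energy `∫ f^2 / H`, where `H` is the iterated average of `window`, loses at least a multiple of its
power `3/2` every `r + 1` generations: either the ratio `f / H` varies among descendants and
Cauchy–Schwarz is strict, or two overlapping cells are hit together. Therefore `∫ (f n)^2 ≤ C / n^2`
(`exists_integral_sq_hitOp_iterate_le`), and `exists_mul_integral_le_upper` concludes by truncating
and waiting a short time. Overlapping pairs exist in every direction because the model is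
non-degenerate, and compactness makes the constants uniform in `θ` (`exists_isLinked`).

For almost sure convergence, `Fav` of a late stage is at most the scaled sum of `Fav` over the
subtrees of generation `k`. Along the generations `i^4`, with `k = i`, the expected excess in this
inequality is summable even after multiplication by `i^4`, and the sum over subtrees concentrates
exponentially fast around its mean times `Z_i`. Monotonicity of `Fav` in the generation fills the
gaps between fourth powers. -/

namespace RandomGrid

noncomputable section

section

variable {L : ℕ}

/-! ### Operators on functions of the line parameter -/

/-- Indicator of `[-2, 2]`, an interval which contains the support of every function below. -/
def window : ℝ → ℝ := indicator (Icc (-2) 2) 1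

/-- Expected value of `∑ a ∈ X, g (L t - p a)` for a uniform selection `X`. -/
def avgOp (p : Cell L → ℝ) (g : ℝ → ℝ) (t : ℝ) : ℝ := (1 / (L : ℝ)) * ∑ a, g (L * t - p a)

/-- Probability that one of the cells `a` of a selection with law `w` is hit, when they are hit
independently, `a` with probability `g (L t - p a)`. -/
def hitOp (w : Config L → ℝ) (p : Cell L → ℝ) (g : ℝ → ℝ) (t : ℝ) : ℝ :=
  ∑ A, w A * (1 - ∏ a ∈ A, (1 - g (L * t - p a)))

/-- Weights of a probability law on selections for which every cell has probability `1 / L`. -/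
structure IsUniformWeight (w : Config L → ℝ) : Prop where
  two_le : 2 ≤ L
  nonneg : ∀ A, 0 ≤ w A
  sum_one : ∑ A, w A = 1
  marginal : ∀ c : Cell L, ∑ A, (if c ∈ A then w A else 0) = 1 / (L : ℝ)

/-- A probability density on `[-2, 2]` which is self-similar for the offsets `p`. -/
structure IsSelfSimilarDensity (p : Cell L → ℝ) (h : ℝ → ℝ) : Prop where
  offset_le : ∀ a, |p a| ≤ 2 * ((L : ℝ) - 1)
  measurable : Measurable h
  nonneg : ∀ t, 0 ≤ h t
  le_window : ∀ t, h t ≤ 2 * window t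
  integral_eq_one : ∫ t, h t = 1
  sum_eq : ∀ t, ∑ a, h (L * t - p a) = L * h t
  shift : ∀ v, ∫ t, |h (t + v) - h t| ≤ 4 * |v|

/-- Measurable functions dominated by `B` times the indicator of `[-2, 2]`. -/
def Dominated (B : ℝ) (g : ℝ → ℝ) : Prop := Measurable g ∧ ∀ t, |g t| ≤ B * window t

lemma window_nonneg (t : ℝ) : 0 ≤ window t := indicator_nonneg (fun _ _ => zero_le_one) t

lemma window_le_one (t : ℝ) : window t ≤ 1 :=
  indicator_le' (fun _ _ => le_rfl) (fun _ _ => zero_le_one) t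

lemma window_of_mem {t : ℝ} (ht : |t| ≤ 2) : window t = 1 := by
  have : t ∈ Icc (-2 : ℝ) 2 := abs_le.1 ht
  simp [window, this]

lemma window_of_not_mem {t : ℝ} (ht : 2 < |t|) : window t = 0 := by
  have : t ∉ Icc (-2 : ℝ) 2 := fun h => absurd (abs_le.2 h) (not_le.2 ht)
  simp [window, this]

lemma window_eq_ite (t : ℝ) : window t = if |t| ≤ 2 then 1 else 0 := by
  split_ifs with h
  · exact window_of_mem h
  · exact window_of_not_mem (not_le.1 h)

lemma measurable_window : Measurable window := measurable_one.indicator measurableSet_Icc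

lemma integrable_window : Integrable window := by
  refine (integrable_indicator_iff measurableSet_Icc).2 ?_
  exact integrableOn_const (by simp)

lemma integral_window : ∫ t, window t = 4 := by
  unfold window
  rw [integral_indicator_one measurableSet_Icc]
  simp; norm_num

lemma dominated_window : Dominated 1 window :=
  ⟨measurable_window, fun t => by rw [abs_of_nonneg (window_nonneg t), one_mul]⟩

lemma IsSelfSimilarDensity.dominated {p : Cell L → ℝ} {h : ℝ → ℝ} (hh : IsSelfSimilarDensity p h) :
    Dominated 2 h :=
  ⟨hh.measurable, fun t => by rw [abs_of_nonneg (hh.nonneg t)]; exact hh.le_window t⟩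

lemma IsSelfSimilarDensity.le_two {p : Cell L → ℝ} {h : ℝ → ℝ} (hh : IsSelfSimilarDensity p h)
    (t : ℝ) : h t ≤ 2 := by
  have := hh.le_window t
  have := window_le_one t
  linarith

namespace Dominated

variable {B B' : ℝ} {g g' : ℝ → ℝ}

lemma integrable (hg : Dominated B g) : Integrable g :=
  (integrable_window.const_mul B).mono' hg.1.aestronglyMeasurable (ae_of_all _ hg.2)

lemma mono (hg : Dominated B g) (h : B ≤ B') : Dominated B' g :=
  ⟨hg.1, fun t => (hg.2 t).trans (mul_le_mul_of_nonneg_right h (window_nonneg t))⟩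

lemma sub (hg : Dominated B g) (hg' : Dominated B' g') : Dominated (B + B') (fun t => g t - g' t) :=
  ⟨hg.1.sub hg'.1, fun t => (abs_sub _ _).trans (by linarith [hg.2 t, hg'.2 t])⟩

lemma abs (hg : Dominated B g) : Dominated B (fun t => |g t|) :=
  ⟨hg.1.abs, fun t => by rw [abs_abs]; exact hg.2 t⟩

lemma const_mul (hg : Dominated B g) (c : ℝ) : Dominated (|c| * B) (fun t => c * g t) :=
  ⟨hg.1.const_mul c, fun t => by
    rw [abs_mul, mul_assoc]; exact mul_le_mul_of_nonneg_left (hg.2 t) (abs_nonneg c)⟩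

lemma bound_nonneg (hg : Dominated B g) : 0 ≤ B := by
  have := (abs_nonneg _).trans (hg.2 0)
  rwa [window_of_mem (by simp), mul_one] at this

lemma abs_le (hg : Dominated B g) (t : ℝ) : |g t| ≤ B :=
  (hg.2 t).trans (mul_le_of_le_one_right hg.bound_nonneg (window_le_one t))

lemma sum {ι : Type*} (s : Finset ι) {f : ι → ℝ → ℝ} {b : ι → ℝ}
    (hf : ∀ i ∈ s, Dominated (b i) (f i)) :
    Dominated (∑ i ∈ s, b i) (fun t => ∑ i ∈ s, f i t) := by
  refine ⟨Finset.measurable_sum _ fun i hi => (hf i hi).1, fun t => ?_⟩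
  rw [Finset.sum_mul]
  exact (Finset.abs_sum_le_sum_abs _ _).trans (Finset.sum_le_sum fun i hi => (hf i hi).2 t)

lemma of_abs_le (hm : Measurable g') (hg : Dominated B g) (h : ∀ t, |g' t| ≤ |g t|) :
    Dominated B g' := ⟨hm, fun t => (h t).trans (hg.2 t)⟩

lemma integral_abs_le (hg : Dominated B g) : ∫ t, |g t| ≤ B * 4 := by
  rw [← integral_window, ← integral_const_mul]
  exact integral_mono hg.abs.integrable (integrable_window.const_mul B) hg.2

end Dominated

/-! ### The averaging operator, linear part of the evolution. -/

section avgOp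

variable {p : Cell L → ℝ} {g g' : ℝ → ℝ}

lemma measurable_avgOp (hg : Measurable g) : Measurable (avgOp p g) := by
  unfold avgOp
  exact (Finset.measurable_sum _ fun a _ => hg.comp (by fun_prop)).const_mul _

lemma avgOp_mono (h : ∀ t, g t ≤ g' t) (t : ℝ) : avgOp p g t ≤ avgOp p g' t :=
  mul_le_mul_of_nonneg_left (Finset.sum_le_sum fun _ _ => h _) (by positivity)

lemma avgOp_sub : avgOp p (fun t => g t - g' t) = fun t => avgOp p g t - avgOp p g' t := by
  funext t; simp [avgOp, Finset.sum_sub_distrib, mul_sub]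

lemma avgOp_const_mul (c : ℝ) : avgOp p (fun t => c * g t) = fun t => c * avgOp p g t := by
  funext t; simp only [avgOp, ← Finset.mul_sum]; ring

lemma abs_avgOp_le (t : ℝ) : |avgOp p g t| ≤ avgOp p (fun t => |g t|) t := by
  simp only [avgOp, abs_mul, abs_div, abs_one, Nat.abs_cast]
  exact mul_le_mul_of_nonneg_left (Finset.abs_sum_le_sum_abs _ _) (by positivity)

lemma integrable_comp_affine (hL : L ≠ 0) (hg : Integrable g) (c : ℝ) :
    Integrable fun t : ℝ => g (L * t - c) := by
  have := (hg.comp_sub_right c).comp_mul_left' (R := (L : ℝ)) (by exact_mod_cast hL)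
  exact this

lemma integral_comp_affine (c : ℝ) : ∫ t : ℝ, g (L * t - c) = (1 / (L : ℝ)) * ∫ t, g t := by
  have := Measure.integral_comp_mul_left (fun t => g (t - c)) (L : ℝ)
  rw [this, integral_sub_right_eq_self g c]
  simp

lemma integrable_avgOp (hL : L ≠ 0) (hg : Integrable g) : Integrable (avgOp p g) :=
  (integrable_finsetSum _ fun a _ => integrable_comp_affine hL hg (p a)).const_mul _

/-- Each of the `L^2` cells carries `1 / L` of the mass after rescaling, and the prefactor is `1 /
L`: the dynamics is critical. -/
lemma integral_avgOp (hL : L ≠ 0) (hg : Integrable g) : ∫ t, avgOp p g t = ∫ t, g t := by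
  have hL' : (L : ℝ) ≠ 0 := by exact_mod_cast hL
  unfold avgOp
  rw [integral_const_mul, integral_finsetSum _ fun a _ => integrable_comp_affine hL hg (p a)]
  simp only [integral_comp_affine, Finset.sum_const, Finset.card_univ, Fintype.card_prod,
    Fintype.card_fin, nsmul_eq_mul]
  push_cast
  field_simp

lemma integral_abs_avgOp_le (hL : L ≠ 0) (hg : Integrable g) :
    ∫ t, |avgOp p g t| ≤ ∫ t, |g t| := by
  rw [← integral_avgOp (p := p) hL hg.abs]
  exact integral_mono (integrable_avgOp hL hg).abs (integrable_avgOp hL hg.abs) abs_avgOp_le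

/-- The bound on the offsets is what keeps `[-2, 2]` invariant: `|t| > 2` implies `|L t - p a| > 2 L
- 2 (L - 1) = 2`. Inside the window all `L^2` terms are counted. -/
lemma avgOp_window_le (hL : 2 ≤ L) (hp : ∀ a, |p a| ≤ 2 * ((L : ℝ) - 1)) (t : ℝ) :
    avgOp p window t ≤ L * window t := by
  have hL' : (2 : ℝ) ≤ L := by exact_mod_cast hL
  by_cases ht : |t| ≤ 2
  · rw [window_of_mem ht, avgOp]
    have : ∑ a : Cell L, window (L * t - p a) ≤ ∑ a : Cell L, 1 :=
      Finset.sum_le_sum fun a _ => window_le_one _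
    simp only [Finset.sum_const, Finset.card_univ, Fintype.card_prod, Fintype.card_fin,
      nsmul_eq_mul, mul_one] at this
    push_cast at this
    calc _ ≤ 1 / (L : ℝ) * (L * L) := mul_le_mul_of_nonneg_left this (by positivity)
      _ = L * 1 := by field_simp
  · rw [window_of_not_mem (not_le.1 ht), avgOp, Finset.sum_eq_zero]
    · simp
    intro a _
    apply window_of_not_mem
    have h1 := abs_sub_abs_le_abs_sub ((L : ℝ) * t) (p a)
    rw [abs_mul, Nat.abs_cast] at h1
    have := hp a
    have : (L : ℝ) * 2 < L * |t| := by
      apply mul_lt_mul_of_pos_left (not_le.1 ht); linarith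
    linarith

lemma Dominated.avgOp (hL : 2 ≤ L) (hp : ∀ a, |p a| ≤ 2 * ((L : ℝ) - 1)) {B : ℝ}
    (hg : Dominated B g) : Dominated (L * B) (avgOp p g) := by
  refine ⟨measurable_avgOp hg.1, fun t => (abs_avgOp_le t).trans ?_⟩
  refine (avgOp_mono hg.2 t).trans ?_
  rw [avgOp_const_mul]
  have := mul_le_mul_of_nonneg_left (avgOp_window_le hL hp t) hg.bound_nonneg
  linarith

lemma IsSelfSimilarDensity.avgOp_eq {h : ℝ → ℝ} (hL : L ≠ 0) (hh : IsSelfSimilarDensity p h) :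
    avgOp p h = h := by
  have hL' : (L : ℝ) ≠ 0 := by exact_mod_cast hL
  funext t
  rw [avgOp, hh.sum_eq]
  field_simp

/-! Iterates -/

lemma avgOp_iterate_mono (h : ∀ t, g t ≤ g' t) (n : ℕ) (t : ℝ) :
    (avgOp p)^[n] g t ≤ (avgOp p)^[n] g' t := by
  induction n generalizing t with
  | zero => exact h t
  | succ n ih => simp only [Function.iterate_succ_apply']; exact avgOp_mono ih t

lemma avgOp_iterate_sub (n : ℕ) :
    (avgOp p)^[n] (fun t => g t - g' t) = fun t => (avgOp p)^[n] g t - (avgOp p)^[n] g' t := by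
  induction n with
  | zero => rfl
  | succ n ih => simp only [Function.iterate_succ_apply', ih, avgOp_sub]

lemma avgOp_iterate_const_mul (c : ℝ) (n : ℕ) :
    (avgOp p)^[n] (fun t => c * g t) = fun t => c * (avgOp p)^[n] g t := by
  induction n with
  | zero => rfl
  | succ n ih => simp only [Function.iterate_succ_apply', ih, avgOp_const_mul]

lemma abs_avgOp_iterate_le (n : ℕ) (t : ℝ) :
    |(avgOp p)^[n] g t| ≤ (avgOp p)^[n] (fun t => |g t|) t := by
  induction n generalizing t with
  | zero => exact le_rfl
  | succ n ih =>
    simp only [Function.iterate_succ_apply']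
    exact (abs_avgOp_le t).trans (avgOp_mono ih t)

lemma measurable_avgOp_iterate (hg : Measurable g) (n : ℕ) : Measurable ((avgOp p)^[n] g) := by
  induction n with
  | zero => exact hg
  | succ n ih => simp only [Function.iterate_succ_apply']; exact measurable_avgOp ih

lemma integrable_avgOp_iterate (hL : L ≠ 0) (hg : Integrable g) (n : ℕ) :
    Integrable ((avgOp p)^[n] g) := by
  induction n with
  | zero => exact hg
  | succ n ih => simp only [Function.iterate_succ_apply']; exact integrable_avgOp hL ih

lemma integral_avgOp_iterate (hL : L ≠ 0) (hg : Integrable g) (n : ℕ) :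
    ∫ t, (avgOp p)^[n] g t = ∫ t, g t := by
  induction n with
  | zero => rfl
  | succ n ih =>
    simp only [Function.iterate_succ_apply']
    rw [integral_avgOp hL (integrable_avgOp_iterate hL hg n), ih]

lemma integral_abs_avgOp_iterate_le (hL : L ≠ 0) (hg : Integrable g) (n : ℕ) :
    ∫ t, |(avgOp p)^[n] g t| ≤ ∫ t, |g t| := by
  induction n with
  | zero => exact le_rfl
  | succ n ih =>
    simp only [Function.iterate_succ_apply']
    exact (integral_abs_avgOp_le hL (integrable_avgOp_iterate hL hg n)).trans ih

lemma IsSelfSimilarDensity.avgOp_iterate_eq {h : ℝ → ℝ} (hL : L ≠ 0)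
    (hh : IsSelfSimilarDensity p h) (n : ℕ) : (avgOp p)^[n] h = h :=
  Function.iterate_fixed (hh.avgOp_eq hL) n

/-- Every average rescales the line by `L`, so translations of the input are contracted by `L^n`.
All mixing estimates rest on this. -/
lemma avgOp_iterate_shift (hL : L ≠ 0) (v : ℝ) (n : ℕ) (t : ℝ) :
    (avgOp p)^[n] (fun s => g (s + v)) t = (avgOp p)^[n] g (t + v / L ^ n) := by
  have hL' : (L : ℝ) ≠ 0 := by exact_mod_cast hL
  induction n generalizing t with
  | zero => simp
  | succ n ih =>
    simp only [Function.iterate_succ_apply', avgOp, ih]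
    congr 1
    refine Finset.sum_congr rfl fun a _ => ?_
    have : (L : ℝ) * (t + v / L ^ (n + 1)) - p a = L * t - p a + v / L ^ n := by
      rw [pow_succ]; field_simp; ring
    rw [this]

/-- Offset of the square with address `w`, rescaled to unit size. -/
def wordOffset (p : Cell L → ℝ) : (n : ℕ) → (Fin n → Cell L) → ℝ
  | 0, _ => 0
  | n + 1, w => L ^ n * p (w 0) + wordOffset p n (Fin.tail w)

lemma avgOp_iterate_eq_sum (n : ℕ) (t : ℝ) :
    (avgOp p)^[n] g t =
      (1 / (L : ℝ) ^ n) * ∑ w : Fin n → Cell L, g (L ^ n * t - wordOffset p n w) := by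
  induction n generalizing t with
  | zero => simp [wordOffset]
  | succ n ih =>
    simp only [Function.iterate_succ_apply', avgOp, ih]
    have key : ∀ G : (Fin (n + 1) → Cell L) → ℝ,
        ∑ w, G w = ∑ a : Cell L, ∑ w : Fin n → Cell L, G (Fin.cons a w) := fun G => by
      rw [← (Fin.consEquiv fun _ : Fin (n + 1) => Cell L).sum_comp]
      exact Fintype.sum_prod_type _
    rw [key, ← Finset.mul_sum, ← mul_assoc, pow_succ]
    congr 1
    · rw [one_div_mul_one_div, mul_comm]
    refine Finset.sum_congr rfl fun a _ => Finset.sum_congr rfl fun w _ => ?_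
    simp only [wordOffset, Fin.cons_zero, Fin.tail_cons]
    congr 1
    ring

end avgOp

end

/-! ### Mixing of the averaging operator. -/

section

variable {L : ℕ}

lemma measurable_window_half : Measurable fun v : ℝ => window (v / 2) :=
  measurable_window.comp (by fun_prop)

lemma integrable_window_half : Integrable fun v : ℝ => window (v / 2) :=
  integrable_window.comp_div two_ne_zero

lemma integral_window_half : ∫ v : ℝ, window (v / 2) = 8 := by
  rw [Measure.integral_comp_div window 2, integral_window]
  norm_num

section Mixing

variable {p : Cell L → ℝ} {h : ℝ → ℝ}

lemma avgOp_iterate_integral {k : ℝ → ℝ → ℝ} (hk : ∀ t, Integrable fun v => k v t) (n : ℕ) (t : ℝ) :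
    (avgOp p)^[n] (fun t => ∫ v, k v t) t = ∫ v, (avgOp p)^[n] (k v) t := by
  simp only [avgOp_iterate_eq_sum]
  rw [integral_const_mul, integral_finsetSum _ fun w _ => hk _]

/-- For `|t| ≤ 2` the weight equals `1` wherever `h (t + v)` is nonzero, so the integral is `∫ h =
1`. A rough function is thus dominated by a superposition of translates of the fixed density. -/
lemma window_le_integral_shift (hh : IsSelfSimilarDensity p h) (t : ℝ) :
    window t ≤ ∫ v, window (v / 2) * h (t + v) := by
  by_cases ht : |t| ≤ 2
  · have : ∀ v, window (v / 2) * h (t + v) = h (t + v) := fun v => by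
      by_cases hv : |v / 2| ≤ 2
      · rw [window_of_mem hv, one_mul]
      · have h1 : 2 < |t + v| := by
          rw [abs_div, abs_two] at hv
          have := abs_sub_abs_le_abs_sub v (-t)
          rw [abs_neg, sub_neg_eq_add, add_comm v t] at this
          have : 4 < |v| := by
            by_contra hc; exact hv (by linarith)
          linarith
        have h2 := hh.le_window (t + v)
        rw [window_of_not_mem h1] at h2
        have : h (t + v) = 0 := le_antisymm (by linarith) (hh.nonneg _)
        rw [this, mul_zero]
    simp only [this]
    rw [integral_add_left_eq_self h t, hh.integral_eq_one]
    exact window_le_one t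
  · rw [window_of_not_mem (not_le.1 ht)]
    exact integral_nonneg fun v => mul_nonneg (window_nonneg _) (hh.nonneg _)

lemma integrable_window_mul_shift (hh : IsSelfSimilarDensity p h) (c t : ℝ) :
    Integrable fun v => window (v / 2) * h (t + v / c) := by
  refine (integrable_window_half.mul_const 2).mono' ?_ (ae_of_all _ fun v => ?_)
  · exact (measurable_window_half.mul (hh.measurable.comp (by fun_prop))).aestronglyMeasurable
  · rw [Real.norm_eq_abs, abs_of_nonneg (mul_nonneg (window_nonneg _) (hh.nonneg _))]
    exact mul_le_mul_of_nonneg_left (hh.le_two _) (window_nonneg _)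

/-- Averaging leaves `h` fixed and only shrinks the translations in the dominating superposition. -/
lemma avgOp_iterate_window_le (hL : L ≠ 0) (hh : IsSelfSimilarDensity p h) (n : ℕ) (t : ℝ) :
    (avgOp p)^[n] window t ≤ ∫ v, window (v / 2) * h (t + v / L ^ n) := by
  refine (avgOp_iterate_mono (window_le_integral_shift hh) n t).trans (le_of_eq ?_)
  rw [avgOp_iterate_integral (k := fun v t => window (v / 2) * h (t + v))
    fun t => by simpa using integrable_window_mul_shift hh 1 t]
  congr 1
  funext v
  rw [avgOp_iterate_const_mul]
  beta_reduce
  rw [avgOp_iterate_shift hL, hh.avgOp_iterate_eq hL]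

lemma avgOp_iterate_window_le_const (hL : L ≠ 0) (hh : IsSelfSimilarDensity p h) (n : ℕ) (t : ℝ) :
    (avgOp p)^[n] window t ≤ 16 := by
  refine (avgOp_iterate_window_le hL hh n t).trans ?_
  calc _ ≤ ∫ v, window (v / 2) * 2 :=
        integral_mono (integrable_window_mul_shift hh _ _) (integrable_window_half.mul_const 2)
          fun v => mul_le_mul_of_nonneg_left (hh.le_two _) (window_nonneg _)
    _ = 16 := by rw [integral_mul_const, integral_window_half]; norm_num

lemma avgOp_iterate_window_eq_zero (hL : 2 ≤ L) (hp : ∀ a, |p a| ≤ 2 * ((L : ℝ) - 1)) (n : ℕ)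
    {t : ℝ} (ht : 2 < |t|) : (avgOp p)^[n] window t = 0 := by
  have : Dominated ((fun b => (L : ℝ) * b)^[n] 1) ((avgOp p)^[n] window) := by
    induction n with
    | zero => exact dominated_window
    | succ n ih => simp only [Function.iterate_succ_apply']; exact ih.avgOp hL hp
  have := this.2 t
  rw [window_of_not_mem ht, mul_zero] at this
  exact abs_eq_zero.1 (le_antisymm this (abs_nonneg _))

lemma avgOp_iterate_window_le_window (hL : 2 ≤ L) (hh : IsSelfSimilarDensity p h) (n : ℕ) (t : ℝ) :
    (avgOp p)^[n] window t ≤ 16 * window t := by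
  by_cases ht : |t| ≤ 2
  · rw [window_of_mem ht, mul_one]; exact avgOp_iterate_window_le_const (by omega) hh n t
  · rw [avgOp_iterate_window_eq_zero hL hh.offset_le n (not_le.1 ht)]
    exact mul_nonneg (by norm_num) (window_nonneg _)

lemma Dominated.avgOp_iterate (hL : 2 ≤ L) (hh : IsSelfSimilarDensity p h) {B : ℝ} {g : ℝ → ℝ}
    (hg : Dominated B g) (n : ℕ) : Dominated (16 * B) ((RandomGrid.avgOp p)^[n] g) := by
  refine ⟨measurable_avgOp_iterate hg.1 n, fun t => (abs_avgOp_iterate_le n t).trans ?_⟩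
  refine (avgOp_iterate_mono hg.2 n t).trans ?_
  rw [avgOp_iterate_const_mul]
  have := mul_le_mul_of_nonneg_left (avgOp_iterate_window_le_window hL hh n t) hg.bound_nonneg
  linarith

lemma integrable_prod_shift (hh : IsSelfSimilarDensity p h) {c : ℝ} (hc : 1 ≤ c) :
    Integrable (fun z : ℝ × ℝ => window (z.2 / 2) * |h (z.1 + z.2 / c) - h z.1|)
      (volume.prod volume) := by
  -- Where the weight is nonzero the shift is at most `4`, because `1 ≤ c`; so the first variable
  -- stays in `[-6, 6]`, which is the window dilated by `3`.
  have hdom : Integrable (fun z : ℝ × ℝ => 2 * window (z.1 / 3) * window (z.2 / 2))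
      (volume.prod volume) :=
    ((integrable_window.comp_div three_ne_zero).const_mul 2).mul_prod integrable_window_half
  refine hdom.mono' ?_ (ae_of_all _ fun z => ?_)
  · have := hh.measurable
    have := measurable_window
    exact Measurable.aestronglyMeasurable (by fun_prop)
  · rw [Real.norm_eq_abs, abs_of_nonneg (mul_nonneg (window_nonneg _) (abs_nonneg _)), mul_comm]
    by_cases hv : |z.2 / 2| ≤ 2
    · refine mul_le_mul_of_nonneg_right ?_ (window_nonneg _)
      have h1 := hh.le_window z.1
      have h2 := hh.le_window (z.1 + z.2 / c)
      have h3 := hh.nonneg z.1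
      have h4 := hh.nonneg (z.1 + z.2 / c)
      by_cases ht : |z.1 / 3| ≤ 2
      · rw [window_of_mem ht, abs_le]
        have := window_le_one z.1
        have := window_le_one (z.1 + z.2 / c)
        constructor <;> linarith
      · have ht' : 6 < |z.1| := by
          rw [abs_div, abs_of_pos (three_pos : (0 : ℝ) < 3)] at ht
          by_contra hcon; exact ht (by linarith)
        have hv' : |z.2 / c| ≤ 4 := by
          rw [abs_div, abs_two] at hv
          rw [abs_div, abs_of_pos (by linarith : 0 < c)]
          calc |z.2| / c ≤ |z.2| / 1 := div_le_div_of_nonneg_left (abs_nonneg _) one_pos hc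
            _ ≤ 4 := by linarith
        have h5 : 2 < |z.1 + z.2 / c| := by
          have := abs_sub_abs_le_abs_sub z.1 (-(z.2 / c))
          rw [abs_neg, sub_neg_eq_add] at this
          linarith
        rw [window_of_not_mem h5] at h2
        rw [window_of_not_mem (by linarith)] at h1
        rw [le_antisymm (by linarith) h3, le_antisymm (by linarith : h (z.1 + z.2 / c) ≤ 0) h4]
        simpa using window_nonneg _
    · rw [window_of_not_mem (not_le.1 hv)]; simp

/-- In `L¹`, iterated averages of the indicator of `[-2, 2]` are almost bounded by `8 h`. -/
lemma integral_max_avgOp_iterate_window_le (hL : 2 ≤ L) (hh : IsSelfSimilarDensity p h) (n : ℕ) :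
    ∫ t, max ((avgOp p)^[n] window t - 8 * h t) 0 ≤ 128 / L ^ n := by
  have hLn : (1 : ℝ) ≤ (L : ℝ) ^ n := one_le_pow₀ (by exact_mod_cast (by omega : 1 ≤ L))
  have hI := integrable_prod_shift hh hLn
  have hpt : ∀ t, max ((avgOp p)^[n] window t - 8 * h t) 0 ≤
      ∫ v, window (v / 2) * |h (t + v / L ^ n) - h t| := fun t => by
    have hi : Integrable fun v => window (v / 2) * |h (t + v / L ^ n) - h t| := by
      refine (integrable_window_half.mul_const 4).mono' ?_ (ae_of_all _ fun v => ?_)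
      · have := hh.measurable
        have := measurable_window
        exact Measurable.aestronglyMeasurable (by fun_prop)
      · rw [Real.norm_eq_abs, abs_of_nonneg (mul_nonneg (window_nonneg _) (abs_nonneg _))]
        refine mul_le_mul_of_nonneg_left ?_ (window_nonneg _)
        have h1 := hh.le_two t
        have h2 := hh.le_two (t + v / L ^ n)
        have h3 := hh.nonneg t
        have h4 := hh.nonneg (t + v / L ^ n)
        rw [abs_le]; constructor <;> linarith
    refine max_le ?_ (integral_nonneg fun v => mul_nonneg (window_nonneg _) (abs_nonneg _))
    -- The factor `8` is the mass of the weight `window (v / 2)`: the superposition without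
    -- translations is exactly `8 h`.
    have h8 : 8 * h t = ∫ v, window (v / 2) * h t := by
      rw [integral_mul_const, integral_window_half]
    calc (avgOp p)^[n] window t - 8 * h t
        ≤ (∫ v, window (v / 2) * h (t + v / L ^ n)) - ∫ v, window (v / 2) * h t := by
          rw [← h8]; linarith [avgOp_iterate_window_le (by omega) hh n t]
      _ = ∫ v, (window (v / 2) * h (t + v / L ^ n) - window (v / 2) * h t) :=
          (integral_sub (integrable_window_mul_shift hh _ _)
            (integrable_window_half.mul_const _)).symm
      _ ≤ _ := integral_mono ((integrable_window_mul_shift hh _ _).sub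
            (integrable_window_half.mul_const _)) hi fun v => by
          rw [← mul_sub]; exact mul_le_mul_of_nonneg_left (le_abs_self _) (window_nonneg _)
  have hD : Dominated 16 (fun t => (avgOp p)^[n] window t) := by
    simpa using dominated_window.avgOp_iterate hL hh n
  have hm : Integrable fun t => max ((avgOp p)^[n] window t - 8 * h t) 0 :=
    (hD.integrable.sub (hh.dominated.integrable.const_mul 8)).pos_part
  calc _ ≤ ∫ t, ∫ v, window (v / 2) * |h (t + v / L ^ n) - h t| :=
        integral_mono hm hI.integral_prod_left hpt
    _ = ∫ v, ∫ t, window (v / 2) * |h (t + v / L ^ n) - h t| := integral_integral_swap hI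
    _ ≤ ∫ v, window (v / 2) * (16 / L ^ n) := by
        refine integral_mono hI.integral_prod_right (integrable_window_half.mul_const _) fun v => ?_
        dsimp only
        rw [integral_const_mul]
        by_cases hv : |v / 2| ≤ 2
        · refine mul_le_mul_of_nonneg_left ((hh.shift _).trans ?_) (window_nonneg _)
          rw [abs_div, abs_two] at hv
          rw [abs_div, abs_of_pos (by linarith : (0 : ℝ) < (L : ℝ) ^ n), mul_div_assoc']
          exact div_le_div_of_nonneg_right (by linarith) (by linarith)
        · rw [window_of_not_mem (not_le.1 hv)]; simp
    _ = 128 / L ^ n := by rw [integral_mul_const, integral_window_half]; ring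

/-- Decay of correlations, for a function `φ` of mean zero. -/
lemma abs_integral_avgOp_iterate_mul_le (hL : 2 ≤ L) (hh : IsSelfSimilarDensity p h) {B : ℝ}
    {φ χ : ℝ → ℝ} (hφ : Dominated B φ) (hφ0 : ∫ t, φ t = 0) (hχm : Measurable χ)
    (hχ : Integrable χ) (n : ℕ) {E : ℝ}
    (hE : ∀ v, |v| ≤ 4 → ∫ t, |χ t - χ (t + v / L ^ n)| ≤ E) :
    |∫ t, (avgOp p)^[n] φ t * χ t| ≤ 32 * B * E := by
  have hB := hφ.bound_nonneg
  have hw := measurable_window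
  have hφm := hφ.1
  -- A mean-zero `φ` is a superposition of differences between a function and a translate. Indeed `∫
  -- k v t dv = φ t`, as `window` has mass `4`, while `∫ k (-v) (t + v) dv` is `window t / 4` times
  -- `∫ φ = 0`; and `t ↦ k (-v) (t + v)` is a translate by `v`.
  set k : ℝ → ℝ → ℝ := fun v t => φ t * (window (t + v) / 4) with hk
  have hkb : ∀ v t, |k v t| ≤ B / 4 * window (v / 2) * window t := fun v t => by
    simp only [hk, abs_mul, abs_div, abs_of_nonneg (window_nonneg _)]
    rw [abs_of_pos (four_pos : (0 : ℝ) < 4)]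
    by_cases ht : |t| ≤ 2
    · by_cases hv : |v / 2| ≤ 2
      · rw [window_of_mem hv]
        have := hφ.2 t
        have := mul_le_mul this (window_le_one (t + v)) (window_nonneg _)
          (mul_nonneg hB (window_nonneg _))
        linarith
      · have h1 : 2 < |t + v| := by
          rw [abs_div, abs_two] at hv
          have := abs_sub_abs_le_abs_sub v (-t)
          rw [abs_neg, sub_neg_eq_add, add_comm v t] at this
          have : 4 < |v| := by
            by_contra hc; exact hv (by linarith)
          linarith
        rw [window_of_not_mem h1]
        have := mul_nonneg (mul_nonneg (div_nonneg hB four_pos.le) (window_nonneg (v / 2)))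
          (window_nonneg t)
        simpa using this
    · have := hφ.2 t
      rw [window_of_not_mem (not_le.1 ht)] at this ⊢
      have : |φ t| = 0 := le_antisymm (by linarith) (abs_nonneg _)
      simp [this]
  have hTk : ∀ v t, |(avgOp p)^[n] (k v) t| ≤ 4 * B * window (v / 2) := fun v t => by
    refine (abs_avgOp_iterate_le n t).trans ((avgOp_iterate_mono (hkb v) n t).trans ?_)
    rw [avgOp_iterate_const_mul]
    have h1 := avgOp_iterate_window_le_const (by omega) hh n t
    have h2 : 0 ≤ B / 4 * window (v / 2) := mul_nonneg (by positivity) (window_nonneg _)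
    have := mul_le_mul_of_nonneg_left h1 h2
    linarith
  have hTm : Measurable fun z : ℝ × ℝ => (avgOp p)^[n] (k z.2) z.1 := by
    simp only [avgOp_iterate_eq_sum, hk]
    fun_prop
  have hki : ∀ t, Integrable fun v => k v t := fun t => by
    refine (integrable_window_half.const_mul (B / 4)).mono' ?_ (ae_of_all _ fun v => ?_)
    · exact Measurable.aestronglyMeasurable (by fun_prop)
    · exact (hkb v t).trans (mul_le_of_le_one_right
        (mul_nonneg (by positivity) (window_nonneg _)) (window_le_one t))
  have hki' : ∀ t, Integrable fun v => k (-v) (t + v) := fun t => by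
    simp only [hk]
    have : (fun v => φ (t + v) * (window (t + v + -v) / 4)) =
        fun v => φ (t + v) * (window t / 4) := by
      funext v; congr 3; ring
    rw [this]
    exact (hφ.integrable.comp_add_left t).mul_const _
  have hφk : ∀ t, φ t = ∫ v, (k v t - k (-v) (t + v)) := fun t => by
    rw [integral_sub (hki t) (hki' t)]
    have h1 : ∫ v, k v t = φ t := by
      simp only [hk]
      rw [integral_const_mul, integral_div, integral_add_left_eq_self window t, integral_window]
      ring
    have h2 : ∫ v, k (-v) (t + v) = 0 := by
      simp only [hk]
      have : (fun v => φ (t + v) * (window (t + v + -v) / 4)) =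
          fun v => φ (t + v) * (window t / 4) := by
        funext v; congr 3; ring
      rw [this, integral_mul_const, integral_add_left_eq_self φ t, hφ0, zero_mul]
    rw [h1, h2, sub_zero]
  have hTφ : ∀ t, (avgOp p)^[n] φ t =
      ∫ v, ((avgOp p)^[n] (k v) t - (avgOp p)^[n] (k (-v)) (t + v / L ^ n)) := fun t => by
    have h1 : φ = fun t => ∫ v, (k v t - k (-v) (t + v)) := funext hφk
    conv_lhs => rw [h1]
    rw [avgOp_iterate_integral (k := fun v t => k v t - k (-v) (t + v))
      fun t => (hki t).sub (hki' t)]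
    congr 1
    funext v
    rw [avgOp_iterate_sub]
    beta_reduce
    rw [avgOp_iterate_shift (by omega)]
  have hdom : Integrable (fun z : ℝ × ℝ => |χ z.1| * (4 * B * window (z.2 / 2)))
      (volume.prod volume) := hχ.abs.mul_prod (integrable_window_half.const_mul _)
  have hI1 : Integrable (fun z : ℝ × ℝ => (avgOp p)^[n] (k z.2) z.1 * χ z.1)
      (volume.prod volume) := by
    refine hdom.mono' (hTm.mul (hχm.comp measurable_fst)).aestronglyMeasurable
      (ae_of_all _ fun z => ?_)
    rw [norm_mul, mul_comm]
    exact mul_le_mul_of_nonneg_left (hTk z.2 z.1) (norm_nonneg _)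
  have hI2 : Integrable (fun z : ℝ × ℝ => (avgOp p)^[n] (k (-z.2)) (z.1 + z.2 / L ^ n) * χ z.1)
      (volume.prod volume) := by
    refine hdom.mono' ?_ (ae_of_all _ fun z => ?_)
    · refine (Measurable.mul ?_ (hχm.comp measurable_fst)).aestronglyMeasurable
      exact hTm.comp (f := fun z : ℝ × ℝ => (z.1 + z.2 / (L : ℝ) ^ n, -z.2)) (by fun_prop)
    · rw [norm_mul, mul_comm]
      refine mul_le_mul_of_nonneg_left ((hTk (-z.2) _).trans (le_of_eq ?_)) (norm_nonneg _)
      simp only [window_eq_ite, neg_div, abs_neg]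
  -- Replace `v` by `-v` in the second term and translate `t`: the contracted shift then falls on
  -- `χ`, whose modulus of continuity in `L¹` is `E`.
  have step : ∫ t, (avgOp p)^[n] φ t * χ t =
      ∫ v, ∫ t, (avgOp p)^[n] (k v) t * (χ t - χ (t + v / L ^ n)) := by
    have e1 : ∫ t, (avgOp p)^[n] φ t * χ t = ∫ t, ∫ v, ((avgOp p)^[n] (k v) t * χ t -
        (avgOp p)^[n] (k (-v)) (t + v / L ^ n) * χ t) := by
      congr 1; funext t
      rw [hTφ t, ← integral_mul_const]
      congr 1; funext v; ring
    rw [e1, integral_integral_swap (hI1.sub hI2)]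
    have e2 : ∀ᵐ v : ℝ, ∫ t, ((avgOp p)^[n] (k v) t * χ t -
        (avgOp p)^[n] (k (-v)) (t + v / L ^ n) * χ t) = (∫ t, (avgOp p)^[n] (k v) t * χ t) -
        ∫ t, (avgOp p)^[n] (k (-v)) (t + v / L ^ n) * χ t := by
      filter_upwards [hI1.prod_left_ae, hI2.prod_left_ae] with v h1 h2
      exact integral_sub h1 h2
    rw [integral_congr_ae e2, integral_sub hI1.integral_prod_right hI2.integral_prod_right,
      ← integral_neg_eq_self fun v => ∫ t, (avgOp p)^[n] (k (-v)) (t + v / L ^ n) * χ t]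
    have hI3 : Integrable fun v : ℝ =>
        ∫ t, (avgOp p)^[n] (k (-(-v))) (t + (-v) / L ^ n) * χ t :=
      hI2.integral_prod_right.comp_neg
    rw [← integral_sub hI1.integral_prod_right hI3]
    refine integral_congr_ae ?_
    filter_upwards [hI1.prod_left_ae] with v h1
    have e3 : ∫ t, (avgOp p)^[n] (k (-(-v))) (t + (-v) / L ^ n) * χ t =
        ∫ t, (avgOp p)^[n] (k v) t * χ (t + v / L ^ n) := by
      rw [← integral_add_right_eq_self _ (v / (L : ℝ) ^ n), neg_neg]
      congr 1; funext t
      rw [show t + v / (L : ℝ) ^ n + -v / (L : ℝ) ^ n = t by ring]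
    have h2 : Integrable fun t => (avgOp p)^[n] (k v) t * χ (t + v / L ^ n) := by
      refine ((hχ.comp_add_right (v / (L : ℝ) ^ n)).abs.const_mul (4 * B * window (v / 2))).mono' ?_
        (ae_of_all _ fun t => ?_)
      · exact ((hTm.comp (by fun_prop : Measurable fun t : ℝ => (t, v))).mul
          (hχm.comp (by fun_prop))).aestronglyMeasurable
      · rw [norm_mul]
        exact mul_le_mul_of_nonneg_right (hTk v t) (norm_nonneg _)
    rw [e3, ← integral_sub h1 h2]
    congr 1; funext t; ring
  rw [step]
  have hbound : ∀ v, ‖∫ t, (avgOp p)^[n] (k v) t * (χ t - χ (t + v / L ^ n))‖ ≤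
      4 * B * E * window (v / 2) := fun v => by
    refine (norm_integral_le_integral_norm _).trans ?_
    have hi : Integrable fun t => |χ t - χ (t + v / L ^ n)| :=
      (hχ.sub (hχ.comp_add_right (v / (L : ℝ) ^ n))).abs
    calc _ ≤ ∫ t, 4 * B * window (v / 2) * |χ t - χ (t + v / L ^ n)| := by
          refine integral_mono_of_nonneg (ae_of_all _ fun _ => norm_nonneg _)
            (hi.const_mul _) (ae_of_all _ fun t => ?_)
          dsimp only
          rw [norm_mul]
          exact mul_le_mul_of_nonneg_right (hTk v t) (norm_nonneg _)
      _ = 4 * B * window (v / 2) * ∫ t, |χ t - χ (t + v / L ^ n)| := integral_const_mul _ _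
      _ ≤ _ := by
          by_cases hv : |v / 2| ≤ 2
          · have : |v| ≤ 4 := by rw [abs_div, abs_two] at hv; linarith
            have := mul_le_mul_of_nonneg_left (hE v this)
              (mul_nonneg (by positivity) (window_nonneg _) : 0 ≤ 4 * B * window (v / 2))
            linarith
          · rw [window_of_not_mem (not_le.1 hv)]; simp
  rw [← Real.norm_eq_abs]
  refine (norm_integral_le_integral_norm _).trans ?_
  calc _ ≤ ∫ v, 4 * B * E * window (v / 2) :=
        integral_mono_of_nonneg (ae_of_all _ fun _ => norm_nonneg _)
          (integrable_window_half.const_mul _) (ae_of_all _ hbound)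
    _ = 32 * B * E := by rw [integral_const_mul, integral_window_half]; ring

end Mixing

end

/-! ### Ergodic sums of the averaging operator. -/

section

variable {L : ℕ}

lemma Dominated.integrable_mul {b b' : ℝ} {u v : ℝ → ℝ} (hu : Dominated b u)
    (hv : Dominated b' v) : Integrable fun t => u t * v t := by
  refine (hv.integrable.abs.const_mul b).mono' (hu.1.mul hv.1).aestronglyMeasurable
    (ae_of_all _ fun t => ?_)
  rw [norm_mul]
  exact mul_le_mul_of_nonneg_right (hu.abs_le t) (norm_nonneg _)

section ErgodicSum

variable {p : Cell L → ℝ} {h : ℝ → ℝ}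

lemma avgOp_sum {ι : Type*} (s : Finset ι) (f : ι → ℝ → ℝ) :
    avgOp p (fun t => ∑ i ∈ s, f i t) = fun t => ∑ i ∈ s, avgOp p (f i) t := by
  funext t
  simp only [avgOp, ← Finset.mul_sum]
  rw [Finset.sum_comm]

/-- A translation of the `i`-th average by `v / L^(i + l)` is the `i`-th average of a translation by
`v / L^l`. Since averaging is an `L¹` contraction, only the gap `l` matters. -/
lemma abs_integral_avgOp_iterate_mul_iterate_le (hL : 2 ≤ L) (hh : IsSelfSimilarDensity p h)
    {B E : ℝ} {φ : ℝ → ℝ} (hφ : Dominated B φ) (hφ0 : ∫ t, φ t = 0)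
    (hE : ∀ v, ∫ t, |φ (t + v) - φ t| ≤ E * |v|) (i l : ℕ) :
    |∫ t, (avgOp p)^[i + l] φ t * (avgOp p)^[i] φ t| ≤ 128 * B * E / L ^ l := by
  have hL0 : L ≠ 0 := by omega
  have hL' : (0 : ℝ) < L := by exact_mod_cast (by omega : 0 < L)
  have hE0 : 0 ≤ E := by
    have := (integral_nonneg fun t => abs_nonneg (φ (t + 1) - φ t)).trans (hE 1)
    simpa using this
  have hD := hφ.avgOp_iterate hL hh i
  have := abs_integral_avgOp_iterate_mul_le hL hh hφ hφ0 hD.1 hD.integrable (i + l)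
    (E := 4 * E / L ^ l) (fun v hv => ?_)
  · refine this.trans (le_of_eq (by ring))
  have e : ∀ t, (avgOp p)^[i] φ t - (avgOp p)^[i] φ (t + v / L ^ (i + l)) =
      (avgOp p)^[i] (fun t => φ t - φ (t + v / L ^ l)) t := fun t => by
    rw [avgOp_iterate_sub]
    beta_reduce
    rw [avgOp_iterate_shift hL0]
    rw [div_div, ← pow_add, add_comm l i]
  simp only [e]
  have hi : Integrable fun t => φ t - φ (t + v / L ^ l) :=
    hφ.integrable.sub (hφ.integrable.comp_add_right _)
  refine (integral_abs_avgOp_iterate_le hL0 hi i).trans ?_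
  simp only [abs_sub_comm (φ _) (φ (_ + _))]
  refine (hE _).trans ?_
  rw [abs_div, abs_of_pos (pow_pos hL' l), mul_div_assoc']
  refine div_le_div_of_nonneg_right ?_ (pow_pos hL' l).le
  nlinarith

lemma sum_range_inv_pow_sub_le (hL : 2 ≤ L) (K : ℕ) :
    ∑ i ∈ Finset.range K, 1 / (L : ℝ) ^ (K - i) ≤ 1 := by
  have hL' : (2 : ℝ) ≤ L := by exact_mod_cast hL
  suffices H : ∑ i ∈ Finset.range K, 1 / (L : ℝ) ^ (K - i) ≤ 1 - 1 / (L : ℝ) ^ K by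
    have : 0 < 1 / (L : ℝ) ^ K := by positivity
    linarith
  induction K with
  | zero => simp
  | succ K ih =>
    rw [Finset.sum_range_succ']
    simp only [Nat.add_sub_add_right, Nat.sub_zero]
    have h1 : 2 * (1 / (L : ℝ) ^ (K + 1)) ≤ 1 / (L : ℝ) ^ K := by
      rw [pow_succ, ← mul_div_assoc, mul_one, div_le_div_iff₀ (by positivity) (by positivity)]
      have : (0 : ℝ) < (L : ℝ) ^ K := by positivity
      nlinarith
    linarith

/-- Quantitative mean ergodic theorem. -/
lemma integral_abs_sum_avgOp_iterate_le (hL : 2 ≤ L) (hh : IsSelfSimilarDensity p h)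
    {B E : ℝ} {φ : ℝ → ℝ} (hφ : Dominated B φ) (hφ0 : ∫ t, φ t = 0)
    (hE : ∀ v, ∫ t, |φ (t + v) - φ t| ≤ E * |v|) (K : ℕ) :
    ∫ t, |∑ i ∈ Finset.range K, (avgOp p)^[i] φ t| ≤
      3 * √(1024 * B ^ 2 + 256 * B * E + 1) * √K := by
  have hB := hφ.bound_nonneg
  have hE0 : 0 ≤ E := by
    have := (integral_nonneg fun t => abs_nonneg (φ (t + 1) - φ t)).trans (hE 1)
    simpa using this
  have hD := fun i => hφ.avgOp_iterate hL hh i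
  set F : ℕ → ℝ → ℝ := fun K t => ∑ i ∈ Finset.range K, (avgOp p)^[i] φ t with hF
  have hFD : ∀ K, ∃ b, Dominated b (F K) := fun K =>
    ⟨_, Dominated.sum (Finset.range K) fun i _ => hD i⟩
  set Q : ℝ := 1024 * B ^ 2 + 256 * B * E + 1 with hQ
  have hQ1 : 1 ≤ Q := by rw [hQ]; nlinarith [mul_nonneg hB hE0, sq_nonneg B]
  -- One more term adds a diagonal integral of at most `(16 B)^2 * 4` and twice a geometric sum of
  -- correlations, hence a bounded amount `Q`; the summand `1` in `Q` only ensures positivity.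
  have sq : ∀ K : ℕ, ∫ t, F K t * F K t ≤ K * Q := fun K => by
    induction K with
    | zero => simp [hF]
    | succ K ih =>
      obtain ⟨b, hb⟩ := hFD K
      have e : ∀ t, F (K + 1) t * F (K + 1) t = F K t * F K t +
          2 * ∑ i ∈ Finset.range K, (avgOp p)^[K] φ t * (avgOp p)^[i] φ t +
          (avgOp p)^[K] φ t * (avgOp p)^[K] φ t := fun t => by
        simp only [hF, Finset.sum_range_succ]
        rw [← Finset.mul_sum]
        ring
      simp only [e]
      have i1 := hb.integrable_mul hb
      have i2 : ∀ i ∈ Finset.range K,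
          Integrable fun t => (avgOp p)^[K] φ t * (avgOp p)^[i] φ t :=
        fun i _ => (hD K).integrable_mul (hD i)
      have i3 := (hD K).integrable_mul (hD K)
      have i4 : Integrable fun t => F K t * F K t +
          2 * ∑ i ∈ Finset.range K, (avgOp p)^[K] φ t * (avgOp p)^[i] φ t :=
        i1.add ((integrable_finsetSum _ i2).const_mul 2)
      rw [integral_add i4 i3,
        integral_add i1 ((integrable_finsetSum _ i2).const_mul 2), integral_const_mul,
        integral_finsetSum _ i2]
      have b1 : ∑ i ∈ Finset.range K, ∫ t, (avgOp p)^[K] φ t * (avgOp p)^[i] φ t ≤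
          128 * B * E := by
        calc _ ≤ ∑ i ∈ Finset.range K, 128 * B * E * (1 / (L : ℝ) ^ (K - i)) := by
              refine Finset.sum_le_sum fun i hi => ?_
              have := abs_integral_avgOp_iterate_mul_iterate_le hL hh hφ hφ0 hE i (K - i)
              rw [Nat.add_sub_cancel' (Finset.mem_range.1 hi).le] at this
              exact (le_abs_self _).trans (this.trans (le_of_eq (by ring)))
          _ ≤ _ := by
              rw [← Finset.mul_sum]
              exact mul_le_of_le_one_right (by positivity) (sum_range_inv_pow_sub_le hL K)
      have b2 : ∫ t, (avgOp p)^[K] φ t * (avgOp p)^[K] φ t ≤ 1024 * B ^ 2 := by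
        calc _ ≤ ∫ t, (16 * B) ^ 2 * window t := by
              refine integral_mono i3 (integrable_window.const_mul _) fun t => ?_
              have h1 := (hD K).2 t
              have h2 := (hD K).abs_le t
              calc _ = |(avgOp p)^[K] φ t| * |(avgOp p)^[K] φ t| := (abs_mul_abs_self _).symm
                _ ≤ (16 * B) * (16 * B * window t) :=
                  mul_le_mul h2 h1 (abs_nonneg _) (by positivity)
                _ = _ := by ring
          _ = _ := by rw [integral_const_mul, integral_window]; ring
      push_cast
      rw [hQ] at ih ⊢
      linarith
  rcases Nat.eq_zero_or_pos K with rfl | hK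
  · simp
  have hK' : (1 : ℝ) ≤ K := by exact_mod_cast hK
  obtain ⟨b, hb⟩ := hFD K
  -- From `L²` to `L¹` by the pointwise bound `|F| ≤ (F^2 / s + s) / 2` on the window, with `s` the
  -- size of the `L²` norm.
  set s := √Q * √K with hs
  have hs0 : 0 < s := mul_pos (Real.sqrt_pos.2 (by linarith)) (Real.sqrt_pos.2 (by linarith))
  have hss : s * s = K * Q := by
    rw [hs, mul_mul_mul_comm, Real.mul_self_sqrt (by linarith), Real.mul_self_sqrt (by linarith),
      mul_comm]
  calc _ ≤ ∫ t, (1 / 2) * ((1 / s) * (F K t * F K t) + s * window t) := by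
        refine integral_mono hb.abs.integrable
          ((((hb.integrable_mul hb).const_mul _).add (integrable_window.const_mul _)).const_mul _)
          fun t => ?_
        change |F K t| ≤ _
        by_cases ht : |t| ≤ 2
        · rw [window_of_mem ht]
          have : (|F K t| - s) ^ 2 ≥ 0 := sq_nonneg _
          have h2 : |F K t| * |F K t| = F K t * F K t := abs_mul_abs_self _
          have : 2 * s * |F K t| ≤ F K t * F K t + s * s := by nlinarith
          have h3 : (1 / 2) * ((1 / s) * (F K t * F K t) + s * 1) =
            (F K t * F K t + s * s) / (2 * s) := by field_simp
          rw [h3, le_div_iff₀ (by positivity)]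
          linarith
        · have := hb.2 t
          rw [window_of_not_mem (not_le.1 ht), mul_zero] at this
          have : |F K t| = 0 := le_antisymm this (abs_nonneg _)
          rw [this]
          have := window_nonneg t
          have := mul_self_nonneg (F K t)
          positivity
    _ = (1 / 2) * ((1 / s) * (∫ t, F K t * F K t) + s * 4) := by
        rw [integral_const_mul, integral_add ((hb.integrable_mul hb).const_mul _)
          (integrable_window.const_mul _), integral_const_mul, integral_const_mul, integral_window]
    _ ≤ (1 / 2) * ((1 / s) * (s * s) + s * 4) := by
        rw [hss]; gcongr; exact sq K
    _ = (5 / 2) * s := by field_simp; ring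
    _ ≤ 3 * √Q * √K := by rw [mul_assoc, ← hs]; linarith

end ErgodicSum

/-! ### Bonferroni inequalities and their stability. -/

section FinsetBounds

variable {ι : Type*} {s : Finset ι} {x y : ι → ℝ}

/-- `Σ x - (1 - ∏ (1 - x))`, the error in the union bound for independent events. -/
lemma unionBound_error (h0 : ∀ i ∈ s, 0 ≤ x i) (h1 : ∀ i ∈ s, x i ≤ 1) :
    0 ≤ ∑ i ∈ s, x i - (1 - ∏ i ∈ s, (1 - x i)) ∧
      ∑ i ∈ s, x i - (1 - ∏ i ∈ s, (1 - x i)) ≤ (∑ i ∈ s, x i) ^ 2 := by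
  classical
  induction s using Finset.induction_on with
  | empty => simp
  | insert a s ha ih =>
    obtain ⟨l, u⟩ := ih (fun i hi => h0 i (Finset.mem_insert_of_mem hi))
      (fun i hi => h1 i (Finset.mem_insert_of_mem hi))
    have ha0 := h0 a (Finset.mem_insert_self _ _)
    have ha1 := h1 a (Finset.mem_insert_self _ _)
    have hs : 0 ≤ ∑ i ∈ s, x i :=
      Finset.sum_nonneg fun i hi => h0 i (Finset.mem_insert_of_mem hi)
    have hp : ∏ i ∈ s, (1 - x i) ≤ 1 := Finset.prod_le_one
      (fun i hi => by linarith [h1 i (Finset.mem_insert_of_mem hi)])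
      (fun i hi => by linarith [h0 i (Finset.mem_insert_of_mem hi)])
    rw [Finset.sum_insert ha, Finset.prod_insert ha]
    set P := ∏ i ∈ s, (1 - x i)
    set S := ∑ i ∈ s, x i
    constructor
    · nlinarith
    · nlinarith [mul_nonneg ha0 hs, sq_nonneg (x a)]

/-- Second order Bonferroni inequality. -/
lemma bonferroni_error (h0 : ∀ i ∈ s, 0 ≤ x i) (h1 : ∀ i ∈ s, x i ≤ 1) :
    |∑ i ∈ s, x i - (1 - ∏ i ∈ s, (1 - x i)) -
      ((∑ i ∈ s, x i) ^ 2 - ∑ i ∈ s, x i ^ 2) / 2| ≤ (∑ i ∈ s, x i) ^ 3 := by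
  classical
  suffices H : 0 ≤ ((∑ i ∈ s, x i) ^ 2 - ∑ i ∈ s, x i ^ 2) / 2 -
      (∑ i ∈ s, x i - (1 - ∏ i ∈ s, (1 - x i))) ∧
      ((∑ i ∈ s, x i) ^ 2 - ∑ i ∈ s, x i ^ 2) / 2 -
      (∑ i ∈ s, x i - (1 - ∏ i ∈ s, (1 - x i))) ≤ (∑ i ∈ s, x i) ^ 3 by
    rw [abs_sub_comm, abs_of_nonneg H.1]; exact H.2
  induction s using Finset.induction_on with
  | empty => simp
  | insert a s ha ih =>
    have h0' : ∀ i ∈ s, 0 ≤ x i := fun i hi => h0 i (Finset.mem_insert_of_mem hi)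
    have h1' : ∀ i ∈ s, x i ≤ 1 := fun i hi => h1 i (Finset.mem_insert_of_mem hi)
    obtain ⟨l, u⟩ := ih h0' h1'
    obtain ⟨l', u'⟩ := unionBound_error h0' h1'
    have ha0 := h0 a (Finset.mem_insert_self _ _)
    have ha1 := h1 a (Finset.mem_insert_self _ _)
    have hs : 0 ≤ ∑ i ∈ s, x i := Finset.sum_nonneg h0'
    rw [Finset.sum_insert ha, Finset.prod_insert ha, Finset.sum_insert ha]
    set P := ∏ i ∈ s, (1 - x i)
    set S := ∑ i ∈ s, x i
    set R := ∑ i ∈ s, x i ^ 2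
    have e : ((x a + S) ^ 2 - (x a ^ 2 + R)) / 2 - (x a + S - (1 - (1 - x a) * P)) =
        ((S ^ 2 - R) / 2 - (S - (1 - P))) + x a * (S - (1 - P)) := by ring
    rw [e]
    constructor
    · exact add_nonneg l (mul_nonneg ha0 l')
    · have h1 := mul_le_mul_of_nonneg_left u' ha0
      have h2 : (x a + S) ^ 3 = S ^ 3 + 3 * (x a * S ^ 2) + 3 * (x a ^ 2 * S) + x a ^ 3 := by ring
      rw [h2]
      have := mul_nonneg ha0 (sq_nonneg S)
      have := mul_nonneg (sq_nonneg (x a)) hs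
      have := pow_nonneg ha0 3
      linarith

/-- Exchange the factors one at a time, the others being in `[0, 1]`. This is what makes `hitOp`
nonexpansive in `L¹`. -/
lemma abs_prod_one_sub_sub_le (h0 : ∀ i ∈ s, 0 ≤ x i) (h1 : ∀ i ∈ s, x i ≤ 1)
    (h0' : ∀ i ∈ s, 0 ≤ y i) (h1' : ∀ i ∈ s, y i ≤ 1) :
    |∏ i ∈ s, (1 - x i) - ∏ i ∈ s, (1 - y i)| ≤ ∑ i ∈ s, |x i - y i| := by
  classical
  induction s using Finset.induction_on with
  | empty => simp
  | insert a s ha ih =>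
    have ih := ih (fun i hi => h0 i (Finset.mem_insert_of_mem hi))
      (fun i hi => h1 i (Finset.mem_insert_of_mem hi))
      (fun i hi => h0' i (Finset.mem_insert_of_mem hi))
      (fun i hi => h1' i (Finset.mem_insert_of_mem hi))
    have ha0 := h0 a (Finset.mem_insert_self _ _)
    have ha1 := h1 a (Finset.mem_insert_self _ _)
    have hp : |∏ i ∈ s, (1 - y i)| ≤ 1 := by
      rw [abs_of_nonneg (Finset.prod_nonneg fun i hi => by
        linarith [h1' i (Finset.mem_insert_of_mem hi)])]
      exact Finset.prod_le_one (fun i hi => by linarith [h1' i (Finset.mem_insert_of_mem hi)])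
        (fun i hi => by linarith [h0' i (Finset.mem_insert_of_mem hi)])
    rw [Finset.prod_insert ha, Finset.prod_insert ha, Finset.sum_insert ha]
    set P := ∏ i ∈ s, (1 - x i)
    set P' := ∏ i ∈ s, (1 - y i)
    have e : (1 - x a) * P - (1 - y a) * P' = (1 - x a) * (P - P') + (y a - x a) * P' := by ring
    rw [e]
    refine (abs_add_le _ _).trans ?_
    rw [abs_mul, abs_mul, abs_sub_comm (y a)]
    have h2 : |1 - x a| ≤ 1 := by rw [abs_le]; constructor <;> linarith
    have := mul_le_of_le_one_left (abs_nonneg (P - P')) h2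
    have := mul_le_of_le_one_right (abs_nonneg (x a - y a)) hp
    linarith

/-- Factor the differences of squares. The factor `B` matters: on functions of size `c` the
quadratic form has Lipschitz constant of order `c`. -/
lemma abs_pairSum_sub_le {B N : ℝ} (hs : (s.card : ℝ) ≤ N) (hN : 1 ≤ N)
    (hx : ∀ i ∈ s, |x i| ≤ B) (hy : ∀ i ∈ s, |y i| ≤ B) (hB : 0 ≤ B) :
    |((∑ i ∈ s, x i) ^ 2 - ∑ i ∈ s, x i ^ 2) / 2 - ((∑ i ∈ s, y i) ^ 2 - ∑ i ∈ s, y i ^ 2) / 2| ≤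
      2 * N * B * ∑ i ∈ s, |x i - y i| := by
  have a1 : |∑ i ∈ s, x i + ∑ i ∈ s, y i| ≤ 2 * N * B := by
    rw [← Finset.sum_add_distrib]
    calc _ ≤ ∑ i ∈ s, |x i + y i| := Finset.abs_sum_le_sum_abs _ _
      _ ≤ ∑ i ∈ s, 2 * B := Finset.sum_le_sum fun i hi =>
          (abs_add_le _ _).trans (by linarith [hx i hi, hy i hi])
      _ = s.card * (2 * B) := by simp
      _ ≤ N * (2 * B) := mul_le_mul_of_nonneg_right hs (by linarith)
      _ = _ := by ring
  have a2 : |∑ i ∈ s, x i - ∑ i ∈ s, y i| ≤ ∑ i ∈ s, |x i - y i| := by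
    rw [← Finset.sum_sub_distrib]; exact Finset.abs_sum_le_sum_abs _ _
  have a3 : |∑ i ∈ s, x i ^ 2 - ∑ i ∈ s, y i ^ 2| ≤ 2 * B * ∑ i ∈ s, |x i - y i| := by
    rw [← Finset.sum_sub_distrib, Finset.mul_sum]
    refine (Finset.abs_sum_le_sum_abs _ _).trans (Finset.sum_le_sum fun i hi => ?_)
    rw [sq_sub_sq, abs_mul]
    exact mul_le_mul_of_nonneg_right ((abs_add_le _ _).trans (by linarith [hx i hi, hy i hi]))
      (abs_nonneg _)
  set D := ∑ i ∈ s, |x i - y i|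
  have hD : 0 ≤ D := Finset.sum_nonneg fun _ _ => abs_nonneg _
  set S := ∑ i ∈ s, x i
  set S' := ∑ i ∈ s, y i
  have e : (S ^ 2 - ∑ i ∈ s, x i ^ 2) / 2 - (S' ^ 2 - ∑ i ∈ s, y i ^ 2) / 2 =
      (S + S') * (S - S') / 2 - (∑ i ∈ s, x i ^ 2 - ∑ i ∈ s, y i ^ 2) / 2 := by ring
  rw [e]
  refine (abs_sub _ _).trans ?_
  rw [abs_div, abs_div, abs_mul, abs_two]
  have a4 : |S + S'| * |S - S'| ≤ (2 * N * B) * D :=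
    mul_le_mul a1 a2 (abs_nonneg _) (by positivity)
  have a5 : 2 * B * D ≤ 2 * N * B * D := by
    refine mul_le_mul_of_nonneg_right ?_ hD
    nlinarith
  linarith

end FinsetBounds

end

/-! ### The hitting operator and its expansion to second order. -/

section

variable {L : ℕ}

/-- Measurable functions with values in `[0, 1]` which vanish outside `[-2, 2]`. -/
def SubWindow (g : ℝ → ℝ) : Prop := Measurable g ∧ ∀ t, 0 ≤ g t ∧ g t ≤ window t

/-- Expected value of `∑ g (L t - p a) g (L t - p b)` over the unordered pairs of selected
cells. -/
def pairOp (w : Config L → ℝ) (p : Cell L → ℝ) (g : ℝ → ℝ) (t : ℝ) : ℝ :=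
  ∑ A, w A * (((∑ a ∈ A, g (L * t - p a)) ^ 2 - ∑ a ∈ A, g (L * t - p a) ^ 2) / 2)

lemma subWindow_window : SubWindow window :=
  ⟨measurable_window, fun t => ⟨window_nonneg t, le_rfl⟩⟩

namespace SubWindow

variable {g : ℝ → ℝ}

lemma nonneg (hg : SubWindow g) (t : ℝ) : 0 ≤ g t := (hg.2 t).1

lemma le_one (hg : SubWindow g) (t : ℝ) : g t ≤ 1 := (hg.2 t).2.trans (window_le_one t)

lemma dominated (hg : SubWindow g) : Dominated 1 g :=
  ⟨hg.1, fun t => by rw [abs_of_nonneg (hg.nonneg t), one_mul]; exact (hg.2 t).2⟩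

lemma integrable (hg : SubWindow g) : Integrable g := hg.dominated.integrable

end SubWindow

section HitOp

variable {w : Config L → ℝ} {p : Cell L → ℝ} {h g g' : ℝ → ℝ}

lemma IsUniformWeight.ne_zero (hw : IsUniformWeight w) : L ≠ 0 := by have := hw.two_le; omega

/-- Interchanging the sums leaves only the one-cell marginals, all equal to `1 / L`: the first-order
term does not see the dependence between cells. -/
lemma IsUniformWeight.sum_sum (hw : IsUniformWeight w) (f : Cell L → ℝ) :
    ∑ A, w A * ∑ a ∈ A, f a = (1 / (L : ℝ)) * ∑ a, f a := by
  have : ∀ A : Config L, w A * ∑ a ∈ A, f a = ∑ a, (if a ∈ A then w A else 0) * f a := fun A => by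
    rw [Finset.mul_sum, ← Finset.sum_filter_add_sum_filter_not Finset.univ (· ∈ A)]
    rw [Finset.filter_mem_eq_inter, Finset.univ_inter]
    rw [Finset.sum_eq_zero (s := Finset.univ.filter (· ∉ A)), add_zero]
    · exact Finset.sum_congr rfl fun a ha => by simp [ha]
    · intro a ha; simp [(Finset.mem_filter.1 ha).2]
  simp only [this]
  rw [Finset.sum_comm, Finset.mul_sum]
  refine Finset.sum_congr rfl fun a _ => ?_
  rw [← Finset.sum_mul, hw.marginal]

lemma IsUniformWeight.avgOp_eq (hw : IsUniformWeight w) (g : ℝ → ℝ) (t : ℝ) :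
    avgOp p g t = ∑ A, w A * ∑ a ∈ A, g (L * t - p a) :=
  (hw.sum_sum fun a => g (L * t - p a)).symm

lemma card_config_le (A : Config L) : (A.card : ℝ) ≤ (L : ℝ) ^ 2 := by
  have : A.card ≤ L * L := by simpa using Finset.card_le_univ A
  rw [sq]; exact_mod_cast this

lemma measurable_hitOp (hg : Measurable g) : Measurable (hitOp w p g) :=
  Finset.measurable_sum _ fun A _ => ((Finset.measurable_prod _ fun a _ =>
    (hg.comp (by fun_prop)).const_sub 1).const_sub 1).const_mul _

lemma measurable_pairOp (hg : Measurable g) : Measurable (pairOp w p g) := by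
  unfold pairOp
  refine Finset.measurable_sum _ fun A _ => Measurable.const_mul (Measurable.div_const
    (Measurable.sub (Measurable.pow_const (Finset.measurable_sum _ fun a _ => ?_) 2)
    (Finset.measurable_sum _ fun a _ => Measurable.pow_const ?_ 2)) 2) _
  all_goals exact hg.comp (by fun_prop)

lemma hitOp_nonneg (hw : IsUniformWeight w) (h0 : ∀ t, 0 ≤ g t) (h1 : ∀ t, g t ≤ 1) (t : ℝ) :
    0 ≤ hitOp w p g t :=
  Finset.sum_nonneg fun A _ => mul_nonneg (hw.nonneg A) (by
    linarith [Finset.prod_le_one (s := A) (f := fun a => 1 - g (L * t - p a))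
      (fun a _ => by linarith [h1 (L * t - p a)]) (fun a _ => by linarith [h0 (L * t - p a)])])

lemma hitOp_le_one (hw : IsUniformWeight w) (h1 : ∀ t, g t ≤ 1) (t : ℝ) : hitOp w p g t ≤ 1 := by
  rw [← hw.sum_one]
  refine Finset.sum_le_sum fun A _ => mul_le_of_le_one_right (hw.nonneg A) ?_
  linarith [Finset.prod_nonneg (s := A) (f := fun a => 1 - g (L * t - p a))
      (fun a _ => by linarith [h1 (L * t - p a)])]

lemma hitOp_mono (hw : IsUniformWeight w) (h1 : ∀ t, g' t ≤ 1) (hgg : ∀ t, g t ≤ g' t) (t : ℝ) :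
    hitOp w p g t ≤ hitOp w p g' t := by
  refine Finset.sum_le_sum fun A _ => mul_le_mul_of_nonneg_left ?_ (hw.nonneg A)
  have := Finset.prod_le_prod (s := A) (f := fun a => 1 - g' (L * t - p a))
    (g := fun a => 1 - g (L * t - p a)) (fun a _ => by linarith [h1 (L * t - p a)])
    (fun a _ => by linarith [hgg (L * t - p a)])
  linarith

lemma avgOp_sub_hitOp_eq (hw : IsUniformWeight w) (t : ℝ) :
    avgOp p g t - hitOp w p g t = ∑ A, w A * (∑ a ∈ A, g (L * t - p a) -
      (1 - ∏ a ∈ A, (1 - g (L * t - p a)))) := by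
  rw [hw.avgOp_eq, hitOp, ← Finset.sum_sub_distrib]
  exact Finset.sum_congr rfl fun A _ => by ring

lemma hitOp_le_avgOp (hw : IsUniformWeight w) (h0 : ∀ t, 0 ≤ g t) (h1 : ∀ t, g t ≤ 1) (t : ℝ) :
    hitOp w p g t ≤ avgOp p g t := by
  rw [← sub_nonneg, avgOp_sub_hitOp_eq hw]
  exact Finset.sum_nonneg fun A _ => mul_nonneg (hw.nonneg A)
    (unionBound_error (fun _ _ => h0 _) (fun _ _ => h1 _)).1

lemma sum_sq_le (A : Config L) (f : Cell L → ℝ) :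
    (∑ a ∈ A, f a) ^ 2 ≤ (L : ℝ) ^ 2 * ∑ a ∈ A, f a ^ 2 :=
  (sq_sum_le_card_mul_sum_sq (s := A) (f := f)).trans
    (mul_le_mul_of_nonneg_right (card_config_le A) (Finset.sum_nonneg fun _ _ => sq_nonneg _))

/-- The error of the union bound is at most the square of the sum, and Cauchy–Schwarz over at most
`L^2` cells turns it into a sum of squares. Integrated, it bounds the mass lost in a generation by
the `L²` norm. -/
lemma avgOp_sub_hitOp_le (hw : IsUniformWeight w) (h0 : ∀ t, 0 ≤ g t) (h1 : ∀ t, g t ≤ 1) (t : ℝ) :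
    avgOp p g t - hitOp w p g t ≤ (L : ℝ) ^ 2 * avgOp p (fun s => g s ^ 2) t := by
  rw [avgOp_sub_hitOp_eq hw, hw.avgOp_eq, Finset.mul_sum]
  refine Finset.sum_le_sum fun A _ => ?_
  rw [mul_left_comm]
  exact mul_le_mul_of_nonneg_left (((unionBound_error (fun _ _ => h0 _) (fun _ _ => h1 _)).2).trans
    (sum_sq_le A _)) (hw.nonneg A)

lemma abs_hitOp_sub_le (hw : IsUniformWeight w) (hg : SubWindow g) (hg' : SubWindow g') (t : ℝ) :
    |hitOp w p g t - hitOp w p g' t| ≤ avgOp p (fun s => |g s - g' s|) t := by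
  rw [hw.avgOp_eq, hitOp, hitOp, ← Finset.sum_sub_distrib]
  refine (Finset.abs_sum_le_sum_abs _ _).trans (Finset.sum_le_sum fun A _ => ?_)
  rw [← mul_sub, abs_mul, abs_of_nonneg (hw.nonneg A)]
  refine mul_le_mul_of_nonneg_left ?_ (hw.nonneg A)
  rw [sub_sub_sub_cancel_left, abs_sub_comm]
  exact abs_prod_one_sub_sub_le (fun _ _ => hg.nonneg _) (fun _ _ => hg.le_one _)
    (fun _ _ => hg'.nonneg _) (fun _ _ => hg'.le_one _)

lemma SubWindow.hitOp (hw : IsUniformWeight w) (hp : ∀ a, |p a| ≤ 2 * ((L : ℝ) - 1))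
    (hg : SubWindow g) : SubWindow (hitOp w p g) := by
  refine ⟨measurable_hitOp hg.1, fun t => ⟨hitOp_nonneg hw hg.nonneg hg.le_one t, ?_⟩⟩
  by_cases ht : |t| ≤ 2
  · rw [window_of_mem ht]; exact hitOp_le_one hw hg.le_one t
  · have h1 := hitOp_le_avgOp (p := p) hw hg.nonneg hg.le_one t
    have h2 := (le_abs_self _).trans ((hg.dominated.avgOp hw.two_le hp).2 t)
    rw [window_of_not_mem (not_le.1 ht)] at h2 ⊢
    linarith

lemma SubWindow.hitOp_iterate (hw : IsUniformWeight w) (hp : ∀ a, |p a| ≤ 2 * ((L : ℝ) - 1))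
    (hg : SubWindow g) (n : ℕ) : SubWindow ((RandomGrid.hitOp w p)^[n] g) := by
  induction n with
  | zero => exact hg
  | succ n ih => rw [Function.iterate_succ_apply']; exact ih.hitOp hw hp

lemma hitOp_iterate_mono (hw : IsUniformWeight w) (hp : ∀ a, |p a| ≤ 2 * ((L : ℝ) - 1))
    (hg' : SubWindow g') (hgg : ∀ t, g t ≤ g' t) (n : ℕ) (t : ℝ) :
    (hitOp w p)^[n] g t ≤ (hitOp w p)^[n] g' t := by
  induction n generalizing t with
  | zero => exact hgg t
  | succ n ih =>
    simp only [Function.iterate_succ_apply']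
    exact hitOp_mono hw (hg'.hitOp_iterate hw hp n).le_one ih t

lemma hitOp_iterate_le_avgOp_iterate (hw : IsUniformWeight w)
    (hp : ∀ a, |p a| ≤ 2 * ((L : ℝ) - 1)) (hg : SubWindow g) (n : ℕ) (t : ℝ) :
    (hitOp w p)^[n] g t ≤ (avgOp p)^[n] g t := by
  induction n generalizing t with
  | zero => exact le_rfl
  | succ n ih =>
    simp only [Function.iterate_succ_apply']
    have := hg.hitOp_iterate hw hp n
    exact (hitOp_le_avgOp hw this.nonneg this.le_one t).trans (avgOp_mono ih t)

/-- The pointwise difference is dominated by an average of the previous one, and averages preserve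
mass. Errors made at different times therefore just add up. -/
lemma integral_abs_hitOp_iterate_sub_le (hw : IsUniformWeight w)
    (hp : ∀ a, |p a| ≤ 2 * ((L : ℝ) - 1)) (hg : SubWindow g) (hg' : SubWindow g') (n : ℕ) :
    ∫ t, |(hitOp w p)^[n] g t - (hitOp w p)^[n] g' t| ≤ ∫ t, |g t - g' t| := by
  induction n with
  | zero => exact le_rfl
  | succ n ih =>
    have h1 := hg.hitOp_iterate hw hp n
    have h2 := hg'.hitOp_iterate hw hp n
    have hi : Integrable fun t => |(hitOp w p)^[n] g t - (hitOp w p)^[n] g' t| :=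
      (h1.integrable.sub h2.integrable).abs
    refine le_trans ?_ ih
    simp only [Function.iterate_succ_apply']
    rw [← integral_avgOp (p := p) hw.ne_zero hi]
    exact integral_mono ((h1.hitOp hw hp).integrable.sub (h2.hitOp hw hp).integrable).abs
      (integrable_avgOp hw.ne_zero hi) (abs_hitOp_sub_le hw h1 h2)

lemma abs_pairOp_sub_le (hw : IsUniformWeight w) {B : ℝ} (hg : ∀ t, |g t| ≤ B)
    (hg' : ∀ t, |g' t| ≤ B) (t : ℝ) :
    |pairOp w p g t - pairOp w p g' t| ≤
      2 * (L : ℝ) ^ 2 * B * avgOp p (fun s => |g s - g' s|) t := by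
  have hL : (2 : ℝ) ≤ L := by exact_mod_cast hw.two_le
  have hB : 0 ≤ B := (abs_nonneg _).trans (hg 0)
  rw [hw.avgOp_eq, pairOp, pairOp, ← Finset.sum_sub_distrib, Finset.mul_sum]
  refine (Finset.abs_sum_le_sum_abs _ _).trans (Finset.sum_le_sum fun A _ => ?_)
  rw [← mul_sub, abs_mul, abs_of_nonneg (hw.nonneg A), mul_left_comm]
  exact mul_le_mul_of_nonneg_left (abs_pairSum_sub_le (card_config_le A) (by nlinarith)
    (fun _ _ => hg _) (fun _ _ => hg' _) hB) (hw.nonneg A)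

lemma pairOp_const_mul (c t : ℝ) :
    pairOp w p (fun s => c * g s) t = c ^ 2 * pairOp w p g t := by
  simp only [pairOp, ← Finset.mul_sum, mul_pow]
  rw [Finset.mul_sum]
  exact Finset.sum_congr rfl fun A _ => by ring

lemma pairOp_nonneg (hw : IsUniformWeight w) (hg : ∀ t, 0 ≤ g t) (t : ℝ) : 0 ≤ pairOp w p g t := by
  refine Finset.sum_nonneg fun A _ => mul_nonneg (hw.nonneg A) (div_nonneg (sub_nonneg.2 ?_) two_pos.le)
  exact Finset.sum_sq_le_sq_sum_of_nonneg fun _ _ => hg _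

/-- The remainder is the cube of the sum over the selection. Two factors are bounded by `L^2 B`; the
third is kept, so that the expectation gives back `avgOp p g`. -/
lemma abs_avgOp_sub_hitOp_sub_pairOp_le (hw : IsUniformWeight w) {B : ℝ} (hg : SubWindow g)
    (hgB : ∀ t, g t ≤ B) (t : ℝ) :
    |avgOp p g t - hitOp w p g t - pairOp w p g t| ≤ (L : ℝ) ^ 4 * B ^ 2 * avgOp p g t := by
  have hB : 0 ≤ B := (hg.nonneg 0).trans (hgB 0)
  rw [avgOp_sub_hitOp_eq hw, pairOp, ← Finset.sum_sub_distrib, hw.avgOp_eq g, Finset.mul_sum]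
  refine (Finset.abs_sum_le_sum_abs _ _).trans (Finset.sum_le_sum fun A _ => ?_)
  rw [← mul_sub, abs_mul, abs_of_nonneg (hw.nonneg A), mul_left_comm]
  refine mul_le_mul_of_nonneg_left ?_ (hw.nonneg A)
  refine (bonferroni_error (fun _ _ => hg.nonneg _) (fun _ _ => hg.le_one _)).trans ?_
  have h0 : 0 ≤ ∑ a ∈ A, g (L * t - p a) := Finset.sum_nonneg fun _ _ => hg.nonneg _
  have h1 : ∑ a ∈ A, g (L * t - p a) ≤ (L : ℝ) ^ 2 * B := by
    calc _ ≤ ∑ a ∈ A, B := Finset.sum_le_sum fun _ _ => hgB _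
      _ = A.card * B := by simp
      _ ≤ _ := mul_le_mul_of_nonneg_right (card_config_le A) hB
  rw [pow_succ]
  refine mul_le_mul_of_nonneg_right ?_ h0
  calc _ ≤ ((L : ℝ) ^ 2 * B) ^ 2 := pow_le_pow_left₀ h0 h1 2
    _ = _ := by ring

/-- The pair function of a self-similar density has bounded range and is Lipschitz in `L¹`. -/
lemma dominated_pairOp (hw : IsUniformWeight w) (hh : IsSelfSimilarDensity p h) :
    Dominated (8 * (L : ℝ) ^ 2) (pairOp w p h) := by
  refine ⟨measurable_pairOp hh.measurable, fun t => ?_⟩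
  have h0 : pairOp w p (fun _ => 0) t = 0 := by simp [pairOp]
  have := abs_pairOp_sub_le (p := p) hw (B := 2) hh.dominated.abs_le
    (g' := fun _ => 0) (fun _ => by simp) t
  rw [h0, sub_zero] at this
  simp only [sub_zero, abs_of_nonneg (hh.nonneg _)] at this
  have e : avgOp p (fun s => h s) t = h t := congrFun (hh.avgOp_eq hw.ne_zero) t
  rw [e] at this
  refine this.trans ?_
  have := mul_le_mul_of_nonneg_left (hh.le_window t) (by positivity : 0 ≤ 2 * (L : ℝ) ^ 2 * 2)
  linarith

lemma integral_abs_pairOp_shift_le (hw : IsUniformWeight w) (hh : IsSelfSimilarDensity p h) (v : ℝ) :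
    ∫ t, |pairOp w p h (t + v) - pairOp w p h t| ≤ 16 * (L : ℝ) ^ 3 * |v| := by
  have e : ∀ t, pairOp w p h (t + v) = pairOp w p (fun s => h (s + L * v)) t := fun t => by
    simp only [pairOp]
    have : ∀ a, (L : ℝ) * (t + v) - p a = L * t - p a + L * v := fun a => by ring
    simp only [this]
  simp only [e]
  have hi : Integrable fun t => |h (t + L * v) - h t| :=
    ((hh.dominated.integrable.comp_add_right _).sub hh.dominated.integrable).abs
  have hD := dominated_pairOp hw hh
  calc _ ≤ ∫ t, 2 * (L : ℝ) ^ 2 * 2 * avgOp p (fun s => |h (s + L * v) - h s|) t := by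
        refine integral_mono ?_ ((integrable_avgOp hw.ne_zero hi).const_mul _) fun t =>
          abs_pairOp_sub_le hw (fun _ => hh.dominated.abs_le _) hh.dominated.abs_le t
        simp only [← e]
        exact ((hD.integrable.comp_add_right v).sub hD.integrable).abs
    _ = 4 * (L : ℝ) ^ 2 * ∫ t, |h (t + L * v) - h t| := by
        rw [integral_const_mul, integral_avgOp hw.ne_zero hi]; ring
    _ ≤ 4 * (L : ℝ) ^ 2 * (4 * |L * v|) := mul_le_mul_of_nonneg_left (hh.shift _) (by positivity)
    _ = _ := by rw [abs_mul, Nat.abs_cast]; ring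

lemma integral_pairOp_nonneg (hw : IsUniformWeight w) (hh : IsSelfSimilarDensity p h) :
    0 ≤ ∫ t, pairOp w p h t := integral_nonneg (pairOp_nonneg hw hh.nonneg)

lemma integral_pairOp_le (hw : IsUniformWeight w) (hh : IsSelfSimilarDensity p h) :
    ∫ t, pairOp w p h t ≤ 32 * (L : ℝ) ^ 2 := by
  have := (dominated_pairOp hw hh).integral_abs_le
  have h2 := integral_mono (dominated_pairOp hw hh).integrable
    (dominated_pairOp hw hh).abs.integrable fun t => le_abs_self _
  linarith

/-- Averages of the pair function converge to a multiple of the density. -/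
lemma integral_abs_sum_pairOp_sub_le (hw : IsUniformWeight w) (hh : IsSelfSimilarDensity p h)
    (K : ℕ) :
    ∫ t, |∑ i ∈ Finset.range K, (avgOp p)^[i] (pairOp w p h) t -
      K * (∫ s, pairOp w p h s) * h t| ≤ 400 * 400 * (L : ℝ) ^ 3 * √K := by
  have hL : (2 : ℝ) ≤ L := by exact_mod_cast hw.two_le
  set m := ∫ s, pairOp w p h s
  have hm0 : 0 ≤ m := integral_pairOp_nonneg hw hh
  have hm1 : m ≤ 32 * (L : ℝ) ^ 2 := integral_pairOp_le hw hh
  have hD := dominated_pairOp hw hh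
  -- Subtracting `m h` makes the mean vanish; as `h` is fixed by `avgOp`, it subtracts exactly `K m
  -- h` from the ergodic sum.
  have hφ := hD.sub (hh.dominated.const_mul m)
  rw [abs_of_nonneg hm0] at hφ
  replace hφ := hφ.mono (B' := 72 * (L : ℝ) ^ 2) (by linarith)
  have key := integral_abs_sum_avgOp_iterate_le hw.two_le hh hφ ?_ (E := 80 * (L : ℝ) ^ 3) ?_ K
  · have e : ∀ t, ∑ i ∈ Finset.range K, (avgOp p)^[i] (fun t => pairOp w p h t - m * h t) t =
        ∑ i ∈ Finset.range K, (avgOp p)^[i] (pairOp w p h) t - K * m * h t := fun t => by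
      simp only [avgOp_iterate_sub, avgOp_iterate_const_mul, hh.avgOp_iterate_eq hw.ne_zero,
        Finset.sum_sub_distrib, Finset.sum_const, Finset.card_range, nsmul_eq_mul, mul_assoc]
    simp only [e] at key
    refine key.trans (mul_le_mul_of_nonneg_right ?_ (Real.sqrt_nonneg _))
    have : √(1024 * (72 * (L : ℝ) ^ 2) ^ 2 + 256 * (72 * (L : ℝ) ^ 2) * (80 * (L : ℝ) ^ 3) + 1) ≤
        50000 * (L : ℝ) ^ 3 := by
      refine Real.sqrt_le_iff.2 ⟨by positivity, ?_⟩
      have h3 : (1 : ℝ) ≤ (L : ℝ) ^ 4 := one_le_pow₀ (by linarith)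
      have h4 : (L : ℝ) ^ 4 ≤ (L : ℝ) ^ 6 := pow_le_pow_right₀ (by linarith) (by norm_num)
      have h5 : (L : ℝ) ^ 5 ≤ (L : ℝ) ^ 6 := pow_le_pow_right₀ (by linarith) (by norm_num)
      ring_nf
      nlinarith
    have : 0 ≤ (L : ℝ) ^ 3 := by positivity
    linarith
  · rw [integral_sub hD.integrable (hh.dominated.integrable.const_mul m), integral_const_mul,
      hh.integral_eq_one, mul_one]
    exact sub_self m
  · intro v
    have i1 : Integrable fun t => |pairOp w p h (t + v) - pairOp w p h t| :=
      ((hD.integrable.comp_add_right v).sub hD.integrable).abs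
    have i2 : Integrable fun t => |h (t + v) - h t| :=
      ((hh.dominated.integrable.comp_add_right _).sub hh.dominated.integrable).abs
    calc _ ≤ ∫ t, (|pairOp w p h (t + v) - pairOp w p h t| + m * |h (t + v) - h t|) := by
          refine integral_mono ((hφ.integrable.comp_add_right v).sub hφ.integrable).abs
            (i1.add (i2.const_mul m)) fun t => ?_
          have e : pairOp w p h (t + v) - m * h (t + v) - (pairOp w p h t - m * h t) =
            (pairOp w p h (t + v) - pairOp w p h t) - m * (h (t + v) - h t) := by ring
          dsimp only
          rw [e]
          refine (abs_sub _ _).trans ?_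
          rw [abs_mul, abs_of_nonneg hm0]
      _ = (∫ t, |pairOp w p h (t + v) - pairOp w p h t|) + m * ∫ t, |h (t + v) - h t| := by
          rw [integral_add i1 (i2.const_mul m), integral_const_mul]
      _ ≤ 16 * (L : ℝ) ^ 3 * |v| + (32 * (L : ℝ) ^ 2) * (4 * |v|) :=
          add_le_add (integral_abs_pairOp_shift_le hw hh v)
            (mul_le_mul hm1 (hh.shift v) (integral_nonneg fun _ => abs_nonneg _) (by positivity))
      _ ≤ _ := by
          have := mul_le_mul_of_nonneg_right hL (by positivity : 0 ≤ (L : ℝ) ^ 2 * |v|)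
          have e : (L : ℝ) ^ 3 * |v| = L * ((L : ℝ) ^ 2 * |v|) := by ring
          nlinarith

end HitOp

/-! ### Evolution of small multiples of the invariant density. -/

section Scaling

variable (L)

/-- By induction: the new step loses at most a multiple of the average of the square of a function
below `c h`, and the old error is averaged. The constant precedes the weights, offsets and density,
so it serves all directions at once. -/
lemma exists_abs_sub_hitOp_iterate_le (i : ℕ) : ∃ D : ℝ, 0 ≤ D ∧
    ∀ (w : Config L → ℝ) (p : Cell L → ℝ) (h : ℝ → ℝ) (c : ℝ), IsUniformWeight w →
      IsSelfSimilarDensity p h → 0 ≤ c → SubWindow (fun t => c * h t) →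
      ∀ t, |c * h t - (hitOp w p)^[i] (fun t => c * h t) t| ≤ D * c ^ 2 * window t := by
  induction i with
  | zero => exact ⟨0, le_rfl, fun w p h c _ _ _ _ t => by simp⟩
  | succ i ih =>
    obtain ⟨D, hD, H⟩ := ih
    refine ⟨L * D + 4 * (L : ℝ) ^ 3, by positivity, fun w p h c hw hh hc hch t => ?_⟩
    have hL := hw.ne_zero
    set G := (hitOp w p)^[i] (fun t => c * h t) with hG
    have hGw : SubWindow G := hch.hitOp_iterate hw hh.offset_le i
    have hGle : ∀ t, G t ≤ c * h t := fun t => by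
      refine (hitOp_iterate_le_avgOp_iterate hw hh.offset_le hch i t).trans ?_
      rw [avgOp_iterate_const_mul, hh.avgOp_iterate_eq hL]
    have hG2 : ∀ t, G t ^ 2 ≤ 4 * c ^ 2 * window t := fun t => by
      have h1 := (hGle t).trans (mul_le_mul_of_nonneg_left (hh.le_window t) hc)
      have h2 := hGw.nonneg t
      have h3 := window_le_one t
      have h4 := window_nonneg t
      calc G t ^ 2 ≤ (c * (2 * window t)) ^ 2 := pow_le_pow_left₀ h2 h1 2
        _ = 4 * c ^ 2 * (window t * window t) := by ring
        _ ≤ _ := mul_le_mul_of_nonneg_left (mul_le_of_le_one_left h4 h3) (by positivity)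
    rw [Function.iterate_succ_apply', ← hG]
    have e : c * h t = avgOp p (fun t => c * h t) t := by
      rw [avgOp_const_mul, hh.avgOp_eq hL]
    have e2 : avgOp p (fun t => c * h t) t - hitOp w p G t =
        avgOp p (fun t => c * h t - G t) t + (avgOp p G t - hitOp w p G t) := by
      rw [avgOp_sub]; ring
    rw [e, e2]
    refine (abs_add_le _ _).trans ?_
    have b1 : |avgOp p (fun t => c * h t - G t) t| ≤ D * c ^ 2 * (L * window t) := by
      refine (abs_avgOp_le t).trans ((avgOp_mono (H w p h c hw hh hc hch) t).trans ?_)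
      rw [avgOp_const_mul]
      exact mul_le_mul_of_nonneg_left (avgOp_window_le hw.two_le hh.offset_le t) (by positivity)
    have b2 : |avgOp p G t - hitOp w p G t| ≤ (L : ℝ) ^ 2 * (4 * c ^ 2 * (L * window t)) := by
      rw [abs_of_nonneg (sub_nonneg.2 (hitOp_le_avgOp hw hGw.nonneg hGw.le_one t))]
      refine (avgOp_sub_hitOp_le hw hGw.nonneg hGw.le_one t).trans
        (mul_le_mul_of_nonneg_left ?_ (by positivity))
      refine (avgOp_mono hG2 t).trans ?_
      rw [avgOp_const_mul]
      exact mul_le_mul_of_nonneg_left (avgOp_window_le hw.two_le hh.offset_le t) (by positivity)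
    calc _ ≤ _ := add_le_add b1 b2
      _ = _ := by ring

/-- The error after one more step is the average of the old error, plus the cubic Bonferroni
remainder, plus the change of `pairOp` when `c h` is replaced by the current function. The last is
`O(c)` times the `O(c^2)` of `exists_abs_sub_hitOp_iterate_le`. -/
lemma exists_integral_abs_second_order_le (i : ℕ) : ∃ D : ℝ, 0 ≤ D ∧
    ∀ (w : Config L → ℝ) (p : Cell L → ℝ) (h : ℝ → ℝ) (c : ℝ), IsUniformWeight w →
      IsSelfSimilarDensity p h → 0 ≤ c → SubWindow (fun t => c * h t) →
      ∫ t, |c * h t - c ^ 2 * ∑ j ∈ Finset.range i, (avgOp p)^[j] (pairOp w p h) t -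
        (hitOp w p)^[i] (fun t => c * h t) t| ≤ D * c ^ 3 := by
  induction i with
  | zero => exact ⟨0, le_rfl, fun w p h c _ _ _ _ => by simp⟩
  | succ i ih =>
    obtain ⟨D, hD, H⟩ := ih
    obtain ⟨D', hD', H'⟩ := exists_abs_sub_hitOp_iterate_le L i
    refine ⟨D + (32 * (L : ℝ) ^ 5 + 16 * (L : ℝ) ^ 3 * D'), by positivity,
      fun w p h c hw hh hc hch => ?_⟩
    have hL := hw.ne_zero
    set G := (hitOp w p)^[i] (fun t => c * h t) with hG
    have hGw : SubWindow G := hch.hitOp_iterate hw hh.offset_le i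
    have hGle : ∀ t, G t ≤ c * h t := fun t => by
      refine (hitOp_iterate_le_avgOp_iterate hw hh.offset_le hch i t).trans ?_
      rw [avgOp_iterate_const_mul, hh.avgOp_iterate_eq hL]
    have hle : ∀ t, c * h t ≤ c * 2 := fun t => mul_le_mul_of_nonneg_left (hh.le_two t) hc
    set S := fun t => ∑ j ∈ Finset.range i, (avgOp p)^[j] (pairOp w p h) t with hS
    set R := fun t => c * h t - c ^ 2 * S t - G t with hR
    have hSD : ∃ b, Dominated b S := ⟨_, Dominated.sum _ fun j _ =>
      (dominated_pairOp hw hh).avgOp_iterate hw.two_le hh j⟩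
    obtain ⟨b, hb⟩ := hSD
    have hRD := ((hh.dominated.const_mul c).sub (hb.const_mul (c ^ 2))).sub hGw.dominated
    have hRi : Integrable R := hRD.integrable
    have e : ∀ t, c * h t - c ^ 2 * ∑ j ∈ Finset.range (i + 1), (avgOp p)^[j] (pairOp w p h) t -
        (hitOp w p)^[i + 1] (fun t => c * h t) t = avgOp p R t +
        ((avgOp p G t - hitOp w p G t - pairOp w p G t) +
        (pairOp w p G t - pairOp w p (fun t => c * h t) t)) := fun t => by
      rw [Function.iterate_succ_apply', ← hG, Finset.sum_range_succ']
      simp only [Function.iterate_succ_apply', Function.iterate_zero, id]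
      rw [hR, avgOp_sub, avgOp_sub, avgOp_const_mul, avgOp_const_mul, hh.avgOp_eq hL, hS, avgOp_sum,
        pairOp_const_mul]
      ring
    simp only [e]
    have hbd : ∀ t, |avgOp p R t + ((avgOp p G t - hitOp w p G t - pairOp w p G t) +
        (pairOp w p G t - pairOp w p (fun t => c * h t) t))| ≤ |avgOp p R t| +
        (8 * (L : ℝ) ^ 5 + 4 * (L : ℝ) ^ 3 * D') * c ^ 3 * window t := fun t => by
      refine (abs_add_le _ _).trans (add_le_add le_rfl ((abs_add_le _ _).trans ?_))
      have b1 := abs_avgOp_sub_hitOp_sub_pairOp_le (p := p) hw hGw (B := c * 2)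
        (fun t => (hGle t).trans (hle t)) t
      have b2 : avgOp p G t ≤ c * (2 * (L * window t)) := by
        refine (avgOp_mono (g' := fun s => c * (2 * window s)) (fun s => (hGle s).trans
          (mul_le_mul_of_nonneg_left (hh.le_window s) hc)) t).trans ?_
        rw [avgOp_const_mul, avgOp_const_mul]
        exact mul_le_mul_of_nonneg_left (mul_le_mul_of_nonneg_left
          (avgOp_window_le hw.two_le hh.offset_le t) two_pos.le) hc
      have b3 := abs_pairOp_sub_le (p := p) hw (g := G) (g' := fun t => c * h t) (B := c * 2)
        (fun t => by rw [abs_of_nonneg (hGw.nonneg t)]; exact (hGle t).trans (hle t))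
        (fun t => by rw [abs_of_nonneg (hch.nonneg t)]; exact hle t) t
      have b4 : avgOp p (fun s => |G s - c * h s|) t ≤ D' * c ^ 2 * (L * window t) := by
        simp only [abs_sub_comm (G _)]
        refine (avgOp_mono (H' w p h c hw hh hc hch) t).trans ?_
        rw [avgOp_const_mul]
        exact mul_le_mul_of_nonneg_left (avgOp_window_le hw.two_le hh.offset_le t) (by positivity)
      have b5 := mul_le_mul_of_nonneg_left b2 (by positivity : 0 ≤ (L : ℝ) ^ 4 * (c * 2) ^ 2)
      have b6 := mul_le_mul_of_nonneg_left b4 (by positivity : 0 ≤ 2 * (L : ℝ) ^ 2 * (c * 2))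
      calc _ ≤ _ := add_le_add (b1.trans b5) (b3.trans b6)
        _ = _ := by ring
    have hTR := integrable_avgOp (p := p) hL hRi
    calc _ ≤ ∫ t, (|avgOp p R t| +
          (8 * (L : ℝ) ^ 5 + 4 * (L : ℝ) ^ 3 * D') * c ^ 3 * window t) :=
          integral_mono_of_nonneg (ae_of_all _ fun _ => abs_nonneg _)
            (hTR.abs.add (integrable_window.const_mul _)) (ae_of_all _ hbd)
      _ = (∫ t, |avgOp p R t|) + (8 * (L : ℝ) ^ 5 + 4 * (L : ℝ) ^ 3 * D') * c ^ 3 * 4 := by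
          rw [integral_add hTR.abs (integrable_window.const_mul _), integral_const_mul,
            integral_window]
      _ ≤ D * c ^ 3 + (8 * (L : ℝ) ^ 5 + 4 * (L : ℝ) ^ 3 * D') * c ^ 3 * 4 :=
          add_le_add ((integral_abs_avgOp_le hL hRi).trans (H w p h c hw hh hc hch)) le_rfl
      _ = _ := by ring

/-- The ergodic sum becomes `K m h` at a cost `√K c^2`, small against the main loss `K m c^2` when
`K` is large. Then `c - c^2 K m` becomes `c / (1 + c K m)` at a cost `O(c^3)`. Note that `C` does
not depend on `K`, while `D` does. -/
lemma exists_integral_abs_block_le : ∃ C : ℝ, 0 ≤ C ∧ ∀ K : ℕ, ∃ D : ℝ, 0 ≤ D ∧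
    ∀ (w : Config L → ℝ) (p : Cell L → ℝ) (h : ℝ → ℝ) (c : ℝ), IsUniformWeight w →
      IsSelfSimilarDensity p h → 0 ≤ c → SubWindow (fun t => c * h t) →
      ∫ t, |(hitOp w p)^[K] (fun t => c * h t) t -
        c / (1 + c * K * ∫ s, pairOp w p h s) * h t| ≤ C * √K * c ^ 2 + D * c ^ 3 := by
  refine ⟨400 * 400 * (L : ℝ) ^ 3, by positivity, fun K => ?_⟩
  obtain ⟨D, hD, H⟩ := exists_integral_abs_second_order_le L K
  refine ⟨D + (K * (32 * (L : ℝ) ^ 2)) ^ 2, by positivity, fun w p h c hw hh hc hch => ?_⟩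
  set m := ∫ s, pairOp w p h s with hm
  have hm0 : 0 ≤ m := integral_pairOp_nonneg hw hh
  have hm1 : m ≤ 32 * (L : ℝ) ^ 2 := integral_pairOp_le hw hh
  set S := fun t => ∑ j ∈ Finset.range K, (avgOp p)^[j] (pairOp w p h) t with hS
  obtain ⟨b, hb⟩ : ∃ b, Dominated b S := ⟨_, Dominated.sum _ fun j _ =>
    (dominated_pairOp hw hh).avgOp_iterate hw.two_le hh j⟩
  set G := (hitOp w p)^[K] (fun t => c * h t) with hG
  have hGw : SubWindow G := hch.hitOp_iterate hw hh.offset_le K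
  set x := c * K * m with hx
  have hx0 : 0 ≤ x := by positivity
  have hcx : |c - c ^ 2 * (K * m) - c / (1 + x)| ≤ (K * (32 * (L : ℝ) ^ 2)) ^ 2 * c ^ 3 := by
    have e : c - c ^ 2 * (K * m) - c / (1 + x) = -(c ^ 3 * (K * m) ^ 2 / (1 + x)) := by
      field_simp
      rw [hx]; ring
    rw [e, abs_neg, abs_of_nonneg (by positivity)]
    calc _ ≤ c ^ 3 * (K * m) ^ 2 := div_le_self (by positivity) (by linarith)
      _ ≤ c ^ 3 * (K * (32 * (L : ℝ) ^ 2)) ^ 2 := by gcongr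
      _ = _ := by ring
  have i1 := (((hh.dominated.const_mul c).sub (hb.const_mul (c ^ 2))).sub hGw.dominated).abs.integrable
  have i2 := (hb.sub (hh.dominated.const_mul (K * m))).abs.integrable
  calc _ ≤ ∫ t, (|c * h t - c ^ 2 * S t - G t| + c ^ 2 * |S t - K * m * h t| +
        (K * (32 * (L : ℝ) ^ 2)) ^ 2 * c ^ 3 * h t) := by
        refine integral_mono_of_nonneg (ae_of_all _ fun _ => abs_nonneg _)
          ((i1.add (i2.const_mul _)).add (hh.dominated.integrable.const_mul _))
          (ae_of_all _ fun t => ?_)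
        have e : G t - c / (1 + x) * h t = -(c * h t - c ^ 2 * S t - G t) +
          (-(c ^ 2 * (S t - K * m * h t))) + (c - c ^ 2 * (K * m) - c / (1 + x)) * h t := by ring
        dsimp only
        rw [e]
        refine (abs_add_le _ _).trans (add_le_add ((abs_add_le _ _).trans ?_) ?_)
        · rw [abs_neg, abs_neg, abs_mul, abs_of_nonneg (sq_nonneg c)]
        · rw [abs_mul, abs_of_nonneg (hh.nonneg t)]
          exact mul_le_mul_of_nonneg_right hcx (hh.nonneg t)
    _ = (∫ t, |c * h t - c ^ 2 * S t - G t|) + c ^ 2 * (∫ t, |S t - K * m * h t|) +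
        (K * (32 * (L : ℝ) ^ 2)) ^ 2 * c ^ 3 := by
        have i3 : Integrable fun t => |c * h t - c ^ 2 * S t - G t| + c ^ 2 * |S t - K * m * h t| :=
          i1.add (i2.const_mul _)
        rw [integral_add i3 (hh.dominated.integrable.const_mul _), integral_add i1 (i2.const_mul _),
          integral_const_mul, integral_const_mul, hh.integral_eq_one, mul_one]
    _ ≤ D * c ^ 3 + c ^ 2 * (400 * 400 * (L : ℝ) ^ 3 * √K) +
        (K * (32 * (L : ℝ) ^ 2)) ^ 2 * c ^ 3 :=
        add_le_add (add_le_add (H w p h c hw hh hc hch) (mul_le_mul_of_nonneg_left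
          (integral_abs_sum_pairOp_sub_le hw hh K) (sq_nonneg c))) le_rfl
    _ = _ := by ring

/-- Evolution of a small multiple of the invariant density over many generations. -/
lemma exists_integral_abs_evolution_le : ∃ C : ℝ, 0 ≤ C ∧ ∀ K : ℕ, ∃ D : ℝ, 0 ≤ D ∧
    ∀ (w : Config L → ℝ) (p : Cell L → ℝ) (h : ℝ → ℝ) (c : ℝ), IsUniformWeight w →
      IsSelfSimilarDensity p h → 0 ≤ c → c ≤ 1 / 2 → ∀ J : ℕ,
      ∫ t, |(hitOp w p)^[K * J] (fun t => c * h t) t -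
        c / (1 + c * (K * J) * ∫ s, pairOp w p h s) * h t| ≤
        J * (C * √K * c ^ 2 + D * c ^ 3) := by
  obtain ⟨C, hC, H⟩ := exists_integral_abs_block_le L
  refine ⟨C, hC, fun K => ?_⟩
  obtain ⟨D, hD, H⟩ := H K
  refine ⟨D, hD, fun w p h c hw hh hc hc2 J => ?_⟩
  set m := ∫ s, pairOp w p h s with hm
  have hm0 : 0 ≤ m := integral_pairOp_nonneg hw hh
  have sub : ∀ {c : ℝ}, 0 ≤ c → c ≤ 1 / 2 → SubWindow fun t => c * h t := fun {c} h0 h1 =>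
    ⟨hh.measurable.const_mul c, fun t => ⟨mul_nonneg h0 (hh.nonneg t), by
      have := mul_le_mul h1 (hh.le_window t) (hh.nonneg t) (by norm_num)
      linarith⟩⟩
  induction J with
  | zero => simp
  | succ J ih =>
    set d := c / (1 + c * (K * J) * m) with hd
    have hden : 1 ≤ 1 + c * (K * J) * m := le_add_of_nonneg_right (by positivity)
    have hd0 : 0 ≤ d := by positivity
    have hdc : d ≤ c := div_le_self hc hden
    -- The fractional linear form composes exactly over blocks: each one adds `K m` to the
    -- reciprocal of the coefficient.
    have e1 : c / (1 + c * (K * (J + 1 : ℕ)) * m) = d / (1 + d * K * m) := by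
      rw [hd]; push_cast; field_simp; ring
    set G := (hitOp w p)^[K * J] (fun t => c * h t) with hG
    have hGw : SubWindow G := (sub hc hc2).hitOp_iterate hw hh.offset_le _
    have hdw := sub hd0 (hdc.trans hc2)
    have e2 : (hitOp w p)^[K * (J + 1)] (fun t => c * h t) = (hitOp w p)^[K] G := by
      rw [hG, ← Function.iterate_add_apply, mul_add, mul_one, add_comm]
    rw [e1, e2]
    have i1 : Integrable fun t => |(hitOp w p)^[K] G t - (hitOp w p)^[K] (fun t => d * h t) t| :=
      ((hGw.hitOp_iterate hw hh.offset_le K).integrable.sub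
        (hdw.hitOp_iterate hw hh.offset_le K).integrable).abs
    have i2 : Integrable fun t => |(hitOp w p)^[K] (fun t => d * h t) t -
        d / (1 + d * K * m) * h t| :=
      ((hdw.hitOp_iterate hw hh.offset_le K).integrable.sub
        (hh.dominated.integrable.const_mul _)).abs
    calc _ ≤ ∫ t, (|(hitOp w p)^[K] G t - (hitOp w p)^[K] (fun t => d * h t) t| +
          |(hitOp w p)^[K] (fun t => d * h t) t - d / (1 + d * K * m) * h t|) :=
          integral_mono_of_nonneg (ae_of_all _ fun _ => abs_nonneg _) (i1.add i2)
            (ae_of_all _ fun t => abs_sub_le _ _ _)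
      _ = _ := integral_add i1 i2
      _ ≤ J * (C * √K * c ^ 2 + D * c ^ 3) + (C * √K * d ^ 2 + D * d ^ 3) :=
          add_le_add ((integral_abs_hitOp_iterate_sub_le hw hh.offset_le hGw hdw K).trans ih)
            (H w p h d hw hh hd0 hdw)
      _ ≤ J * (C * √K * c ^ 2 + D * c ^ 3) + (C * √K * c ^ 2 + D * c ^ 3) := by gcongr
      _ = _ := by push_cast; ring

end Scaling

end

/-! ### Energy dissipation and decay in `L²`. -/

section

variable {L : ℕ}

/-- Two distinct cells `a`, `b` are selected together with probability at least `q`, and every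
line which meets a certain subsquare of `a` of level `r` meets `b` in a chord of (relative) length
at least `c`. -/
def IsLinked (w : Config L → ℝ) (p : Cell L → ℝ) (h : ℝ → ℝ) (q c : ℝ) (r : ℕ) : Prop :=
  ∃ (a b : Cell L) (u : Fin r → Cell L), a ≠ b ∧
    q ≤ ∑ A, (if a ∈ A ∧ b ∈ A then w A else 0) ∧
    ∀ s, |s| ≤ 2 → c ≤ h ((s + wordOffset p r u) / L ^ r + p a - p b)

section FiniteSums

variable {ι : Type*} [Fintype ι] {W X : ι → ℝ}

/-- The defect in Cauchy–Schwarz is the variance of the ratios `X i / W i` with weights `W i`.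
Division by zero is harmless, since `W i = 0` forces `X i = 0`. -/
lemma sum_sq_div_eq (hX : ∀ i, 0 ≤ X i) (hXW : ∀ i, X i ≤ W i) :
    ∑ i, X i ^ 2 / W i = (∑ i, X i) ^ 2 / ∑ i, W i +
      ∑ i, W i * (X i / W i - (∑ i, X i) / ∑ i, W i) ^ 2 := by
  set u := (∑ i, X i) / ∑ i, W i with hu
  have e : ∀ i, X i ^ 2 / W i = 2 * u * X i - u ^ 2 * W i + W i * (X i / W i - u) ^ 2 := fun i => by
    rcases (hX i).trans (hXW i) |>.eq_or_lt with h0 | h0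
    · have : X i = 0 := le_antisymm (by rw [h0]; exact hXW i) (hX i)
      simp [← h0, this]
    · field_simp; ring
  simp only [e, Finset.sum_add_distrib, Finset.sum_sub_distrib, ← Finset.mul_sum]
  congr 1
  rcases (Finset.sum_nonneg fun i (_ : i ∈ Finset.univ) => (hX i).trans (hXW i)).eq_or_lt
    with h0 | h0
  · have : ∑ i, X i = 0 := le_antisymm (by rw [h0]; exact Finset.sum_le_sum fun i _ => hXW i)
      (Finset.sum_nonneg fun i _ => hX i)
    simp [← h0, this]
  · rw [hu]; field_simp; ring

lemma sq_div_sum_le (hX : ∀ i, 0 ≤ X i) (hXW : ∀ i, X i ≤ W i) {f : ℝ} (hf : 0 ≤ f)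
    (hfX : f ≤ ∑ i, X i) : f ^ 2 / ∑ i, W i ≤ ∑ i, X i ^ 2 / W i := by
  have hW : ∀ i, 0 ≤ W i := fun i => (hX i).trans (hXW i)
  rw [sum_sq_div_eq hX hXW]
  have h1 : 0 ≤ ∑ i, W i * (X i / W i - (∑ i, X i) / ∑ i, W i) ^ 2 :=
    Finset.sum_nonneg fun i _ => mul_nonneg (hW i) (sq_nonneg _)
  have h2 : f ^ 2 / ∑ i, W i ≤ (∑ i, X i) ^ 2 / ∑ i, W i :=
    div_le_div_of_nonneg_right (pow_le_pow_left₀ hf hfX 2) (Finset.sum_nonneg fun i _ => hW i)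
  linarith

/-- Here `u` and `v` are two ratios and `m` their overall mean. If `m ≤ u / 2`, the variance of the
first term pays; if `m > u / 2` but `v ≤ u / 4`, that of the second pays; otherwise `v` and `m` are
comparable to `u` and the interaction pays a multiple of `u^3`. -/
lemma interaction_bound {u v m x y q ω b κ : ℝ} (hu0 : 0 ≤ u) (hu1 : u ≤ 1) (hv0 : 0 ≤ v)
    (hm0 : 0 ≤ m) (hx : 0 ≤ x) (hq : 0 ≤ q) (hω : 0 ≤ ω) (hωy : ω ≤ y) (hb : x ≤ b) (hκ : 0 ≤ κ)
    (h1 : κ ≤ 1 / 4) (h2 : 16 * b * κ ≤ ω) (h3 : 8 * κ ≤ q * ω) :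
    κ * (x * u ^ 3) ≤ q * (x * u) * (y * v) * m + x * (u - m) ^ 2 + y * (v - m) ^ 2 := by
  have hy : 0 ≤ y := hω.trans hωy
  have k0 : 0 ≤ q * (x * u) * (y * v) * m := by positivity
  have k1 : 0 ≤ x * (u - m) ^ 2 := by positivity
  have k2 : 0 ≤ y * (v - m) ^ 2 := by positivity
  have hu3 : 0 ≤ u ^ 3 := by positivity
  have hu2 : 0 ≤ u ^ 2 := by positivity
  have hu32 : u ^ 3 ≤ u ^ 2 := pow_le_pow_of_le_one hu0 hu1 (by norm_num)
  by_cases c1 : m ≤ u / 2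
  · have a1 : u ^ 2 / 4 ≤ (u - m) ^ 2 := by nlinarith
    have a2 : κ * u ^ 3 ≤ 1 / 4 * u ^ 2 := mul_le_mul h1 hu32 hu3 (by norm_num)
    have a3 := mul_le_mul_of_nonneg_left
      (a2.trans (by linarith : 1 / 4 * u ^ 2 ≤ (u - m) ^ 2)) hx
    linarith
  push Not at c1
  by_cases c2 : v ≤ u / 4
  · have a1 : u ^ 2 / 16 ≤ (v - m) ^ 2 := by nlinarith
    have a2 : x * u ^ 3 ≤ b * u ^ 2 := mul_le_mul hb hu32 hu3 (hx.trans hb)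
    have a3 := mul_le_mul_of_nonneg_left a2 hκ
    have a4 := mul_le_mul (h2.trans hωy) a1 (by positivity) hy
    linarith
  · push Not at c2
    have a1 : u / 4 * (u / 2) ≤ v * m := mul_le_mul c2.le c1.le (by positivity) hv0
    have a2 : 8 * κ ≤ q * y := h3.trans (mul_le_mul_of_nonneg_left hωy hq)
    have a3 := mul_le_mul a2 a1 (by positivity) (by positivity)
    have a4 := mul_le_mul_of_nonneg_left a3 (mul_nonneg hx hu0)
    linarith

/-- Loss of energy caused by the interaction of two terms. -/
lemma sq_div_sum_add_le (hX : ∀ i, 0 ≤ X i) (hXW : ∀ i, X i ≤ W i) {i j : ι} (hij : i ≠ j)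
    {f q ω b κ : ℝ} (hf : 0 ≤ f) (hfX : f ≤ ∑ i, X i - q * X i * X j) (hq : 0 ≤ q)
    (hω : 0 ≤ ω) (hωj : ω ≤ W j) (hb : W i ≤ b) (hκ : 0 ≤ κ)
    (h1 : κ ≤ 1 / 4) (h2 : 16 * b * κ ≤ ω) (h3 : 8 * κ ≤ q * ω) :
    f ^ 2 / ∑ i, W i + κ * (X i ^ 3 / W i ^ 2) ≤ ∑ i, X i ^ 2 / W i := by
  have hW : ∀ i, 0 ≤ W i := fun i => (hX i).trans (hXW i)
  rcases (hW i).eq_or_lt with h0 | h0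
  · rw [← h0]
    simp only [ne_eq, OfNat.ofNat_ne_zero, not_false_eq_true, zero_pow, div_zero, mul_zero, add_zero]
    refine sq_div_sum_le hX hXW hf (hfX.trans (sub_le_self _ ?_))
    exact mul_nonneg (mul_nonneg hq (hX i)) (hX j)
  rw [sum_sq_div_eq hX hXW]
  set T := ∑ i, X i with hT
  set S := ∑ i, W i with hS
  have hS0 : 0 < S := h0.trans_le (Finset.single_le_sum (fun i _ => hW i) (Finset.mem_univ i))
  have hT0 : 0 ≤ T := Finset.sum_nonneg fun i _ => hX i
  have hvar : W i * (X i / W i - T / S) ^ 2 + W j * (X j / W j - T / S) ^ 2 ≤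
      ∑ i, W i * (X i / W i - T / S) ^ 2 := by
    classical
    rw [← Finset.sum_pair (f := fun i => W i * (X i / W i - T / S) ^ 2) hij]
    exact Finset.sum_le_sum_of_subset_of_nonneg (Finset.subset_univ _)
      fun i _ _ => mul_nonneg (hW i) (sq_nonneg _)
  have hkill : f ^ 2 / S ≤ T ^ 2 / S - q * X i * X j * (T / S) := by
    have e : T ^ 2 / S - q * X i * X j * (T / S) = (T - q * X i * X j) * T / S := by
      field_simp
    rw [e]
    refine div_le_div_of_nonneg_right ?_ hS0.le
    have : T - q * X i * X j ≤ T := sub_le_self _ (mul_nonneg (mul_nonneg hq (hX i)) (hX j))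
    nlinarith
  suffices H : κ * (X i ^ 3 / W i ^ 2) ≤ q * X i * X j * (T / S) +
      W i * (X i / W i - T / S) ^ 2 + W j * (X j / W j - T / S) ^ 2 by linarith
  set u := X i / W i with hu
  set m := T / S with hm
  have hm0 : 0 ≤ m := by positivity
  have hu0 : 0 ≤ u := div_nonneg (hX i) (hW i)
  have hu1 : u ≤ 1 := div_le_one_of_le₀ (hXW i) (hW i)
  have eXi : X i = W i * u := by rw [hu]; field_simp
  have e3 : X i ^ 3 / W i ^ 2 = W i * u ^ 3 := by rw [eXi]; field_simp
  rw [e3]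
  -- If `ω = 0` the weight `W j` might vanish, but then `h3` forces `κ = 0`.
  rcases hω.eq_or_lt with hω0 | hω0
  · rw [← hω0, mul_zero] at h3
    have : κ = 0 := le_antisymm (by linarith) hκ
    rw [this, zero_mul]
    have k0 := mul_nonneg (mul_nonneg (mul_nonneg hq (hX i)) (hX j)) hm0
    have k1 := mul_nonneg (hW i) (sq_nonneg (u - m))
    have k2 := mul_nonneg (hW j) (sq_nonneg (X j / W j - m))
    linarith
  have hWj : 0 < W j := hω0.trans_le hωj
  have eXj : X j = W j * (X j / W j) := by field_simp
  have := interaction_bound hu0 hu1 (div_nonneg (hX j) (hW j)) hm0 (hW i) hq hω hωj hb hκ h1 h2 h3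
  rwa [← eXi, ← eXj] at this

end FiniteSums

section Energy

variable {w : Config L → ℝ} {p : Cell L → ℝ} {h f H : ℝ → ℝ}

/-- It suffices that `a` itself is selected, with probability `1 / L`, and hit. -/
lemma le_hitOp (hw : IsUniformWeight w) (hf : SubWindow f) (a : Cell L) (t : ℝ) :
    (1 / (L : ℝ)) * f (L * t - p a) ≤ hitOp w p f t := by
  rw [← hw.marginal a, Finset.sum_mul]
  refine Finset.sum_le_sum fun A _ => ?_
  have hP : ∀ s : Config L, ∏ b ∈ s, (1 - f (L * t - p b)) ≤ 1 := fun s => Finset.prod_le_one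
    (fun b _ => by linarith [hf.le_one (L * t - p b)])
    (fun b _ => by linarith [hf.nonneg (L * t - p b)])
  split_ifs with ha
  · refine mul_le_mul_of_nonneg_left ?_ (hw.nonneg A)
    rw [← Finset.mul_prod_erase A _ ha]
    have := mul_le_mul_of_nonneg_left (hP (A.erase a)) (sub_nonneg.2 (hf.le_one (L * t - p a)))
    linarith
  · rw [zero_mul]
    exact mul_nonneg (hw.nonneg A) (sub_nonneg.2 (hP A))

lemma le_hitOp_iterate (hw : IsUniformWeight w) (hp : ∀ a, |p a| ≤ 2 * ((L : ℝ) - 1))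
    (hf : SubWindow f) (n : ℕ) (u : Fin n → Cell L) (t : ℝ) :
    (1 / (L : ℝ) ^ n) * f (L ^ n * t - wordOffset p n u) ≤ (hitOp w p)^[n] f t := by
  induction n generalizing t with
  | zero => simp [wordOffset]
  | succ n ih =>
    rw [Function.iterate_succ_apply']
    refine le_trans ?_ (le_hitOp hw (hf.hitOp_iterate hw hp n) (u 0) t)
    have := mul_le_mul_of_nonneg_left (ih (Fin.tail u) (L * t - p (u 0)))
      (by positivity : 0 ≤ 1 / (L : ℝ))
    refine le_trans (le_of_eq ?_) this
    rw [← mul_assoc, one_div_mul_one_div, ← pow_succ']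
    congr 2
    simp only [wordOffset]
    ring

/-- After splitting off `a`, the remaining product is at most `1 - x b`. So a single pair already
makes the union bound lose `x a * x b`. -/
lemma mul_le_unionBound_error {ι : Type*} [DecidableEq ι] {s : Finset ι} {x : ι → ℝ}
    (h0 : ∀ i, 0 ≤ x i) (h1 : ∀ i, x i ≤ 1) {a b : ι} (ha : a ∈ s) (hb : b ∈ s) (hab : a ≠ b) :
    x a * x b ≤ ∑ i ∈ s, x i - (1 - ∏ i ∈ s, (1 - x i)) := by
  have hb' : b ∈ s.erase a := Finset.mem_erase.2 ⟨hab.symm, hb⟩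
  have l := (unionBound_error (s := s.erase a) (fun i _ => h0 i) (fun i _ => h1 i)).1
  rw [← Finset.add_sum_erase s _ ha, ← Finset.mul_prod_erase s _ ha]
  have hP : ∏ i ∈ s.erase a, (1 - x i) ≤ 1 - x b := by
    rw [← Finset.mul_prod_erase _ _ hb']
    exact mul_le_of_le_one_right (sub_nonneg.2 (h1 b)) (Finset.prod_le_one
      (fun i _ => sub_nonneg.2 (h1 i)) (fun i _ => by linarith [h0 i]))
  have := mul_le_mul_of_nonneg_left hP (h0 a)
  linarith

lemma hitOp_le_avgOp_sub (hw : IsUniformWeight w) (hf : SubWindow f) {a b : Cell L} (hab : a ≠ b)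
    {q : ℝ} (hq : q ≤ ∑ A, (if a ∈ A ∧ b ∈ A then w A else 0)) (t : ℝ) :
    hitOp w p f t ≤ avgOp p f t - q * (f (L * t - p a) * f (L * t - p b)) := by
  have : q * (f (L * t - p a) * f (L * t - p b)) ≤ avgOp p f t - hitOp w p f t := by
    rw [avgOp_sub_hitOp_eq hw]
    refine (mul_le_mul_of_nonneg_right hq (mul_nonneg (hf.nonneg _) (hf.nonneg _))).trans ?_
    rw [Finset.sum_mul]
    refine Finset.sum_le_sum fun A _ => ?_
    split_ifs with hA
    · exact mul_le_mul_of_nonneg_left (mul_le_unionBound_error (x := fun a => f (L * t - p a))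
        (fun _ => hf.nonneg _) (fun _ => hf.le_one _) hA.1 hA.2 hab) (hw.nonneg A)
    · rw [zero_mul]
      exact mul_nonneg (hw.nonneg A) (unionBound_error (fun _ _ => hf.nonneg _)
        (fun _ _ => hf.le_one _)).1
  linarith

lemma avgOp_iterate_succ_eq_sum (r : ℕ) (g : ℝ → ℝ) (t : ℝ) :
    (avgOp p)^[r + 1] g t = ∑ i : Cell L × (Fin r → Cell L),
      (1 / (L : ℝ) ^ (r + 1)) * g (L ^ r * (L * t - p i.1) - wordOffset p r i.2) := by
  rw [Function.iterate_succ_apply', avgOp, ← Finset.mul_sum,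
    Fintype.sum_prod_type (f := fun i : Cell L × (Fin r → Cell L) =>
      g (L ^ r * (L * t - p i.1) - wordOffset p r i.2))]
  simp only [avgOp_iterate_eq_sum, ← Finset.mul_sum]
  rw [← mul_assoc, one_div_mul_one_div, ← pow_succ']

/-- Apply `sq_div_sum_add_le` to the descendants of generation `r + 1`, with `X` and `W` the
rescaled values of `f` and `H`. The interacting pair consists of the linked subsquare `(a, u)` and a
subsquare of `b` met by the same line on which `H` is not small. -/
lemma energy_step_pointwise (hw : IsUniformWeight w) (hh : IsSelfSimilarDensity p h) {q c : ℝ}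
    {r : ℕ} (hq : 0 ≤ q) (hc : 0 ≤ c) {a b : Cell L} {u : Fin r → Cell L} (hab : a ≠ b)
    (hqA : q ≤ ∑ A, (if a ∈ A ∧ b ∈ A then w A else 0))
    (hlink : ∀ s, |s| ≤ 2 → c ≤ h ((s + wordOffset p r u) / L ^ r + p a - p b))
    (hf : SubWindow f) (hfH : ∀ t, f t ≤ H t) (hhH : ∀ t, h t ≤ 2 * H t) (hH : ∀ t, H t ≤ 16)
    {κ : ℝ} (hκ : 0 ≤ κ) (h1 : κ ≤ 1 / 4) (h2 : 512 * (L : ℝ) ^ (2 * r + 1) * κ ≤ c)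
    (h3 : 16 * (L : ℝ) ^ (2 * r + 1) * κ ≤ q * c) (t : ℝ) :
    (hitOp w p)^[r + 1] f t ^ 2 / (avgOp p)^[r + 1] H t +
      κ * (1 / (L : ℝ) ^ (r + 1)) * (f (L ^ r * (L * t - p a) - wordOffset p r u) ^ 3 /
        H (L ^ r * (L * t - p a) - wordOffset p r u) ^ 2) ≤
      (avgOp p)^[r + 1] (fun s => f s ^ 2 / H s) t := by
  have hL0 : (0 : ℝ) < L := by exact_mod_cast Nat.pos_of_ne_zero hw.ne_zero
  set ℓ : ℝ := 1 / (L : ℝ) ^ (r + 1) with hℓ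
  have hℓ0 : 0 < ℓ := by positivity
  have hL1 : (1 : ℝ) ≤ L := by exact_mod_cast Nat.pos_of_ne_zero hw.ne_zero
  have hℓ1 : ℓ ≤ 1 := div_le_one_of_le₀ (one_le_pow₀ hL1) (by positivity)
  set pos : Cell L × (Fin r → Cell L) → ℝ :=
    fun i => L ^ r * (L * t - p i.1) - wordOffset p r i.2 with hpos
  set W : Cell L × (Fin r → Cell L) → ℝ := fun i => ℓ * H (pos i) with hW
  set X : Cell L × (Fin r → Cell L) → ℝ := fun i => ℓ * f (pos i) with hX
  have hX0 : ∀ i, 0 ≤ X i := fun i => mul_nonneg hℓ0.le (hf.nonneg _)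
  have hXW : ∀ i, X i ≤ W i := fun i => mul_le_mul_of_nonneg_left (hfH _) hℓ0.le
  have eT : (avgOp p)^[r + 1] f t = ∑ i, X i := avgOp_iterate_succ_eq_sum r f t
  have eH : (avgOp p)^[r + 1] H t = ∑ i, W i := avgOp_iterate_succ_eq_sum r H t
  have e2 : (avgOp p)^[r + 1] (fun s => f s ^ 2 / H s) t = ∑ i, X i ^ 2 / W i := by
    rw [avgOp_iterate_succ_eq_sum]
    refine Finset.sum_congr rfl fun i _ => ?_
    simp only [hX, hW]
    rcases eq_or_ne (H (pos i)) 0 with h0 | h0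
    · change ℓ * (f (pos i) ^ 2 / H (pos i)) = _
      simp [h0]
    · change ℓ * (f (pos i) ^ 2 / H (pos i)) = _
      field_simp
  have hF := hf.hitOp_iterate hw hh.offset_le (r + 1)
  rw [eH, e2]
  set s := L ^ r * (L * t - p a) - wordOffset p r u with hs
  have e3 : κ * ℓ * (f s ^ 3 / H s ^ 2) = κ * (X (a, u) ^ 3 / W (a, u) ^ 2) := by
    simp only [hX, hW]
    change κ * ℓ * (f s ^ 3 / H s ^ 2) = κ * ((ℓ * f s) ^ 3 / (ℓ * H s) ^ 2)
    rcases eq_or_ne (H s) 0 with h0 | h0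
    · simp [h0]
    · field_simp
  rw [e3]
  by_cases hs2 : |s| ≤ 2
  · have hb : c ≤ h (L * t - p b) := by
      refine (hlink s hs2).trans (le_of_eq ?_)
      congr 1
      rw [hs]; field_simp; ring
    -- Pigeonhole: there are `L^(2r)` words, and their values of `h` sum to `L^r` times a number
    -- which is at least `c`.
    obtain ⟨v, hv⟩ : ∃ v : Fin r → Cell L,
        c / L ^ r ≤ h (L ^ r * (L * t - p b) - wordOffset p r v) := by
      by_contra hcon
      push Not at hcon
      have e := congrFun (hh.avgOp_iterate_eq hw.ne_zero r) (L * t - p b)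
      rw [avgOp_iterate_eq_sum] at e
      have : ∑ v : Fin r → Cell L, h (L ^ r * (L * t - p b) - wordOffset p r v) <
          ∑ v : Fin r → Cell L, c / (L : ℝ) ^ r :=
        Finset.sum_lt_sum_of_nonempty ⟨u, Finset.mem_univ _⟩ fun v _ => hcon v
      simp only [Finset.sum_const, Finset.card_univ, Fintype.card_fun, Fintype.card_prod,
        Fintype.card_fin, nsmul_eq_mul] at this
      push_cast at this
      have h4 := mul_lt_mul_of_pos_left this (by positivity : 0 < 1 / (L : ℝ) ^ r)
      rw [e] at h4
      have h5 : 1 / (L : ℝ) ^ r * (((L : ℝ) * L) ^ r * (c / L ^ r)) = c := by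
        rw [mul_pow]; field_simp
      linarith
    -- The lower bound `ω` for the weight of `(b, v)` is the product of `1 / L^(r + 1)`, the
    -- pigeonhole bound `c / L^r`, and the `1 / 2` from `h ≤ 2 H`.
    refine sq_div_sum_add_le hX0 hXW (i := (a, u)) (j := (b, v)) (q := q)
      (ω := c / (2 * (L : ℝ) ^ (2 * r + 1))) (b := 16)
      (fun hab' => hab (congrArg Prod.fst hab')) (hF.nonneg t) ?_ hq (by positivity) ?_ ?_ hκ
      h1 ?_ ?_
    · rw [← eT, Function.iterate_succ_apply']
      have hG := hf.hitOp_iterate hw hh.offset_le r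
      refine (hitOp_le_avgOp_sub hw hG hab hqA t).trans (sub_le_sub ?_ ?_)
      · rw [Function.iterate_succ_apply']
        exact avgOp_mono (hitOp_iterate_le_avgOp_iterate hw hh.offset_le hf r) t
      · have key : ∀ (a : Cell L) (u : Fin r → Cell L),
            X (a, u) ≤ (hitOp w p)^[r] f (L * t - p a) := fun a u => by
          refine le_trans ?_ (le_hitOp_iterate hw hh.offset_le hf r u (L * t - p a))
          refine mul_le_mul_of_nonneg_right ?_ (hf.nonneg _)
          exact one_div_le_one_div_of_le (by positivity)
            (pow_le_pow_right₀ hL1 (Nat.le_succ r))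
        rw [mul_assoc]
        exact mul_le_mul_of_nonneg_left (mul_le_mul (key a u) (key b v) (hX0 _) (hG.nonneg _)) hq
    · change _ ≤ ℓ * H (L ^ r * (L * t - p b) - wordOffset p r v)
      have h6 := hv.trans (hhH _)
      have h7 : c / (L : ℝ) ^ r / 2 ≤ H (L ^ r * (L * t - p b) - wordOffset p r v) := by linarith
      refine le_trans (le_of_eq ?_) (mul_le_mul_of_nonneg_left h7 hℓ0.le)
      rw [hℓ]
      field_simp
      ring
    · exact (mul_le_of_le_one_left ((hf.nonneg _).trans (hfH _)) hℓ1).trans (hH _)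
    · rw [le_div_iff₀ (by positivity)]; linarith
    · rw [mul_div_assoc', le_div_iff₀ (by positivity)]; linarith
  · have : X (a, u) = 0 := by
      have := (hf.2 s).2
      rw [window_of_not_mem (not_le.1 hs2)] at this
      have : f s = 0 := le_antisymm this (hf.nonneg s)
      change ℓ * f s = 0
      rw [this, mul_zero]
    rw [this]
    simp only [ne_eq, OfNat.ofNat_ne_zero, not_false_eq_true, zero_pow, zero_div, mul_zero, add_zero]
    refine sq_div_sum_le hX0 hXW (hF.nonneg t) ?_
    rw [← eT]
    exact hitOp_iterate_le_avgOp_iterate hw hh.offset_le hf (r + 1) t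

lemma SubWindow.dominated_div (hf : SubWindow f) (hHm : Measurable H) (hfH : ∀ t, f t ≤ H t)
    (n : ℕ) : Dominated 1 (fun t => f t ^ (n + 1) / H t ^ n) := by
  refine Dominated.of_abs_le ((hf.1.pow_const _).div (hHm.pow_const _)) hf.dominated fun t => ?_
  have h0 := hf.nonneg t
  have h1 := hfH t
  rw [abs_of_nonneg (div_nonneg (pow_nonneg h0 _) (pow_nonneg (h0.trans h1) _)), abs_of_nonneg h0]
  rcases (h0.trans h1).eq_or_lt with h2 | h2
  · rw [le_antisymm (h2 ▸ h1) h0]; simp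
  · rw [div_le_iff₀ (pow_pos h2 n), pow_succ, mul_comm]
    exact mul_le_mul_of_nonneg_left (pow_le_pow_left₀ h0 h1 n) h0

/-- Integration in `t`: the averaged energy keeps its integral, and the change of variables in the
dissipated term produces the second factor `1 / L^(r + 1)`. -/
lemma energy_step (hw : IsUniformWeight w) (hh : IsSelfSimilarDensity p h) {q c : ℝ}
    {r : ℕ} (hq : 0 ≤ q) (hc : 0 ≤ c) (hlink : IsLinked w p h q c r)
    (hf : SubWindow f) (hfH : ∀ t, f t ≤ H t) (hHm : Measurable H) (hhH : ∀ t, h t ≤ 2 * H t)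
    (hH : ∀ t, H t ≤ 16)
    {κ : ℝ} (hκ : 0 ≤ κ) (h1 : κ ≤ 1 / 4) (h2 : 512 * (L : ℝ) ^ (2 * r + 1) * κ ≤ c)
    (h3 : 16 * (L : ℝ) ^ (2 * r + 1) * κ ≤ q * c) :
    (∫ t, (hitOp w p)^[r + 1] f t ^ 2 / (avgOp p)^[r + 1] H t) +
      κ * (1 / (L : ℝ) ^ (r + 1)) ^ 2 * (∫ t, f t ^ 3 / H t ^ 2) ≤ ∫ t, f t ^ 2 / H t := by
  obtain ⟨a, b, u, hab, hqA, hlk⟩ := hlink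
  have hL0 : (0 : ℝ) < L := by exact_mod_cast Nat.pos_of_ne_zero hw.ne_zero
  have d2 : Integrable fun t => f t ^ 2 / H t := by
    simpa using (hf.dominated_div hHm hfH 1).integrable
  have d3 := (hf.dominated_div hHm hfH 2).integrable
  have hF := hf.hitOp_iterate hw hh.offset_le (r + 1)
  have hFH : ∀ t, (hitOp w p)^[r + 1] f t ≤ (avgOp p)^[r + 1] H t := fun t =>
    (hitOp_iterate_le_avgOp_iterate hw hh.offset_le hf (r + 1) t).trans
      (avgOp_iterate_mono hfH (r + 1) t)
  have d2' : Integrable fun t => (hitOp w p)^[r + 1] f t ^ 2 / (avgOp p)^[r + 1] H t := by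
    simpa using (hF.dominated_div (measurable_avgOp_iterate hHm (r + 1)) hFH 1).integrable
  set G := fun t => f t ^ 3 / H t ^ 2 with hG
  have e : ∀ t, f (L ^ r * (L * t - p a) - wordOffset p r u) ^ 3 /
        H (L ^ r * (L * t - p a) - wordOffset p r u) ^ 2 =
      G ((L : ℝ) ^ (r + 1) * t - (L ^ r * p a + wordOffset p r u)) := fun t => by
    have : (L : ℝ) ^ r * (L * t - p a) - wordOffset p r u =
      (L : ℝ) ^ (r + 1) * t - (L ^ r * p a + wordOffset p r u) := by ring
    rw [hG, this]
  have ha := integrable_comp_affine (L := L ^ (r + 1)) (by have := hw.ne_zero; positivity) d3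
    (L ^ r * p a + wordOffset p r u)
  have hb := integral_comp_affine (L := L ^ (r + 1)) (g := G) (L ^ r * p a + wordOffset p r u)
  push_cast at ha hb
  calc _ = ∫ t, ((hitOp w p)^[r + 1] f t ^ 2 / (avgOp p)^[r + 1] H t +
        κ * (1 / (L : ℝ) ^ (r + 1)) *
          G ((L : ℝ) ^ (r + 1) * t - (L ^ r * p a + wordOffset p r u))) := by
        rw [integral_add d2' (ha.const_mul _), integral_const_mul, hb]; ring
    _ ≤ ∫ t, (avgOp p)^[r + 1] (fun s => f s ^ 2 / H s) t := by
        refine integral_mono (d2'.add (ha.const_mul _))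
          (integrable_avgOp_iterate hw.ne_zero d2 _) fun t => ?_
        have := energy_step_pointwise hw hh hq hc hab hqA hlk hf hfH hhH hH hκ h1 h2 h3 t
        rw [e] at this
        exact this
    _ = _ := integral_avgOp_iterate hw.ne_zero d2 _

/-- Power means of `v = f / H` for the measure `H dt` of mass `4`. The tangent inequality `v^3 ≥
(3/2) σ v^2 - σ^3 / 2` comes from the factorization `(v - σ)^2 (2 v + σ) ≥ 0`, taken at the root
mean square `σ`. -/
lemma integral_cube_div_ge (hf : SubWindow f) (hfH : ∀ t, f t ≤ H t) (hHm : Measurable H)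
    (hHi : Integrable H) (hH4 : ∫ t, H t = 4) :
    √(∫ t, f t ^ 2 / H t) ^ 3 / 2 ≤ ∫ t, f t ^ 3 / H t ^ 2 := by
  set e := ∫ t, f t ^ 2 / H t with he
  have he0 : 0 ≤ e := integral_nonneg fun t =>
    div_nonneg (sq_nonneg _) ((hf.nonneg t).trans (hfH t))
  set σ := √e / 2 with hσ
  have hσ0 : 0 ≤ σ := by positivity
  have d2 : Integrable fun t => f t ^ 2 / H t := by
    simpa using (hf.dominated_div hHm hfH 1).integrable
  have d3 := (hf.dominated_div hHm hfH 2).integrable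
  have hee : e = √e ^ 2 := (Real.sq_sqrt he0).symm
  calc √e ^ 3 / 2 = (3 / 2) * σ * e - (σ ^ 3 / 2) * 4 := by
        rw [hσ]; nth_rw 3 [hee]; ring
    _ = ∫ t, ((3 / 2) * σ * (f t ^ 2 / H t) - (σ ^ 3 / 2) * H t) := by
        rw [integral_sub (d2.const_mul _) (hHi.const_mul _), integral_const_mul,
          integral_const_mul, hH4]
    _ ≤ _ := by
        refine integral_mono ((d2.const_mul _).sub (hHi.const_mul _)) d3 fun t => ?_
        have h0 := hf.nonneg t
        rcases (h0.trans (hfH t)).eq_or_lt with h2 | h2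
        · simp [← h2]
        · set v := f t / H t with hv
          have hv0 : 0 ≤ v := by positivity
          have ef : f t = H t * v := by rw [hv]; field_simp
          have e1 : f t ^ 2 / H t = H t * v ^ 2 := by rw [ef]; field_simp
          have e2 : f t ^ 3 / H t ^ 2 = H t * v ^ 3 := by rw [ef]; field_simp
          simp only [e1, e2]
          have : 0 ≤ H t * ((v - σ) ^ 2 * (2 * v + σ)) := by positivity
          nlinarith

end Energy

/-- The recursion implies `z (j + 1) ≤ z j / (1 + c z j / 2)`, so `1 / z` grows by at least `c / 2`
per step. -/
lemma sqrt_recursion_le {z : ℕ → ℝ} {c : ℝ} (hc : 0 < c) (hz : ∀ j, 0 ≤ z j)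
    (h : ∀ j, z (j + 1) ^ 2 + c * z j ^ 3 ≤ z j ^ 2) (j : ℕ) : z j * (c * j) ≤ 2 := by
  have step : ∀ j, z (j + 1) * (1 + c * z j / 2) ≤ z j := fun j => by
    have h0 := hz j
    have hx : 0 ≤ c * z j := by positivity
    refine (pow_le_pow_iff_left₀ (mul_nonneg (hz _) (by positivity)) h0 two_ne_zero).1 ?_
    rw [mul_pow]
    have h1 : z (j + 1) ^ 2 ≤ z j ^ 2 * (1 - c * z j) := by linarith [h j]
    calc _ ≤ z j ^ 2 * (1 - c * z j) * (1 + c * z j / 2) ^ 2 := by gcongr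
      _ = z j ^ 2 - z j ^ 2 * (3 / 4 * (c * z j) ^ 2 + (c * z j) ^ 3 / 4) := by ring
      _ ≤ z j ^ 2 := sub_le_self _ (by positivity)
  induction j with
  | zero => simp
  | succ j ih =>
    have h0 := hz j
    have h1 := hz (j + 1)
    have h2 := step j
    push_cast
    by_cases hle : z j * c ≤ 2
    · rcases h0.eq_or_lt with h3 | h3
      · rw [← h3] at h2
        have : z (j + 1) = 0 := le_antisymm (by simpa using h2) h1
        rw [this]; simp
      · have h4 : z (j + 1) ≤ z j / (1 + c * z j / 2) := by
          rw [le_div_iff₀ (by positivity)]; exact h2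
        calc z (j + 1) * (c * (j + 1)) ≤ z j / (1 + c * z j / 2) * (c * (j + 1)) := by gcongr
          _ = (z j * (c * j) + c * z j) / (1 + c * z j / 2) := by ring
          _ ≤ (2 + c * z j) / (1 + c * z j / 2) := by gcongr
          _ = 2 := by field_simp
    -- This case is void: the recursion would make `z (j + 1) ^ 2` negative.
    · push Not at hle
      have h5 : 0 ≤ z (j + 1) ^ 2 := sq_nonneg _
      have h6 := h j
      have h7 : 0 < z j := by
        rcases h0.eq_or_lt with h3 | h3
        · rw [← h3] at hle; linarith
        · exact h3
      nlinarith [pow_pos h7 2]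

variable (L) in
/-- The hitting probabilities decay in `L²` like the inverse of the generation. -/
theorem exists_integral_sq_hitOp_iterate_le {q c : ℝ} (hq : 0 < q) (hc : 0 < c) (r : ℕ) :
    ∃ C : ℝ, 0 ≤ C ∧ ∀ (w : Config L → ℝ) (p : Cell L → ℝ) (h : ℝ → ℝ), IsUniformWeight w →
      IsSelfSimilarDensity p h → IsLinked w p h q c r → ∀ k : ℕ, 1 ≤ k →
      ∫ t, (hitOp w p)^[k] window t ^ 2 ≤ C / k ^ 2 := by
  rcases Nat.eq_zero_or_pos L with rfl | hLpos
  · exact ⟨0, le_rfl, fun w p h hw => absurd hw.two_le (by norm_num)⟩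
  have hL0 : (0 : ℝ) < L := by exact_mod_cast hLpos
  set κ := min (1 / 4) (min (c / (512 * (L : ℝ) ^ (2 * r + 1))) (q * c / (16 * (L : ℝ) ^ (2 * r + 1))))
    with hκ
  have hκ0 : 0 < κ := lt_min (by norm_num) (lt_min (by positivity) (by positivity))
  have k1 : κ ≤ 1 / 4 := min_le_left _ _
  have k2 : 512 * (L : ℝ) ^ (2 * r + 1) * κ ≤ c := by
    have : κ ≤ _ := (min_le_right _ _).trans (min_le_left _ _)
    rw [le_div_iff₀ (by positivity)] at this; linarith
  have k3 : 16 * (L : ℝ) ^ (2 * r + 1) * κ ≤ q * c := by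
    have : κ ≤ _ := (min_le_right _ _).trans (min_le_right _ _)
    rw [le_div_iff₀ (by positivity)] at this; linarith
  set d := κ * (1 / (L : ℝ) ^ (r + 1)) ^ 2 / 2 with hd
  have hd0 : 0 < d := by positivity
  refine ⟨256 * ((r : ℝ) + 1) ^ 2 / d ^ 2 + 4 * ((r : ℝ) + 1) ^ 2, by positivity,
    fun w p h hw hh hlink k hk => ?_⟩
  set f := fun k => (hitOp w p)^[k] window with hf
  set H := fun k => (avgOp p)^[k] window with hH
  have hfw : ∀ k, SubWindow (f k) := fun k => subWindow_window.hitOp_iterate hw hh.offset_le k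
  have hfH : ∀ k t, f k t ≤ H k t := fun k =>
    hitOp_iterate_le_avgOp_iterate hw hh.offset_le subWindow_window k
  have hHm : ∀ k, Measurable (H k) := fun k => measurable_avgOp_iterate measurable_window k
  have hHi : ∀ k, Integrable (H k) := fun k =>
    integrable_avgOp_iterate hw.ne_zero integrable_window k
  have hH4 : ∀ k, ∫ t, H k t = 4 := fun k => by
    rw [hH]; rw [integral_avgOp_iterate hw.ne_zero integrable_window, integral_window]
  have hH16 : ∀ k t, H k t ≤ 16 := fun k => avgOp_iterate_window_le_const hw.ne_zero hh k
  -- Average the inequality `h ≤ 2 window`: its left side is invariant, so the reference function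
  -- never falls below `h / 2`.
  have hhH : ∀ k t, h t ≤ 2 * H k t := fun k t => by
    have := avgOp_iterate_mono (p := p) hh.le_window k t
    rwa [avgOp_iterate_const_mul, hh.avgOp_iterate_eq hw.ne_zero] at this
  set e := fun k => ∫ t, f k t ^ 2 / H k t with he
  have he0 : ∀ k, 0 ≤ e k := fun k => integral_nonneg fun t =>
    div_nonneg (sq_nonneg _) (((hfw k).nonneg t).trans (hfH k t))
  have hrec : ∀ k, e (k + (r + 1)) + d * √(e k) ^ 3 ≤ e k := fun k => by
    have s1 := energy_step hw hh hq.le hc.le hlink (hfw k) (hfH k) (hHm k) (hhH k) (hH16 k)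
      hκ0.le k1 k2 k3
    have s2 := integral_cube_div_ge (hfw k) (hfH k) (hHm k) (hHi k) (hH4 k)
    have e1 : (hitOp w p)^[r + 1] (f k) = f (k + (r + 1)) := by
      rw [hf, add_comm k]; exact (Function.iterate_add_apply _ _ _ _).symm
    have e2 : (avgOp p)^[r + 1] (H k) = H (k + (r + 1)) := by
      rw [hH, add_comm k]; exact (Function.iterate_add_apply _ _ _ _).symm
    rw [e1, e2] at s1
    have s3 := mul_le_mul_of_nonneg_left s2 (by positivity : 0 ≤ κ * (1 / (L : ℝ) ^ (r + 1)) ^ 2)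
    have e3 : κ * (1 / (L : ℝ) ^ (r + 1)) ^ 2 * (√(e k) ^ 3 / 2) = d * √(e k) ^ 3 := by
      rw [hd]; ring
    rw [← e3]
    linarith
  -- Dissipation is visible only every `r + 1` generations; other `k` are compared with the
  -- preceding multiple, using that `f` decreases with the generation.
  have hz := sqrt_recursion_le (z := fun j => √(e (j * (r + 1)))) hd0
    (fun j => Real.sqrt_nonneg _) (fun j => by
      rw [Real.sq_sqrt (he0 _), Real.sq_sqrt (he0 _), add_mul, one_mul]; exact hrec _)
  have sq16 : ∀ k, ∫ t, f k t ^ 2 ≤ 16 * e k := fun k => by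
    rw [he, ← integral_const_mul]
    refine integral_mono_of_nonneg (ae_of_all _ fun t => sq_nonneg _) ?_ (ae_of_all _ fun t => ?_)
    · refine Integrable.const_mul ?_ _
      simpa using ((hfw k).dominated_div (hHm k) (hfH k) 1).integrable
    · have h0 := (hfw k).nonneg t
      have h1 := hfH k t
      dsimp only
      rcases (h0.trans h1).eq_or_lt with h2 | h2
      · rw [le_antisymm (h2 ▸ h1) h0]; simp
      · rw [mul_div_assoc', le_div_iff₀ h2, mul_comm]
        exact mul_le_mul_of_nonneg_right (hH16 k t) (sq_nonneg _)
  have anti : ∀ k n t, f (k + n) t ≤ f k t := fun k n t => by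
    have : f (k + n) = (hitOp w p)^[k] (f n) := Function.iterate_add_apply _ _ _ _
    rw [this]
    exact hitOp_iterate_mono hw hh.offset_le subWindow_window (fun t => ((hfw n).2 t).2) k t
  have sqi : ∀ k, Integrable fun t => f k t ^ 2 := fun k => by
    simpa [sq] using (hfw k).dominated.integrable_mul (hfw k).dominated
  change ∫ t, f k t ^ 2 ≤ _
  have hk' : (1 : ℝ) ≤ k := by exact_mod_cast hk
  rw [le_div_iff₀ (by positivity)]
  set j := k / (r + 1) with hj
  have hjk : k = j * (r + 1) + k % (r + 1) := by rw [hj, mul_comm]; exact (Nat.div_add_mod k _).symm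
  have hmod : k % (r + 1) < r + 1 := Nat.mod_lt _ (Nat.succ_pos r)
  rcases Nat.eq_zero_or_pos j with hj0 | hj0
  · have hkr : (k : ℝ) ≤ (r : ℝ) + 1 := by
      rw [hj0, zero_mul, zero_add] at hjk
      have : k ≤ r + 1 := by omega
      exact_mod_cast this
    have : ∫ t, f k t ^ 2 ≤ 4 := by
      rw [← integral_window]
      refine integral_mono (sqi k) integrable_window fun t => ?_
      have h0 := (hfw k).nonneg t
      have h1 := (hfw k).le_one t
      have h2 := ((hfw k).2 t).2
      dsimp only
      nlinarith
    have h4 : (k : ℝ) ^ 2 ≤ ((r : ℝ) + 1) ^ 2 := pow_le_pow_left₀ (by positivity) hkr 2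
    calc _ ≤ 4 * ((r : ℝ) + 1) ^ 2 := mul_le_mul this h4 (by positivity) (by norm_num)
      _ ≤ _ := le_add_of_nonneg_left (by positivity)
  · have hj1 : (1 : ℝ) ≤ j := by exact_mod_cast hj0
    have hkj : (k : ℝ) ≤ 2 * (j * ((r : ℝ) + 1)) := by
      have : k ≤ 2 * (j * (r + 1)) := by nlinarith
      exact_mod_cast this
    have m1 : ∫ t, f k t ^ 2 ≤ ∫ t, f (j * (r + 1)) t ^ 2 := by
      refine integral_mono (sqi _) (sqi _) fun t => ?_
      have := anti (j * (r + 1)) (k % (r + 1)) t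
      rw [← hjk] at this
      exact pow_le_pow_left₀ ((hfw k).nonneg t) this 2
    have m2 := m1.trans (sq16 _)
    have hzj := hz j
    have h5 : e (j * (r + 1)) * (d * j) ^ 2 ≤ 4 := by
      have := pow_le_pow_left₀ (by positivity) hzj 2
      rw [mul_pow, Real.sq_sqrt (he0 _)] at this
      linarith
    have h6 : e (j * (r + 1)) * (j : ℝ) ^ 2 ≤ 4 / d ^ 2 := by
      rw [le_div_iff₀ (by positivity)]; linarith
    calc (∫ t, f k t ^ 2) * (k : ℝ) ^ 2
        ≤ (16 * e (j * (r + 1))) * (2 * (j * ((r : ℝ) + 1))) ^ 2 := by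
          gcongr
          exact mul_nonneg (by norm_num) (he0 _)
      _ = 64 * ((r : ℝ) + 1) ^ 2 * (e (j * (r + 1)) * (j : ℝ) ^ 2) := by ring
      _ ≤ 64 * ((r : ℝ) + 1) ^ 2 * (4 / d ^ 2) := by gcongr
      _ = 256 * ((r : ℝ) + 1) ^ 2 / d ^ 2 := by ring
      _ ≤ _ := le_add_of_nonneg_right (by positivity)

end

/-! ### Uniform asymptotics of the mass. -/

section

variable {L : ℕ}

section

variable {w : Config L → ℝ} {p : Cell L → ℝ} {h g g' : ℝ → ℝ}

lemma subWindow_const_mul_density (hh : IsSelfSimilarDensity p h) {c : ℝ} (h0 : 0 ≤ c)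
    (h1 : c ≤ 1 / 2) : SubWindow fun t => c * h t :=
  ⟨hh.measurable.const_mul c, fun t => ⟨mul_nonneg h0 (hh.nonneg t), by
    have := mul_le_mul h1 (hh.le_window t) (hh.nonneg t) (by norm_num)
    linarith⟩⟩

lemma integral_hitOp_iterate_mono (hw : IsUniformWeight w) (hp : ∀ a, |p a| ≤ 2 * ((L : ℝ) - 1))
    (hg : SubWindow g) (hg' : SubWindow g') (hgg : ∀ t, g t ≤ g' t) (n : ℕ) :
    ∫ t, (hitOp w p)^[n] g t ≤ ∫ t, (hitOp w p)^[n] g' t :=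
  integral_mono (hg.hitOp_iterate hw hp n).integrable (hg'.hitOp_iterate hw hp n).integrable
    fun t => hitOp_iterate_mono hw hp hg' hgg n t

/-- Mass decreases for every initial function, although pointwise monotonicity may fail: `hitOp`
lies below `avgOp`, which preserves mass. -/
lemma integral_hitOp_iterate_add_le (hw : IsUniformWeight w) (hp : ∀ a, |p a| ≤ 2 * ((L : ℝ) - 1))
    (hg : SubWindow g) (n k : ℕ) :
    ∫ t, (hitOp w p)^[n + k] g t ≤ ∫ t, (hitOp w p)^[n] g t := by
  have h1 := hg.hitOp_iterate hw hp n
  rw [add_comm, Function.iterate_add_apply, ← integral_avgOp_iterate (p := p) hw.ne_zero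
    h1.integrable k]
  exact integral_mono (h1.hitOp_iterate hw hp k).integrable
    (integrable_avgOp_iterate hw.ne_zero h1.integrable k)
    fun t => hitOp_iterate_le_avgOp_iterate hw hp h1 k t

lemma integral_hitOp_iterate_anti (hw : IsUniformWeight w) (hp : ∀ a, |p a| ≤ 2 * ((L : ℝ) - 1))
    (hg : SubWindow g) {n k : ℕ} (hnk : n ≤ k) :
    ∫ t, (hitOp w p)^[k] g t ≤ ∫ t, (hitOp w p)^[n] g t := by
  obtain ⟨j, rfl⟩ := Nat.exists_eq_add_of_le hnk
  exact integral_hitOp_iterate_add_le hw hp hg n j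

lemma integral_hitOp_iterate_le_add (hw : IsUniformWeight w)
    (hp : ∀ a, |p a| ≤ 2 * ((L : ℝ) - 1)) (hg : SubWindow g) (hg' : SubWindow g') (n : ℕ) :
    ∫ t, (hitOp w p)^[n] g t ≤ (∫ t, (hitOp w p)^[n] g' t) + ∫ t, |g t - g' t| := by
  have h1 := hg.hitOp_iterate hw hp n
  have h2 := hg'.hitOp_iterate hw hp n
  have h3 := integral_abs_hitOp_iterate_sub_le hw hp hg hg' n
  have h4 : ∫ t, ((hitOp w p)^[n] g t - (hitOp w p)^[n] g' t) ≤
      ∫ t, |(hitOp w p)^[n] g t - (hitOp w p)^[n] g' t| :=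
    integral_mono (h1.integrable.sub h2.integrable) (h1.integrable.sub h2.integrable).abs
      fun t => le_abs_self _
  rw [integral_sub h1.integrable h2.integrable] at h4
  linarith

end

lemma abs_div_one_add_mul_sub_le {M m x y : ℝ} (hM : 0 ≤ M) (hm : 0 ≤ m) (hx : 0 ≤ x)
    (hy : 0 ≤ y) :
    |M / (1 + M * x * m) - M / (1 + M * y * m)| ≤ M ^ 2 * m * |x - y| := by
  have h1 : 1 ≤ 1 + M * x * m := le_add_of_nonneg_right (by positivity)
  have h2 : 1 ≤ 1 + M * y * m := le_add_of_nonneg_right (by positivity)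
  have e : M / (1 + M * x * m) - M / (1 + M * y * m) =
      M ^ 2 * m * (y - x) / ((1 + M * x * m) * (1 + M * y * m)) := by
    field_simp; ring
  rw [e, abs_div, abs_mul, abs_of_nonneg (by positivity : 0 ≤ M ^ 2 * m), abs_sub_comm y x,
    abs_of_pos (by positivity : 0 < (1 + M * x * m) * (1 + M * y * m))]
  exact div_le_self (by positivity) (one_le_mul_of_one_le_of_one_le h1 h2)

variable (L)

/-- Scaling limit, for initial data which are small multiples of the invariant density. -/
lemma exists_abs_mul_integral_sub_le {M η : ℝ} (hM : 0 < M) (hη : 0 < η) : ∃ N : ℕ,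
    ∀ (w : Config L → ℝ) (p : Cell L → ℝ) (h : ℝ → ℝ), IsUniformWeight w →
      IsSelfSimilarDensity p h → ∀ n ≥ N, 1 ≤ n ∧ M / n ≤ 1 / 2 ∧ ∀ n' ≤ n,
      |n * (∫ t, (hitOp w p)^[n'] (fun t => M / n * h t) t) -
        M / (1 + M * (n' / n) * ∫ s, pairOp w p h s)| ≤ η := by
  obtain ⟨C, hC, H⟩ := exists_integral_abs_evolution_le L
  -- About `n / K` blocks with error `C √K (M / n)^2` each give, after multiplication by `n`, a
  -- total of `C M^2 / √K`. So `K` is fixed first, and `n` is taken large afterwards.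
  obtain ⟨K, hK⟩ := exists_nat_gt ((2 * C * M ^ 2 / η) ^ 2 + 1)
  have hK1 : (1 : ℝ) < K := lt_of_le_of_lt (le_add_of_nonneg_left (sq_nonneg _)) hK
  have hKs : C * M ^ 2 / √K ≤ η / 2 := by
    have : 2 * C * M ^ 2 / η ≤ √K := Real.le_sqrt_of_sq_le (by linarith)
    have hs : 0 < √(K : ℝ) := Real.sqrt_pos.2 (by linarith)
    rw [div_le_iff₀ hη] at this
    rw [div_le_iff₀ hs]
    linarith
  obtain ⟨D, hD, H⟩ := H K
  set R := C * √K * M ^ 2 + 2 * D * M ^ 3 + M ^ 2 * (32 * (L : ℝ) ^ 2) * K with hR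
  have hR0 : 0 ≤ R := by positivity
  obtain ⟨N, hN⟩ := exists_nat_gt (max (2 * M) (2 * R / η + 1))
  refine ⟨N, fun w p h hw hh n hn => ?_⟩
  have hnN : (N : ℝ) ≤ n := by exact_mod_cast hn
  have hn2M : 2 * M < n := (le_max_left _ _).trans_lt (hN.trans_le hnN)
  have hnR : 2 * R / η + 1 < n := (le_max_right _ _).trans_lt (hN.trans_le hnN)
  have hn1 : (1 : ℝ) < n := lt_of_le_of_lt (le_add_of_nonneg_left (by positivity)) hnR
  have hn0 : (0 : ℝ) < n := by linarith
  have hRn : R / n ≤ η / 2 := by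
    rw [div_le_iff₀ hn0]
    have : 2 * R / η ≤ n := by linarith
    rw [div_le_iff₀ hη] at this
    linarith
  have hMn : M / n ≤ 1 / 2 := by rw [div_le_iff₀ hn0]; linarith
  refine ⟨by exact_mod_cast hn1.le, hMn, fun n' hn' => ?_⟩
  have hMn0 : 0 ≤ M / n := by positivity
  set m := ∫ s, pairOp w p h s with hm
  have hm0 : 0 ≤ m := integral_pairOp_nonneg hw hh
  have hm1 : m ≤ 32 * (L : ℝ) ^ 2 := integral_pairOp_le hw hh
  have hsub := subWindow_const_mul_density hh hMn0 hMn
  have hn'n : (n' : ℝ) ≤ n := by exact_mod_cast hn'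
  -- The estimate is proved at both multiples of `K` around `n'`; monotonicity of the mass then
  -- gives it at `n'`.
  have key : ∀ J : ℕ, (K : ℝ) * J ≤ n' + K → (n' : ℝ) ≤ K * J + K →
      |n * (∫ t, (hitOp w p)^[K * J] (fun t => M / n * h t) t) -
        M / (1 + M * (n' / n) * m)| ≤ η := fun J hJ1 hJ2 => by
    have h1 := H w p h (M / n) hw hh hMn0 hMn J
    rw [← hm] at h1
    have hG := hsub.hitOp_iterate hw hh.offset_le (K * J)
    set cJ := M / n / (1 + M / n * (K * J) * m) with hcJ
    have h2 : |(∫ t, (hitOp w p)^[K * J] (fun t => M / n * h t) t) - cJ| ≤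
        J * (C * √K * (M / n) ^ 2 + D * (M / n) ^ 3) := by
      refine le_trans ?_ h1
      have e : cJ = ∫ t, cJ * h t := by rw [integral_const_mul, hh.integral_eq_one, mul_one]
      conv_lhs => rw [e]
      rw [← integral_sub hG.integrable (hh.dominated.integrable.const_mul _)]
      exact abs_integral_le_integral_abs
    have e1 : n * cJ = M / (1 + M * (K * J / n) * m) := by
      rw [hcJ]; field_simp
    have h3 := abs_div_one_add_mul_sub_le hM.le hm0 (x := K * J / n) (y := n' / n)
      (by positivity) (by positivity)
    have h4 : |(K : ℝ) * J / n - n' / n| ≤ K / n := by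
      rw [← sub_div, abs_div, abs_of_pos hn0]
      refine div_le_div_of_nonneg_right ?_ hn0.le
      rw [abs_le]; constructor <;> linarith
    have h5 : M ^ 2 * m * |(K : ℝ) * J / n - n' / n| ≤ M ^ 2 * (32 * (L : ℝ) ^ 2) * (K / n) := by
      gcongr
    have h6 : (J : ℝ) ≤ n / K + 1 := by
      have hK0 : (0 : ℝ) < K := by linarith
      rw [← sub_le_iff_le_add, le_div_iff₀ hK0]
      nlinarith
    have h7 : n * (J * (C * √K * (M / n) ^ 2 + D * (M / n) ^ 3)) ≤
        C * M ^ 2 / √K + (C * √K * M ^ 2 + 2 * D * M ^ 3) / n := by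
      have hs : 0 < √(K : ℝ) := Real.sqrt_pos.2 (by linarith)
      have hss : √(K : ℝ) * √K = K := Real.mul_self_sqrt (by linarith)
      calc _ ≤ n * ((n / K + 1) * (C * √K * (M / n) ^ 2 + D * (M / n) ^ 3)) := by gcongr
        _ = C * M ^ 2 * (√K / K) + (C * √K * M ^ 2) / n + D * M ^ 3 * (1 / K) / n +
            D * M ^ 3 * (1 / n) / n := by
            have : (0 : ℝ) < K := by linarith
            field_simp
            ring
        _ ≤ C * M ^ 2 * (1 / √K) + (C * √K * M ^ 2) / n + D * M ^ 3 * 1 / n +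
            D * M ^ 3 * 1 / n := by
            have a1 : √(K : ℝ) / K = 1 / √K := by
              nth_rw 2 [← hss]; field_simp
            have a2 : 1 / (K : ℝ) ≤ 1 := div_le_one_of_le₀ hK1.le (by linarith)
            have a3 : 1 / (n : ℝ) ≤ 1 := div_le_one_of_le₀ hn1.le hn0.le
            rw [a1]
            gcongr
        _ = _ := by ring
    rw [← e1] at h3
    have h8 := abs_sub_le (n * (∫ t, (hitOp w p)^[K * J] (fun t => M / n * h t) t)) (n * cJ)
      (M / (1 + M * (n' / n) * m))
    rw [← mul_sub, abs_mul, abs_of_pos hn0] at h8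
    have h9 := mul_le_mul_of_nonneg_left h2 hn0.le
    have h10 : (C * √K * M ^ 2 + 2 * D * M ^ 3) / n + M ^ 2 * (32 * (L : ℝ) ^ 2) * (K / n) = R / n := by
      rw [hR]; ring
    linarith
  have hKpos : 0 < K := by
    have : (0 : ℝ) < K := by linarith
    exact_mod_cast this
  set J := n' / K with hJ
  have hdiv : n' = K * J + n' % K := (Nat.div_add_mod n' K).symm
  have hmod : n' % K < K := Nat.mod_lt _ hKpos
  have c1 : K * J ≤ n' := by omega
  have c2 : n' ≤ K * (J + 1) := by rw [mul_add]; omega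
  have d1 : (K : ℝ) * J ≤ n' := by exact_mod_cast c1
  have d2 : (n' : ℝ) ≤ K * J + K := by
    have : n' ≤ K * J + K := by omega
    exact_mod_cast this
  have u1 := key J (by linarith) d2
  have u2 := key (J + 1) (by push_cast; linarith) (by push_cast; linarith)
  have v1 := mul_le_mul_of_nonneg_left
    (integral_hitOp_iterate_anti hw hh.offset_le hsub c1) hn0.le
  have v2 := mul_le_mul_of_nonneg_left
    (integral_hitOp_iterate_anti hw hh.offset_le hsub c2) hn0.le
  rw [abs_le] at u1 u2 ⊢
  constructor <;> linarith [u1.1, u1.2, u2.1, u2.2]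

/-- Since `M / n ≤ 1 / 2`, the function `(M / n) h` lies below `f`. No link is assumed, so the
interaction may still vanish here; this is used to exclude that it does. -/
lemma exists_le_mul_integral {M η : ℝ} (hM : 0 < M) (hη : 0 < η) : ∃ N : ℕ,
    ∀ (w : Config L → ℝ) (p : Cell L → ℝ) (h f : ℝ → ℝ), IsUniformWeight w →
      IsSelfSimilarDensity p h → SubWindow f → (∀ t, h t / 2 ≤ f t) → ∀ n ≥ N, 1 ≤ n ∧
      M / (1 + M * ∫ s, pairOp w p h s) - η ≤ n * ∫ t, (hitOp w p)^[n] f t := by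
  obtain ⟨N, H⟩ := exists_abs_mul_integral_sub_le L hM hη
  refine ⟨N, fun w p h f hw hh hf hhf n hn => ?_⟩
  obtain ⟨h1, h2, h3⟩ := H w p h hw hh n hn
  refine ⟨h1, ?_⟩
  have hn0 : (0 : ℝ) < n := by exact_mod_cast h1
  have h4 := h3 n le_rfl
  rw [div_self hn0.ne', mul_one] at h4
  have h5 := integral_hitOp_iterate_mono hw hh.offset_le
    (subWindow_const_mul_density hh (by positivity) h2) hf (fun t => by
      have := mul_le_mul_of_nonneg_right h2 (hh.nonneg t)
      linarith [hhf t]) n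
  have h6 := mul_le_mul_of_nonneg_left h5 hn0.le
  linarith [(abs_le.1 h4).1]

/-- On a window of length `4`, the inequality `x ≤ n x^2 + 1 / n` converts the decay in `L²` into
decay of the mass. -/
lemma exists_mul_integral_le {q c : ℝ} (hq : 0 < q) (hc : 0 < c) (r : ℕ) : ∃ C : ℝ, 0 ≤ C ∧
    ∀ (w : Config L → ℝ) (p : Cell L → ℝ) (h : ℝ → ℝ), IsUniformWeight w →
      IsSelfSimilarDensity p h → IsLinked w p h q c r → ∀ n : ℕ, 1 ≤ n →
      n * ∫ t, (hitOp w p)^[n] window t ≤ C := by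
  obtain ⟨C, hC, H⟩ := exists_integral_sq_hitOp_iterate_le L hq hc r
  refine ⟨C + 4, by positivity, fun w p h hw hh hl n hn => ?_⟩
  have hn0 : (0 : ℝ) < n := by exact_mod_cast hn
  have hf := subWindow_window.hitOp_iterate hw hh.offset_le n
  have sqi : Integrable fun t => (hitOp w p)^[n] window t ^ 2 := by
    simpa [sq] using hf.dominated.integrable_mul hf.dominated
  have h1 : ∫ t, (hitOp w p)^[n] window t ≤
      ∫ t, (n * (hitOp w p)^[n] window t ^ 2 + 1 / n * window t) := by
    refine integral_mono hf.integrable ((sqi.const_mul _).add (integrable_window.const_mul _))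
      fun t => ?_
    set x := (hitOp w p)^[n] window t with hx
    have h0 := hf.nonneg t
    have h2 := (hf.2 t).2
    rw [← hx] at h0 h2
    dsimp only
    by_cases ht : |t| ≤ 2
    · rw [window_of_mem ht, mul_one]
      have h3 : 0 ≤ (n * x - 1 / 2) ^ 2 := sq_nonneg _
      have h4 : n * x ≤ n * (n * x ^ 2 + 1 / n) := by
        have : n * (n * x ^ 2 + 1 / n) = (n * x) ^ 2 + 1 := by field_simp
        rw [this]; nlinarith
      exact le_of_mul_le_mul_left h4 hn0
    · rw [window_of_not_mem (not_le.1 ht)] at h2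
      have : x = 0 := le_antisymm h2 h0
      change x ≤ _
      rw [this]
      have := window_nonneg t
      positivity
  rw [integral_add (sqi.const_mul _) (integrable_window.const_mul _), integral_const_mul,
    integral_const_mul, integral_window] at h1
  have h2 := H w p h hw hh hl n hn
  have h3 := mul_le_mul_of_nonneg_left h2 hn0.le
  have h4 := mul_le_mul_of_nonneg_left (h1.trans (add_le_add h3 le_rfl)) hn0.le
  refine h4.trans (le_of_eq ?_)
  field_simp

/-- The interaction of linked models is bounded from below. -/
lemma exists_le_integral_pairOp {q c : ℝ} (hq : 0 < q) (hc : 0 < c) (r : ℕ) : ∃ m₀ : ℝ, 0 < m₀ ∧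
    ∀ (w : Config L → ℝ) (p : Cell L → ℝ) (h : ℝ → ℝ), IsUniformWeight w →
      IsSelfSimilarDensity p h → IsLinked w p h q c r → m₀ ≤ ∫ s, pairOp w p h s := by
  obtain ⟨C, hC, H⟩ := exists_mul_integral_le L hq hc r
  -- Were the interaction zero, the lower bound would approach `M`, which exceeds the upper bound
  -- `C`. With this choice `M / (1 + M m) ≤ C + 1` forces `M m ≥ 1`.
  set M := 2 * (C + 1) with hM
  have hM0 : 0 < M := by positivity
  obtain ⟨N, H2⟩ := exists_le_mul_integral L hM0 one_pos
  refine ⟨1 / M, by positivity, fun w p h hw hh hl => ?_⟩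
  have hm0 : 0 ≤ ∫ s, pairOp w p h s := integral_pairOp_nonneg hw hh
  obtain ⟨h1, h2⟩ := H2 w p h window hw hh subWindow_window
    (fun t => by linarith [hh.le_window t]) N le_rfl
  have h3 := h2.trans (H w p h hw hh hl N h1)
  set m := ∫ s, pairOp w p h s
  have h4 : M / (1 + M * m) ≤ C + 1 := by linarith
  rw [div_le_iff₀ (by positivity)] at h4
  rw [div_le_iff₀ hM0]
  have : C + 1 ≤ (C + 1) * (M * m) := by rw [hM] at h4 ⊢; linarith
  have := le_of_mul_le_mul_left (a := C + 1) (b := 1) (c := M * m) (by linarith) (by positivity)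
  linarith

-- Start from the largest datum `window`. After `k ≈ κ n` generations the `L²` decay allows
-- truncation at height `M / n` at small `L¹` cost. After `k` more, mixing puts the result below `(8
-- M / n) h` up to an error exponentially small in `k`. The remaining `n - 2 k` generations follow
-- the scaling law, and `8 M / (1 + 8 M x m) ≤ 1 / (x m)` whatever `M` is.
set_option maxHeartbeats 1000000 in
lemma exists_mul_integral_le_upper {q c : ℝ} (hq : 0 < q) (hc : 0 < c) (r : ℕ) {ε : ℝ}
    (hε : 0 < ε) : ∃ N : ℕ,
    ∀ (w : Config L → ℝ) (p : Cell L → ℝ) (h f : ℝ → ℝ), IsUniformWeight w →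
      IsSelfSimilarDensity p h → IsLinked w p h q c r → SubWindow f → ∀ n ≥ N,
      n * (∫ t, (hitOp w p)^[n] f t) ≤ 1 / (∫ s, pairOp w p h s) + ε := by
  obtain ⟨C, hC, HC⟩ := exists_integral_sq_hitOp_iterate_le L hq hc r
  obtain ⟨m₀, hm₀, Hm⟩ := exists_le_integral_pairOp L hq hc r
  set κ := min (1 / 6) (ε / (4 * (C + 6 / m₀ + 1))) with hκ
  have hκ0 : 0 < κ := lt_min (by norm_num) (by positivity)
  have hκ6 : κ ≤ 1 / 6 := min_le_left _ _
  have hκε : κ * (C + 6 / m₀ + 1) ≤ ε / 4 := by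
    have : κ ≤ _ := min_le_right _ _
    rw [le_div_iff₀ (by positivity)] at this
    linarith
  -- Truncation costs at most `(n / M) * C / (κ n)^2 = κ C / n`, negligible against `1 / n`.
  set M := 1 / κ ^ 3 with hM
  have hM0 : 0 < M := by positivity
  obtain ⟨N, H⟩ := exists_abs_mul_integral_sub_le L (M := 8 * M) (by positivity)
    (η := ε / 4) (by positivity)
  obtain ⟨N', hN'⟩ := exists_nat_gt (max (2 / κ) (128 * M / κ * (4 / ε)))
  refine ⟨max N N', fun w p h f hw hh hl hf n hn => ?_⟩
  obtain ⟨hn1, h8M, Hn⟩ := H w p h hw hh n ((le_max_left _ _).trans hn)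
  have hn0 : (0 : ℝ) < n := by exact_mod_cast hn1
  have hnN' : (N' : ℝ) ≤ n := by exact_mod_cast (le_max_right _ _).trans hn
  have hna : 2 / κ < n := (le_max_left _ _).trans_lt (hN'.trans_le hnN')
  have hnb : 128 * M / κ * (4 / ε) < n := (le_max_right _ _).trans_lt (hN'.trans_le hnN')
  rw [div_lt_iff₀ hκ0] at hna
  set m := ∫ s, pairOp w p h s with hm
  have hmm : m₀ ≤ m := Hm w p h hw hh hl
  have hm0 : 0 < m := hm₀.trans_le hmm
  set k := ⌈κ * n⌉₊ with hk
  have hk1 : κ * n ≤ k := Nat.le_ceil _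
  have hk2 : (k : ℝ) < κ * n + 1 := Nat.ceil_lt_add_one (by positivity)
  have hkpos : 1 ≤ k := by
    have : (0 : ℝ) < k := by linarith
    exact_mod_cast this
  have hk0 : (0 : ℝ) < k := by exact_mod_cast hkpos
  have h2k : 2 * k ≤ n := by
    have : (2 * k : ℝ) ≤ n := by nlinarith
    exact_mod_cast this
  set n' := n - 2 * k with hn'
  have hnn : n = n' + k + k := by omega
  have hn'r : (n' : ℝ) = n - 2 * k := by rw [hn']; push_cast [h2k]; ring
  have hp := hh.offset_le
  have hfw := subWindow_window.hitOp_iterate hw hp k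
  set F := (hitOp w p)^[k] window with hF
  set a := M / n with ha
  have ha0 : 0 < a := by positivity
  set g1 : ℝ → ℝ := fun t => min (F t) a with hg1
  have hg1w : SubWindow g1 := ⟨hfw.1.min measurable_const, fun t =>
    ⟨le_min (hfw.nonneg t) ha0.le, (min_le_left _ _).trans (hfw.2 t).2⟩⟩
  have hg1a : ∀ t, g1 t ≤ a * window t := fun t => by
    by_cases ht : |t| ≤ 2
    · rw [window_of_mem ht, mul_one]; exact min_le_right _ _
    · have h0 := (hfw.2 t).2
      rw [window_of_not_mem (not_le.1 ht)] at h0 ⊢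
      rw [mul_zero]; exact (min_le_left _ _).trans h0
  set G1 := (hitOp w p)^[k] g1 with hG1
  have hG1w : SubWindow G1 := hg1w.hitOp_iterate hw hp k
  set g2 : ℝ → ℝ := fun t => min (G1 t) (8 * M / n * h t) with hg2
  have h8w := subWindow_const_mul_density hh (by positivity) h8M
  have hg2w : SubWindow g2 := ⟨hG1w.1.min (hh.measurable.const_mul _), fun t =>
    ⟨le_min (hG1w.nonneg t) (h8w.nonneg t), (min_le_left _ _).trans (hG1w.2 t).2⟩⟩
  have s0 : ∫ t, (hitOp w p)^[n] f t ≤ ∫ t, (hitOp w p)^[n'] ((hitOp w p)^[k] F) t := by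
    rw [hF, ← Function.iterate_add_apply, ← Function.iterate_add_apply, ← hnn]
    exact integral_hitOp_iterate_mono hw hp hf subWindow_window (fun t => (hf.2 t).2) n
  have s1 := integral_hitOp_iterate_le_add hw hp (hfw.hitOp_iterate hw hp k) hG1w n'
  have s2 : ∫ t, |(hitOp w p)^[k] F t - G1 t| ≤ κ * C / n := by
    refine (integral_abs_hitOp_iterate_sub_le hw hp hfw hg1w k).trans ?_
    have sqi : Integrable fun t => F t ^ 2 := by
      simpa [sq] using hfw.dominated.integrable_mul hfw.dominated
    calc _ ≤ ∫ t, 1 / a * F t ^ 2 := by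
          refine integral_mono (hfw.integrable.sub hg1w.integrable).abs (sqi.const_mul _)
            fun t => ?_
          dsimp only [hg1]
          rw [abs_of_nonneg (sub_nonneg.2 (min_le_left _ _)), one_div_mul_eq_div,
            le_div_iff₀ ha0]
          change (F t - min (F t) a) * a ≤ F t ^ 2
          have h0 := hfw.nonneg t
          rcases le_total (F t) a with h1 | h1
          · rw [min_eq_left h1]; nlinarith
          · rw [min_eq_right h1]; nlinarith
      _ = 1 / a * ∫ t, F t ^ 2 := integral_const_mul _ _
      _ ≤ 1 / a * (C / (κ * n) ^ 2) := by
          gcongr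
          refine (HC w p h hw hh hl k hkpos).trans ?_
          gcongr
      _ = κ * C / n := by rw [ha, hM]; field_simp
  have s3 := integral_hitOp_iterate_le_add hw hp hG1w hg2w n'
  have s4 : ∫ t, |G1 t - g2 t| ≤ 128 * M / (κ * n ^ 2) := by
    have hmi : Integrable fun t => max ((avgOp p)^[k] window t - 8 * h t) 0 :=
      ((integrable_avgOp_iterate hw.ne_zero integrable_window k).sub
        (hh.dominated.integrable.const_mul 8)).pos_part
    calc _ ≤ ∫ t, a * max ((avgOp p)^[k] window t - 8 * h t) 0 := by
          refine integral_mono (hG1w.integrable.sub hg2w.integrable).abs (hmi.const_mul _)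
            fun t => ?_
          dsimp only [hg2]
          rw [abs_of_nonneg (sub_nonneg.2 (min_le_left _ _))]
          have h1 : G1 t ≤ a * (avgOp p)^[k] window t := by
            have := (hitOp_iterate_le_avgOp_iterate hw hp hg1w k t).trans
              (avgOp_iterate_mono hg1a k t)
            rwa [avgOp_iterate_const_mul] at this
          have e8 : 8 * M / n * h t = a * (8 * h t) := by rw [ha]; ring
          change G1 t - min (G1 t) (8 * M / n * h t) ≤ _
          rw [e8]
          have hx := le_max_left ((avgOp p)^[k] window t - 8 * h t) 0
          have hy := le_max_right ((avgOp p)^[k] window t - 8 * h t) 0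
          have hx' := mul_le_mul_of_nonneg_left hx ha0.le
          have hy' := mul_le_mul_of_nonneg_left hy ha0.le
          rcases le_total (G1 t) (a * (8 * h t)) with h2 | h2
          · rw [min_eq_left h2]; linarith
          · rw [min_eq_right h2]; linarith
      _ = a * ∫ t, max ((avgOp p)^[k] window t - 8 * h t) 0 := integral_const_mul _ _
      _ ≤ a * (128 / L ^ k) := by
          gcongr
          exact integral_max_avgOp_iterate_window_le hw.two_le hh k
      _ ≤ a * (128 / (κ * n)) := by
          gcongr
          refine hk1.trans ?_
          have h1 : (k : ℝ) < 2 ^ k := by exact_mod_cast Nat.lt_two_pow_self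
          have h2 : (2 : ℝ) ≤ L := by exact_mod_cast hw.two_le
          exact h1.le.trans (pow_le_pow_left₀ two_pos.le h2 k)
      _ = _ := by rw [ha]; field_simp
  have s5 := integral_hitOp_iterate_mono hw hp hg2w h8w (fun t => min_le_right _ _) n'
  have s6 := (abs_le.1 (Hn n' (by omega))).2
  have s7 : 8 * M / (1 + 8 * M * (n' / n) * m) ≤ 1 / m + 6 * κ / m₀ := by
    -- Since `κ n > 2`, the ceiling in `k` costs at most half of `κ n`, so the two waiting periods
    -- use at most `3 κ n` generations.
    have hx : 1 - 3 * κ ≤ (n' : ℝ) / n := by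
      rw [le_div_iff₀ hn0, hn'r]; nlinarith
    have hx0 : 0 < 1 - 3 * κ := by linarith
    calc _ ≤ 8 * M / (8 * M * (1 - 3 * κ) * m) := by
          refine div_le_div_of_nonneg_left (by positivity) (by positivity) ?_
          have : 8 * M * (1 - 3 * κ) * m ≤ 8 * M * (n' / n) * m := by gcongr
          linarith
      _ = 1 / ((1 - 3 * κ) * m) := by field_simp
      _ = 1 / m + 3 * κ / ((1 - 3 * κ) * m) := by field_simp; ring
      _ ≤ 1 / m + 3 * κ / ((1 / 2) * m₀) := by
          gcongr
          linarith
      _ = _ := by ring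
  have t0 := mul_le_mul_of_nonneg_left (s0.trans (s1.trans (add_le_add (s3.trans
    (add_le_add s5 s4)) s2))) hn0.le
  have e1 : (n : ℝ) * (128 * M / (κ * n ^ 2)) ≤ ε / 4 := by
    have : (n : ℝ) * (128 * M / (κ * n ^ 2)) = 128 * M / κ / n := by field_simp
    rw [this, div_le_iff₀ hn0]
    have h1 := mul_lt_mul_of_pos_right hnb (by positivity : 0 < ε / 4)
    have h2 : 128 * M / κ * (4 / ε) * (ε / 4) = 128 * M / κ := by field_simp
    linarith
  have e2 : (n : ℝ) * (κ * C / n) = κ * C := by field_simp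
  rw [mul_add, mul_add, e2] at t0
  have e3 : κ * (C + 6 / m₀ + 1) = κ * C + 6 * κ / m₀ + κ := by ring
  linarith

/-- Uniform asymptotics of hitting probabilities. -/
theorem exists_abs_mul_integral_hitOp_sub_le {q c : ℝ} (hq : 0 < q) (hc : 0 < c) (r : ℕ) {ε : ℝ}
    (hε : 0 < ε) : ∃ N : ℕ,
    ∀ (w : Config L → ℝ) (p : Cell L → ℝ) (h f : ℝ → ℝ), IsUniformWeight w →
      IsSelfSimilarDensity p h → IsLinked w p h q c r → SubWindow f → (∀ t, h t / 2 ≤ f t) →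
      ∀ n ≥ N, |n * (∫ t, (hitOp w p)^[n] f t) - 1 / (∫ s, pairOp w p h s)| ≤ ε := by
  obtain ⟨m₀, hm₀, Hm⟩ := exists_le_integral_pairOp L hq hc r
  obtain ⟨N, H⟩ := exists_mul_integral_le_upper L hq hc r hε
  -- Chosen so that `1 / m - M / (1 + M m) ≤ 1 / (M m₀^2) = ε / 2`.
  set M := 2 / (m₀ ^ 2 * ε) with hM
  have hM0 : 0 < M := by positivity
  obtain ⟨N', H'⟩ := exists_le_mul_integral L hM0 (η := ε / 2) (by positivity)
  refine ⟨max N N', fun w p h f hw hh hl hf hhf n hn => ?_⟩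
  have h1 := H w p h f hw hh hl hf n ((le_max_left _ _).trans hn)
  have h2 := (H' w p h f hw hh hf hhf n ((le_max_right _ _).trans hn)).2
  have hmm := Hm w p h hw hh hl
  set m := ∫ s, pairOp w p h s
  have hm0 : 0 < m := hm₀.trans_le hmm
  have h3 : 1 / m - ε / 2 ≤ M / (1 + M * m) := by
    have e : M / (1 + M * m) = 1 / m - 1 / (m * (1 + M * m)) := by field_simp; ring
    rw [e]
    have : 1 / (m * (1 + M * m)) ≤ 1 / (m₀ * (M * m₀)) := by
      refine one_div_le_one_div_of_le (by positivity) ?_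
      have : M * m₀ ≤ 1 + M * m := by nlinarith
      exact mul_le_mul hmm this (by positivity) hm0.le
    have e2 : 1 / (m₀ * (M * m₀)) = ε / 2 := by rw [hM]; field_simp
    linarith
  rw [abs_le]; constructor <;> linarith

end

section

variable {L : ℕ}

/-! ### Chords of the unit square -/

/-- Indicator of `[0, 1)`. -/
def unitInd : ℝ → ℝ := indicator (Ico 0 1) 1

lemma unitInd_of_mem {x : ℝ} (hx : x ∈ Ico (0 : ℝ) 1) : unitInd x = 1 := by simp [unitInd, hx]

lemma unitInd_of_not_mem {x : ℝ} (hx : x ∉ Ico (0 : ℝ) 1) : unitInd x = 0 := by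
  simp [unitInd, hx]

lemma unitInd_nonneg (x : ℝ) : 0 ≤ unitInd x := indicator_nonneg (fun _ _ => zero_le_one) x

lemma unitInd_le_one (x : ℝ) : unitInd x ≤ 1 :=
  indicator_le' (fun _ _ => le_rfl) (fun _ _ => zero_le_one) x

lemma measurable_unitInd : Measurable unitInd := measurable_one.indicator measurableSet_Ico

lemma integrable_unitInd : Integrable unitInd := by
  refine (integrable_indicator_iff measurableSet_Ico).2 ?_
  exact integrableOn_const (by simp)

lemma integral_unitInd : ∫ x, unitInd x = 1 := by
  unfold unitInd
  rw [integral_indicator_one measurableSet_Ico]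
  simp

/-- Half-open intervals tile without overlap, so the identity holds at every point; this is why the
invariant density is built from half-open squares. -/
lemma unitInd_eq_sum (hL : L ≠ 0) (x : ℝ) : unitInd x = ∑ i : Fin L, unitInd (L * x - (i : ℕ)) := by
  have key : ∀ n : ℕ, ∀ y : ℝ,
      ∑ i ∈ Finset.range n, unitInd (y - i) = indicator (Ico (0 : ℝ) n) 1 y := by
    intro n y
    induction n with
    | zero => simp
    | succ n ih =>
      rw [Finset.sum_range_succ, ih]
      have hn : (0 : ℝ) ≤ n := n.cast_nonneg
      unfold unitInd
      simp only [indicator_apply, mem_Ico, Pi.one_apply]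
      push_cast
      split_ifs <;> grind
  have hL0 : (0 : ℝ) < L := by exact_mod_cast Nat.pos_of_ne_zero hL
  rw [Fin.sum_univ_eq_sum_range (fun i => unitInd (L * x - (i : ℕ))) L, key]
  unfold unitInd
  have : x ∈ Ico (0 : ℝ) 1 ↔ (L : ℝ) * x ∈ Ico (0 : ℝ) L := by
    simp only [mem_Ico]
    constructor
    · rintro ⟨h1, h2⟩
      exact ⟨by positivity, by nlinarith⟩
    · rintro ⟨h1, h2⟩
      exact ⟨nonneg_of_mul_nonneg_right h1 hL0, by nlinarith⟩
  by_cases hx : x ∈ Ico (0 : ℝ) 1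
  · simp [indicator_of_mem hx, indicator_of_mem (this.1 hx)]
  · rw [indicator_of_notMem hx, indicator_of_notMem (fun h => hx (this.2 h))]

lemma integrable_unitInd_affine {c : ℝ} (hc : c ≠ 0) (u : ℝ) :
    Integrable fun s => unitInd (u + s * c) := by
  have := (integrable_unitInd.comp_add_left u).comp_mul_right' hc
  exact this

lemma integral_abs_unitInd_add_sub_le (a : ℝ) : ∫ x, |unitInd (x + a) - unitInd x| ≤ 2 * |a| := by
  have hi : ∀ u v : ℝ, Integrable (indicator (uIcc u v) (1 : ℝ → ℝ)) := fun u v =>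
    (integrable_indicator_iff measurableSet_uIcc).2 (integrableOn_const (by simp))
  calc _ ≤ ∫ x, (indicator (uIcc (-a) 0) (1 : ℝ → ℝ) x + indicator (uIcc (1 - a) 1) 1 x) := by
        refine integral_mono ((integrable_unitInd.comp_add_right a).sub integrable_unitInd).abs
          ((hi _ _).add (hi _ _)) fun x => ?_
        classical
        change |unitInd (x + a) - unitInd x| ≤
          indicator (uIcc (-a) 0) (1 : ℝ → ℝ) x + indicator (uIcc (1 - a) 1) 1 x
        simp only [unitInd, indicator_apply, mem_Ico, mem_uIcc, Pi.one_apply]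
        split_ifs <;> first | (norm_num; done) | (exfalso; grind)
    _ = 2 * |a| := by
        rw [integral_add (hi _ _) (hi _ _), integral_indicator_one measurableSet_uIcc,
          integral_indicator_one measurableSet_uIcc]
        simp only [Measure.real, Real.volume_interval]
        rw [ENNReal.toReal_ofReal (abs_nonneg _), ENNReal.toReal_ofReal (abs_nonneg _)]
        ring_nf

/-- The map is a reflection: a linear involution, whose determinant therefore has square `1`. -/
lemma measurePreserving_linePoint (θ : ℝ) :
    MeasurePreserving (fun z : ℝ × ℝ => linePoint θ z.1 z.2) volume volume := by
  let f : ℝ × ℝ →ₗ[ℝ] ℝ × ℝ :=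
    { toFun := fun z => linePoint θ z.1 z.2
      map_add' := fun z z' => by
        simp only [linePoint, Prod.fst_add, Prod.snd_add, Prod.mk_add_mk, Prod.mk.injEq]
        constructor <;> ring
      map_smul' := fun c z => by
        simp only [linePoint, Prod.smul_fst, Prod.smul_snd, smul_eq_mul, RingHom.id_apply,
          Prod.smul_mk, Prod.mk.injEq]
        constructor <;> ring }
  have hff : f ∘ₗ f = LinearMap.id := by
    refine LinearMap.ext fun z => ?_
    change linePoint θ (linePoint θ z.1 z.2).1 (linePoint θ z.1 z.2).2 = z
    have h := Real.sin_sq_add_cos_sq θ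
    refine Prod.ext ?_ ?_ <;> simp only [linePoint]
    · linear_combination z.1 * h
    · linear_combination z.2 * h
  have hdet : |LinearMap.det f| = 1 := by
    have h1 : LinearMap.det f * LinearMap.det f = 1 := by
      rw [← LinearMap.det_comp, hff, LinearMap.det_id]
    have h2 : |LinearMap.det f| * |LinearMap.det f| = 1 := by rw [abs_mul_abs_self, h1]
    nlinarith [abs_nonneg (LinearMap.det f)]
  have hd0 : LinearMap.det f ≠ 0 := fun h => by simp [h] at hdet
  have hadd : (volume : Measure (ℝ × ℝ)).IsAddHaarMeasure :=
    inferInstanceAs ((volume : Measure ℝ).prod (volume : Measure ℝ)).IsAddHaarMeasure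
  refine ⟨by unfold linePoint; fun_prop, ?_⟩
  have := Measure.map_linearMap_addHaar_eq_smul_addHaar (volume : Measure (ℝ × ℝ)) hd0
  rw [abs_inv, hdet, inv_one, ENNReal.ofReal_one, one_smul] at this
  exact this

/-- Indicator of the half-open unit square. -/
def squareInd (z : ℝ × ℝ) : ℝ := unitInd z.1 * unitInd z.2

lemma measurable_squareInd : Measurable squareInd :=
  (measurable_unitInd.comp measurable_fst).mul (measurable_unitInd.comp measurable_snd)

lemma squareInd_nonneg (z : ℝ × ℝ) : 0 ≤ squareInd z :=
  mul_nonneg (unitInd_nonneg _) (unitInd_nonneg _)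

lemma squareInd_le_one (z : ℝ × ℝ) : squareInd z ≤ 1 :=
  mul_le_one₀ (unitInd_le_one _) (unitInd_nonneg _) (unitInd_le_one _)

lemma integrable_squareInd : Integrable squareInd := by
  rw [Measure.volume_eq_prod]
  exact integrable_unitInd.mul_prod integrable_unitInd

lemma measurable_linePoint (θ : ℝ) : Measurable fun z : ℝ × ℝ => linePoint θ z.1 z.2 :=
  (measurePreserving_linePoint θ).measurable

lemma linePoint_linePoint (θ t s : ℝ) :
    linePoint θ (linePoint θ t s).1 (linePoint θ t s).2 = (t, s) := by
  have h := Real.sin_sq_add_cos_sq θ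
  refine Prod.ext ?_ ?_ <;> simp only [linePoint]
  · linear_combination t * h
  · linear_combination s * h

lemma abs_linePoint_le {θ t s : ℝ} (ht : |t| ≤ 1) (hs : |s| ≤ 1) :
    |(linePoint θ t s).1| ≤ 2 ∧ |(linePoint θ t s).2| ≤ 2 := by
  have h1 := Real.abs_sin_le_one θ
  have h2 := Real.abs_cos_le_one θ
  simp only [linePoint]
  constructor
  · refine (abs_add_le _ _).trans ?_
    rw [abs_mul, abs_mul, abs_neg]
    have := mul_le_one₀ ht (abs_nonneg _) h1
    have := mul_le_one₀ hs (abs_nonneg _) h2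
    linarith
  · refine (abs_add_le _ _).trans ?_
    rw [abs_mul, abs_mul]
    have := mul_le_one₀ ht (abs_nonneg _) h2
    have := mul_le_one₀ hs (abs_nonneg _) h1
    linarith

lemma squareInd_linePoint_eq_zero {θ t s : ℝ} (h : 2 < |t| ∨ 2 < |s|) :
    squareInd (linePoint θ t s) = 0 := by
  by_contra hne
  have h1 : (linePoint θ t s).1 ∈ Ico (0 : ℝ) 1 := by
    by_contra h'; exact hne (by rw [squareInd, unitInd_of_not_mem h', zero_mul])
  have h2 : (linePoint θ t s).2 ∈ Ico (0 : ℝ) 1 := by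
    by_contra h'; exact hne (by rw [squareInd, unitInd_of_not_mem h', mul_zero])
  have := abs_linePoint_le (θ := θ) (abs_le.2 ⟨by linarith [h1.1], h1.2.le⟩)
    (abs_le.2 ⟨by linarith [h2.1], h2.2.le⟩)
  rw [linePoint_linePoint] at this
  rcases h with h | h <;> linarith [this.1, this.2]

lemma squareInd_linePoint_le (θ t s : ℝ) : squareInd (linePoint θ t s) ≤ window s := by
  by_cases h : |s| ≤ 2
  · rw [window_of_mem h]; exact squareInd_le_one _
  · rw [squareInd_linePoint_eq_zero (Or.inr (not_le.1 h))]; exact window_nonneg _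

lemma integrable_squareInd_linePoint (θ t : ℝ) :
    Integrable fun s => squareInd (linePoint θ t s) := by
  refine integrable_window.mono' ((measurable_squareInd.comp ((measurable_linePoint θ).comp
    measurable_prodMk_left)).aestronglyMeasurable) (ae_of_all _ fun s => ?_)
  rw [Real.norm_of_nonneg (squareInd_nonneg _)]
  exact squareInd_linePoint_le θ t s

/-- Length of the chord cut out of the half-open unit square by the line `ℓ(θ, t)`. -/
def unitChord (θ t : ℝ) : ℝ := ∫ s, squareInd (linePoint θ t s)

/-- Position of the cell `a` in the direction orthogonal to `θ`. -/
def cellOffset (θ : ℝ) (a : Cell L) : ℝ := proj θ ((a.1 : ℕ), (a.2 : ℕ))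

lemma unitChord_nonneg (θ t : ℝ) : 0 ≤ unitChord θ t :=
  integral_nonneg fun _ => squareInd_nonneg _

lemma measurable_unitChord_uncurry : Measurable fun z : ℝ × ℝ => unitChord z.1 z.2 := by
  have : StronglyMeasurable (Function.uncurry fun (z : ℝ × ℝ) (s : ℝ) =>
      squareInd (linePoint z.1 z.2 s)) := by
    refine (measurable_squareInd.comp ?_).stronglyMeasurable
    unfold linePoint
    fun_prop
  exact this.integral_prod_right.measurable

lemma measurable_unitChord (θ : ℝ) : Measurable (unitChord θ) :=
  measurable_unitChord_uncurry.comp measurable_prodMk_left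

/-- One of `|cos θ|`, `|sin θ|` is at least `1 / 2`; the corresponding coordinate moves along the
line at that speed or faster and has only unit length available. -/
lemma unitChord_le_two_mul_window (θ t : ℝ) : unitChord θ t ≤ 2 * window t := by
  by_cases ht : |t| ≤ 2
  · rw [window_of_mem ht, mul_one]
    have key : ∀ c u : ℝ, 1 / 2 ≤ |c| → ∫ s, unitInd (u + s * c) ≤ 2 := by
      intro c u hc
      have hc0 : 0 < |c| := by linarith
      have := Measure.integral_comp_mul_right (fun s => unitInd (u + s)) c
      rw [this, integral_add_left_eq_self unitInd u, integral_unitInd, smul_eq_mul, mul_one,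
        abs_inv, inv_le_comm₀ hc0 two_pos]
      linarith
    have hsc := Real.sin_sq_add_cos_sq θ
    by_cases hc : 1 / 2 ≤ |Real.cos θ|
    · refine le_trans ?_ (key (Real.cos θ) (-t * Real.sin θ) hc)
      refine integral_mono (integrable_squareInd_linePoint θ t) (integrable_unitInd_affine
        (fun h => by rw [h] at hc; norm_num at hc) _) fun s => ?_
      exact mul_le_of_le_one_right (unitInd_nonneg _) (unitInd_le_one _)
    · have hs : 1 / 2 ≤ |Real.sin θ| := by
        rw [← sq_abs (Real.sin θ), ← sq_abs (Real.cos θ)] at hsc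
        nlinarith [abs_nonneg (Real.sin θ), abs_nonneg (Real.cos θ), not_le.1 hc]
      refine le_trans ?_ (key (Real.sin θ) (t * Real.cos θ) hs)
      refine integral_mono (integrable_squareInd_linePoint θ t) (integrable_unitInd_affine
        (fun h => by rw [h] at hs; norm_num at hs) _) fun s => ?_
      exact mul_le_of_le_one_left (unitInd_nonneg _) (unitInd_le_one _)
  · have : unitChord θ t = 0 := by
      unfold unitChord
      simp [squareInd_linePoint_eq_zero (Or.inl (not_le.1 ht))]
    rw [this]
    exact mul_nonneg two_pos.le (window_nonneg _)

lemma integral_unitChord (θ : ℝ) : ∫ t, unitChord θ t = 1 := by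
  have hi : Integrable (fun z : ℝ × ℝ => squareInd (linePoint θ z.1 z.2)) :=
    (measurePreserving_linePoint θ).integrable_comp_of_integrable integrable_squareInd
  have h1 : ∫ z : ℝ × ℝ, squareInd (linePoint θ z.1 z.2) = ∫ t, unitChord θ t := by
    rw [Measure.volume_eq_prod] at hi ⊢
    exact integral_prod _ hi
  have h2 := integral_map (μ := volume) (measurable_linePoint θ).aemeasurable
    (f := squareInd) measurable_squareInd.aestronglyMeasurable
  rw [(measurePreserving_linePoint θ).map_eq] at h2
  rw [← h1, ← h2, Measure.volume_eq_prod]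
  have h3 := integral_prod_mul (μ := (volume : Measure ℝ)) (ν := (volume : Measure ℝ)) unitInd unitInd
  rw [integral_unitInd, mul_one] at h3
  exact h3

/-- Cut the chord along the `L × L` grid and rescale each piece to unit size. -/
lemma sum_unitChord (hL : L ≠ 0) (θ t : ℝ) :
    ∑ a : Cell L, unitChord θ (L * t - cellOffset θ a) = L * unitChord θ t := by
  have hL0 : (L : ℝ) ≠ 0 := by exact_mod_cast hL
  have e : ∀ s : ℝ, squareInd (linePoint θ t s) = ∑ a : Cell L,
      squareInd (linePoint θ (L * t - cellOffset θ a)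
        (L * s - ((a.1 : ℕ) * Real.cos θ + (a.2 : ℕ) * Real.sin θ))) := by
    intro s
    unfold squareInd
    rw [unitInd_eq_sum hL, unitInd_eq_sum hL (linePoint θ t s).2, Finset.sum_mul_sum,
      ← Finset.sum_product']
    refine Finset.sum_congr rfl fun a _ => ?_
    have h := Real.sin_sq_add_cos_sq θ
    simp only [linePoint, cellOffset, proj]
    congr 2
    · linear_combination ((a.1 : ℕ) : ℝ) * h
    · linear_combination ((a.2 : ℕ) : ℝ) * h
  have hint : ∀ a : Cell L, Integrable fun s => squareInd (linePoint θ (L * t - cellOffset θ a)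
        (L * s - ((a.1 : ℕ) * Real.cos θ + (a.2 : ℕ) * Real.sin θ))) := fun a =>
    integrable_comp_affine hL (integrable_squareInd_linePoint θ (L * t - cellOffset θ a)) _
  have : unitChord θ t = ∑ a : Cell L, (1 / (L : ℝ)) * unitChord θ (L * t - cellOffset θ a) := by
    conv_lhs => unfold unitChord
    simp only [e]
    rw [integral_finsetSum _ fun a _ => hint a]
    refine Finset.sum_congr rfl fun a _ => ?_
    exact integral_comp_affine
      (g := fun s => squareInd (linePoint θ (L * t - cellOffset θ a) s)) _
  rw [this, ← Finset.mul_sum]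
  field_simp

lemma integral_abs_squareInd_add_sub_le (a b : ℝ) :
    ∫ z : ℝ × ℝ, |squareInd (z + (a, b)) - squareInd z| ≤ 2 * |a| + 2 * |b| := by
  have ha := (integrable_unitInd.comp_add_right a)
  have hb := (integrable_unitInd.comp_add_right b)
  have h1 := ((ha.sub integrable_unitInd).abs).mul_prod hb
  have h2 := integrable_unitInd.mul_prod ((hb.sub integrable_unitInd).abs)
  have hs : Integrable (fun z : ℝ × ℝ => |squareInd (z + (a, b)) - squareInd z|) := by
    have h3 := ha.mul_prod hb
    have h4 := integrable_unitInd.mul_prod integrable_unitInd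
    exact (h3.sub h4).abs
  have e1 := integral_prod_mul (μ := (volume : Measure ℝ)) (ν := (volume : Measure ℝ))
    (fun x => |unitInd (x + a) - unitInd x|) (fun y => unitInd (y + b))
  have e2 := integral_prod_mul (μ := (volume : Measure ℝ)) (ν := (volume : Measure ℝ))
    unitInd (fun y => |unitInd (y + b) - unitInd y|)
  rw [integral_add_right_eq_self unitInd b, integral_unitInd, mul_one] at e1
  rw [integral_unitInd, one_mul] at e2
  have := integral_mono hs (h1.add h2) fun z => by
    change |unitInd (z.1 + a) * unitInd (z.2 + b) - unitInd z.1 * unitInd z.2| ≤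
      |unitInd (z.1 + a) - unitInd z.1| * unitInd (z.2 + b) +
        unitInd z.1 * |unitInd (z.2 + b) - unitInd z.2|
    have e : unitInd (z.1 + a) * unitInd (z.2 + b) - unitInd z.1 * unitInd z.2 =
      (unitInd (z.1 + a) - unitInd z.1) * unitInd (z.2 + b) +
        unitInd z.1 * (unitInd (z.2 + b) - unitInd z.2) := by ring
    rw [e]
    refine (abs_add_le _ _).trans ?_
    rw [abs_mul, abs_mul, abs_of_nonneg (unitInd_nonneg (z.2 + b)),
      abs_of_nonneg (unitInd_nonneg z.1)]
  refine this.trans ?_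
  have h5 := integral_add h1 h2
  have ia := integral_abs_unitInd_add_sub_le a
  have ib := integral_abs_unitInd_add_sub_le b
  calc _ = _ := h5
    _ ≤ _ := add_le_add (e1.le.trans ia) (e2.le.trans ib)

/-- By Fubini in rotated coordinates, this follows from the `L¹` modulus of the indicator of the
square under a translation of length `|v|`. -/
lemma integral_abs_unitChord_add_sub_le (θ v : ℝ) :
    ∫ t, |unitChord θ (t + v) - unitChord θ t| ≤ 4 * |v| := by
  set F : ℝ × ℝ → ℝ := fun z =>
    |squareInd (z + (-v * Real.sin θ, v * Real.cos θ)) - squareInd z| with hF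
  have hmF : Measurable F := by
    have := measurable_squareInd
    rw [hF]
    fun_prop
  have hFi : Integrable F :=
    ((integrable_squareInd.comp_add_right _).sub integrable_squareInd).abs
  have hi : Integrable (fun z : ℝ × ℝ => F (linePoint θ z.1 z.2)) :=
    (measurePreserving_linePoint θ).integrable_comp_of_integrable hFi
  have h1 : ∫ z : ℝ × ℝ, F (linePoint θ z.1 z.2) = ∫ t, ∫ s, F (linePoint θ t s) := by
    rw [Measure.volume_eq_prod] at hi ⊢
    exact integral_prod _ hi
  have h2 := integral_map (μ := volume) (measurable_linePoint θ).aemeasurable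
    (f := F) hmF.aestronglyMeasurable
  rw [(measurePreserving_linePoint θ).map_eq] at h2
  have h3 := integral_abs_squareInd_add_sub_le (-v * Real.sin θ) (v * Real.cos θ)
  have h4 : 2 * |-v * Real.sin θ| + 2 * |v * Real.cos θ| ≤ 4 * |v| := by
    rw [abs_mul, abs_mul, abs_neg]
    have e1 := mul_le_of_le_one_right (abs_nonneg v) (Real.abs_sin_le_one θ)
    have e2 := mul_le_of_le_one_right (abs_nonneg v) (Real.abs_cos_le_one θ)
    linarith
  have hFl : ∀ t s, F (linePoint θ t s) =
      |squareInd (linePoint θ (t + v) s) - squareInd (linePoint θ t s)| := by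
    intro t s
    have : linePoint θ t s + (-v * Real.sin θ, v * Real.cos θ) = linePoint θ (t + v) s := by
      refine Prod.ext ?_ ?_ <;> simp only [linePoint, Prod.fst_add, Prod.snd_add] <;> ring
    simp only [hF, this]
  have hchord : Integrable (unitChord θ) := by
    refine (integrable_window.const_mul 2).mono' (measurable_unitChord θ).aestronglyMeasurable
      (ae_of_all _ fun t => ?_)
    rw [Real.norm_of_nonneg (unitChord_nonneg θ t)]
    exact unitChord_le_two_mul_window θ t
  refine le_trans ?_ ((h2.trans h1).symm.le.trans (h3.trans h4))
  refine integral_mono ((hchord.comp_add_right v).sub hchord).abs ?_ fun t => ?_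
  · rw [Measure.volume_eq_prod] at hi
    exact hi.integral_prod_left
  · change |unitChord θ (t + v) - unitChord θ t| ≤ ∫ s, F (linePoint θ t s)
    simp only [hFl, unitChord]
    rw [← integral_sub (integrable_squareInd_linePoint θ (t + v))
      (integrable_squareInd_linePoint θ t)]
    exact abs_integral_le_integral_abs

lemma abs_proj_le {θ x y b : ℝ} (hx : |x| ≤ b) (hy : |y| ≤ b) : |proj θ (x, y)| ≤ 2 * b := by
  unfold proj
  refine (abs_add_le _ _).trans ?_
  rw [abs_mul, abs_mul, abs_neg]
  have h1 := mul_le_of_le_one_right (abs_nonneg x) (Real.abs_sin_le_one θ)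
  have h2 := mul_le_of_le_one_right (abs_nonneg y) (Real.abs_cos_le_one θ)
  simp only
  linarith

lemma abs_cellOffset_le (θ : ℝ) (a : Cell L) : |cellOffset θ a| ≤ 2 * ((L : ℝ) - 1) := by
  have key : ∀ i : Fin L, |((i : ℕ) : ℝ)| ≤ (L : ℝ) - 1 := fun i => by
    rw [Nat.abs_cast, le_sub_iff_add_le]
    exact_mod_cast i.2
  exact abs_proj_le (key _) (key _)

lemma isSelfSimilarDensity_unitChord (hL : L ≠ 0) (θ : ℝ) :
    IsSelfSimilarDensity (cellOffset (L := L) θ) (unitChord θ) where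
  offset_le := abs_cellOffset_le θ
  measurable := measurable_unitChord θ
  nonneg := unitChord_nonneg θ
  le_window := unitChord_le_two_mul_window θ
  integral_eq_one := integral_unitChord θ
  sum_eq := sum_unitChord hL θ
  shift := integral_abs_unitChord_add_sub_le θ

end

section

variable {L : ℕ}

/-! ### Pairs of selected cells whose projections overlap -/

/-- Left end of the projection of the unit square. -/
def projMin (θ : ℝ) : ℝ := min (-Real.sin θ) 0 + min (Real.cos θ) 0

/-- Right end of the projection of the unit square. -/
def projMax (θ : ℝ) : ℝ := max (-Real.sin θ) 0 + max (Real.cos θ) 0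

/-- Length of the projection of the unit square. -/
def projWidth (θ : ℝ) : ℝ := |Real.sin θ| + |Real.cos θ|

lemma projMax_eq (θ : ℝ) : projMax θ = projMin θ + projWidth θ := by
  unfold projMax projMin projWidth
  have h1 := max_sub_min_eq_abs (-Real.sin θ) 0
  have h2 := max_sub_min_eq_abs (Real.cos θ) 0
  rw [zero_sub, abs_neg] at h1 h2
  rw [abs_neg] at h1
  linarith

lemma projWidth_pos (θ : ℝ) : 0 < projWidth θ := by
  by_contra h
  have h1 := abs_nonneg (Real.sin θ)
  have h2 := abs_nonneg (Real.cos θ)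
  unfold projWidth at h
  have h3 : Real.sin θ = 0 := abs_eq_zero.1 (by linarith)
  have h4 : Real.cos θ = 0 := abs_eq_zero.1 (by linarith)
  have := Real.sin_sq_add_cos_sq θ
  rw [h3, h4] at this
  norm_num at this

lemma projWidth_le_two (θ : ℝ) : projWidth θ ≤ 2 := by
  have h1 := Real.abs_sin_le_one θ
  have h2 := Real.abs_cos_le_one θ
  unfold projWidth
  linarith

/-- Move along the diagonal which joins the corners of extreme projection. As the projection has
length at most `2`, a margin `η` there leaves a margin `η / 2` in both coordinates. -/
lemma exists_proj_eq {θ t η : ℝ} (hη : 0 ≤ η) (h1 : projMin θ + η ≤ t) (h2 : t ≤ projMax θ - η) :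
    ∃ x ∈ Icc (η / 2) (1 - η / 2), ∃ y ∈ Icc (η / 2) (1 - η / 2), proj θ (x, y) = t := by
  have hW := projWidth_pos θ
  have hW2 := projWidth_le_two θ
  set l := (t - projMin θ) / projWidth θ with hl
  have hlt : l * projWidth θ = t - projMin θ := div_mul_cancel₀ _ hW.ne'
  have hMm := projMax_eq θ
  have hl1 : η / 2 ≤ l := by
    by_contra h
    nlinarith
  have hl2 : l ≤ 1 - η / 2 := by
    by_contra h
    nlinarith
  have hmem : ∀ P : Prop, ∀ _ : Decidable P,
      (if P then 1 - l else l) ∈ Icc (η / 2) (1 - η / 2) := by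
    intro P _
    split_ifs
    · exact ⟨by linarith, by linarith⟩
    · exact ⟨hl1, hl2⟩
  refine ⟨if -Real.sin θ < 0 then 1 - l else l, hmem _ _,
    if Real.cos θ < 0 then 1 - l else l, hmem _ _, ?_⟩
  have ht : t = projMin θ + l * projWidth θ := by linarith
  rw [ht]
  unfold proj projMin projWidth
  simp only
  rw [← abs_neg (Real.sin θ)]
  rcases lt_or_ge (-Real.sin θ) 0 with hs | hs <;> rcases lt_or_ge (Real.cos θ) 0 with hc | hc
  · rw [if_pos hs, if_pos hc, min_eq_left hs.le, min_eq_left hc.le, abs_of_neg hs, abs_of_neg hc]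
    ring
  · rw [if_pos hs, if_neg hc.not_gt, min_eq_left hs.le, min_eq_right hc, abs_of_neg hs,
      abs_of_nonneg hc]
    ring
  · rw [if_neg hs.not_gt, if_pos hc, min_eq_right hs, min_eq_left hc.le, abs_of_nonneg hs,
      abs_of_neg hc]
    ring
  · rw [if_neg hs.not_gt, if_neg hc.not_gt, min_eq_right hs, min_eq_right hc, abs_of_nonneg hs,
      abs_of_nonneg hc]
    ring

/-- A point at distance `η / 2` from the sides is the midpoint of a segment of length `η`, in any
direction, inside the square. -/
lemma le_unitChord {θ t η : ℝ} (hη : 0 ≤ η) (h1 : projMin θ + η ≤ t) (h2 : t ≤ projMax θ - η) :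
    η ≤ unitChord θ t := by
  obtain ⟨x, hx, y, hy, ht⟩ := exists_proj_eq hη h1 h2
  set s₀ := x * Real.cos θ + y * Real.sin θ with hs₀
  have key : ∀ s, indicator (Ioo (s₀ - η / 2) (s₀ + η / 2)) (1 : ℝ → ℝ) s ≤
      squareInd (linePoint θ t s) := by
    intro s
    by_cases hs : s ∈ Ioo (s₀ - η / 2) (s₀ + η / 2)
    · rw [indicator_of_mem hs, Pi.one_apply]
      have hs' : |s - s₀| < η / 2 := abs_lt.2 ⟨by linarith [hs.1], by linarith [hs.2]⟩
      have hsc := Real.sin_sq_add_cos_sq θ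
      have e1 : (linePoint θ t s).1 = x + (s - s₀) * Real.cos θ := by
        rw [← ht, hs₀]
        simp only [linePoint, proj]
        linear_combination x * hsc
      have e2 : (linePoint θ t s).2 = y + (s - s₀) * Real.sin θ := by
        rw [← ht, hs₀]
        simp only [linePoint, proj]
        linear_combination y * hsc
      have b1 : |(s - s₀) * Real.cos θ| < η / 2 := by
        rw [abs_mul]
        exact (mul_le_of_le_one_right (abs_nonneg _) (Real.abs_cos_le_one θ)).trans_lt hs'
      have b2 : |(s - s₀) * Real.sin θ| < η / 2 := by
        rw [abs_mul]
        exact (mul_le_of_le_one_right (abs_nonneg _) (Real.abs_sin_le_one θ)).trans_lt hs'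
      rw [abs_lt] at b1 b2
      unfold squareInd
      rw [e1, e2, unitInd_of_mem ⟨by linarith [hx.1], by linarith [hx.2]⟩,
        unitInd_of_mem ⟨by linarith [hy.1], by linarith [hy.2]⟩, one_mul]
    · rw [indicator_of_notMem hs]
      exact squareInd_nonneg _
  have hi : Integrable (indicator (Ioo (s₀ - η / 2) (s₀ + η / 2)) (1 : ℝ → ℝ)) :=
    (integrable_indicator_iff measurableSet_Ioo).2 (integrableOn_const (by simp))
  have := integral_mono hi (integrable_squareInd_linePoint θ t) key
  rw [integral_indicator_one measurableSet_Ioo] at this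
  simp only [Measure.real, Real.volume_Ioo] at this
  rw [ENNReal.toReal_ofReal (by linarith)] at this
  have e : s₀ + η / 2 - (s₀ - η / 2) = η := by ring
  rw [e] at this
  exact this

lemma exists_digit (hL : L ≠ 0) {x : ℝ} (hx : x ∈ Icc (0 : ℝ) 1) :
    ∃ i : Fin L, (L : ℝ) * x - (i : ℕ) ∈ Icc (0 : ℝ) 1 := by
  have hL0 : (0 : ℝ) < L := by exact_mod_cast Nat.pos_of_ne_zero hL
  have h0 : (0 : ℝ) ≤ L * x := mul_nonneg hL0.le hx.1
  rcases lt_or_ge x 1 with h | h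
  · refine ⟨⟨⌊(L : ℝ) * x⌋₊, ?_⟩, ?_, ?_⟩
    · rw [Nat.floor_lt h0]
      nlinarith
    · simpa using Nat.floor_le h0
    · have := Nat.lt_floor_add_one ((L : ℝ) * x)
      simp only
      linarith
  · have hx1 : x = 1 := le_antisymm hx.2 h
    refine ⟨⟨L - 1, by omega⟩, ?_⟩
    have : ((L - 1 : ℕ) : ℝ) = L - 1 := by
      rw [Nat.cast_sub (Nat.one_le_iff_ne_zero.2 hL), Nat.cast_one]
    simp [this, hx1]

/-- The word is the `L`-adic address of the point to depth `r`; after `r` rescalings the point is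
back in the unit square, whose projection lies in `[-2, 2]`. -/
lemma exists_wordOffset_close (hL : L ≠ 0) (θ : ℝ) (r : ℕ) : ∀ x ∈ Icc (0 : ℝ) 1,
    ∀ y ∈ Icc (0 : ℝ) 1, ∃ u : Fin r → Cell L,
      |L ^ r * proj θ (x, y) - wordOffset (cellOffset θ) r u| ≤ 2 := by
  induction r with
  | zero =>
    intro x hx y hy
    refine ⟨Fin.elim0, ?_⟩
    have := abs_proj_le (θ := θ) (abs_le.2 ⟨by linarith [hx.1], hx.2⟩)
      (abs_le.2 ⟨by linarith [hy.1], hy.2⟩)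
    simpa [wordOffset] using this
  | succ n ih =>
    intro x hx y hy
    obtain ⟨i, hi⟩ := exists_digit hL hx
    obtain ⟨j, hj⟩ := exists_digit hL hy
    obtain ⟨u, hu⟩ := ih _ hi _ hj
    refine ⟨Fin.cons (i, j) u, ?_⟩
    have e : (L : ℝ) ^ (n + 1) * proj θ (x, y) - wordOffset (cellOffset θ) (n + 1)
        (Fin.cons (i, j) u) = L ^ n * proj θ (L * x - (i : ℕ), L * y - (j : ℕ)) -
          wordOffset (cellOffset θ) n u := by
      simp only [wordOffset, Fin.cons_zero, Fin.tail_cons, cellOffset, proj]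
      ring
    rw [e]
    exact hu

/-- Probability that both `a` and `b` are selected. -/
def pairWeight (w : Config L → ℝ) (a b : Cell L) : ℝ := ∑ A, (if a ∈ A ∧ b ∈ A then w A else 0)

/-- An overlap of at least `γ` leaves room for a line through `a` which enters `b` at depth `γ / 2`.
The lines through a subsquare of level `r` deviate from it by at most `4 / L^r ≤ γ / 4`, so depth `γ
/ 4` remains. -/
lemma isLinked_of_abs_sub_le (hL : L ≠ 0) {w : Config L → ℝ} {θ q γ : ℝ} {a b : Cell L} {r : ℕ}
    (hab : a ≠ b) (hq : q ≤ pairWeight w a b) (hγ : 0 < γ)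
    (hgap : |cellOffset θ a - cellOffset θ b| ≤ projWidth θ - γ) (hr : 16 ≤ γ * (L : ℝ) ^ r) :
    IsLinked w (cellOffset θ) (unitChord θ) q (γ / 4) r := by
  have hM := projMax_eq θ
  obtain ⟨y, hy1, hy2, hy3, hy4⟩ : ∃ y, projMin θ ≤ y ∧ y ≤ projMax θ ∧
      projMin θ + γ / 2 ≤ y + (cellOffset θ a - cellOffset θ b) ∧
      y + (cellOffset θ a - cellOffset θ b) ≤ projMax θ - γ / 2 := by
    rcases le_total 0 (cellOffset θ a - cellOffset θ b) with h | h
    · rw [abs_of_nonneg h] at hgap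
      exact ⟨projMin θ + γ / 2, by linarith, by linarith, by linarith, by linarith⟩
    · rw [abs_of_nonpos h] at hgap
      exact ⟨projMax θ - γ / 2, by linarith, by linarith, by linarith, by linarith⟩
  obtain ⟨x₀, hx₀, y₀, hy₀, hp⟩ := exists_proj_eq le_rfl (by linarith : projMin θ + 0 ≤ y)
    (by linarith)
  rw [zero_div, sub_zero] at hx₀ hy₀
  obtain ⟨u, hu⟩ := exists_wordOffset_close hL θ r x₀ hx₀ y₀ hy₀
  rw [hp] at hu
  refine ⟨a, b, u, hab, hq, fun s hs => ?_⟩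
  have hL0 : (0 : ℝ) < L := by exact_mod_cast Nat.pos_of_ne_zero hL
  have hLr : (0 : ℝ) < (L : ℝ) ^ r := by positivity
  have hclose : |(s + wordOffset (cellOffset θ) r u) / L ^ r - y| ≤ γ / 4 := by
    have e : (s + wordOffset (cellOffset θ) r u) / L ^ r - y =
        (s - (L ^ r * y - wordOffset (cellOffset θ) r u)) / L ^ r := by
      field_simp
      ring
    rw [e, abs_div, abs_of_pos hLr, div_le_iff₀ hLr]
    have := abs_sub s (L ^ r * y - wordOffset (cellOffset θ) r u)
    linarith
  rw [abs_le] at hclose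
  refine le_unitChord (by linarith) ?_ ?_ <;> linarith [hclose.1, hclose.2]

/-- Bins of width `W` contain one point each, and only `L` bins are available. When all are
occupied, the last bin contains only the right end of the range. -/
lemma card_le_of_separated {ι : Type*} {x : ι → ℝ} {A : Finset ι} {m W : ℝ} (hW : 0 < W)
    (hL : L ≠ 0) (h1 : ∀ a ∈ A, m ≤ x a) (h2 : ∀ a ∈ A, x a ≤ m + ((L : ℝ) - 1) * W)
    (hsep : ∀ a ∈ A, ∀ b ∈ A, a ≠ b → W ≤ |x a - x b|) :
    A.card ≤ L ∧ (A.card = L → ∃ a ∈ A, x a = m + ((L : ℝ) - 1) * W) := by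
  set k : ι → ℕ := fun a => ⌊(x a - m) / W⌋₊ with hk
  have hn : ∀ a ∈ A, 0 ≤ (x a - m) / W := fun a ha => div_nonneg (by linarith [h1 a ha]) hW.le
  have hmaps : ∀ a ∈ A, k a ∈ Finset.range L := by
    intro a ha
    rw [Finset.mem_range, Nat.floor_lt (hn a ha), div_lt_iff₀ hW]
    have := h2 a ha
    nlinarith
  have hinj : Set.InjOn k A := by
    intro a ha b hb hab
    by_contra hne
    have hs := hsep a ha b hb hne
    have f1 := Nat.floor_le (hn a ha)
    have f2 := Nat.lt_floor_add_one ((x a - m) / W)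
    have f3 := Nat.floor_le (hn b hb)
    have f4 := Nat.lt_floor_add_one ((x b - m) / W)
    simp only [hk] at hab
    rw [hab] at f1 f2
    have : |(x a - m) / W - (x b - m) / W| < 1 := abs_lt.2 ⟨by linarith, by linarith⟩
    rw [← sub_div, abs_div, abs_of_pos hW, div_lt_one hW] at this
    have e : x a - m - (x b - m) = x a - x b := by ring
    rw [e] at this
    linarith
  have hcard := Finset.card_le_card_of_injOn k hmaps hinj
  rw [Finset.card_range] at hcard
  refine ⟨hcard, fun hc => ?_⟩
  classical
  have himg : A.image k = Finset.range L := by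
    refine Finset.eq_of_subset_of_card_le (Finset.image_subset_iff.2 hmaps) ?_
    rw [Finset.card_image_of_injOn hinj, hc, Finset.card_range]
  have : L - 1 ∈ A.image k := by
    rw [himg, Finset.mem_range]
    omega
  obtain ⟨a, ha, hka⟩ := Finset.mem_image.1 this
  refine ⟨a, ha, le_antisymm (h2 a ha) ?_⟩
  have f1 := Nat.floor_le (hn a ha)
  simp only [hk] at hka
  rw [hka, Nat.cast_sub (Nat.one_le_iff_ne_zero.2 hL), Nat.cast_one, le_div_iff₀ hW] at f1
  linarith

lemma IsUniformWeight.sum_mul_card {w : Config L → ℝ} (hw : IsUniformWeight w) :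
    ∑ A, w A * A.card = L := by
  have hL0 : (L : ℝ) ≠ 0 := by exact_mod_cast hw.ne_zero
  calc ∑ A, w A * A.card = ∑ A : Config L, ∑ c : Cell L, (if c ∈ A then w A else 0) := by
        refine Finset.sum_congr rfl fun A _ => ?_
        rw [← Finset.sum_filter]
        simp [mul_comm]
    _ = ∑ c : Cell L, 1 / (L : ℝ) := by
        rw [Finset.sum_comm]
        exact Finset.sum_congr rfl fun c _ => hw.marginal c
    _ = L := by
        simp

lemma existsUnique_of_injOn {α : Type*} {A : Finset α} {f : α → Fin L} (hf : Set.InjOn f A)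
    (hc : A.card = L) (j : Fin L) : ∃! a, a ∈ A ∧ f a = j := by
  have : A.image f = Finset.univ := by
    refine Finset.eq_univ_of_card _ ?_
    rw [Finset.card_image_of_injOn hf, hc, Fintype.card_fin]
  obtain ⟨a, ha, hfa⟩ := Finset.mem_image.1 (this ▸ Finset.mem_univ j)
  exact ⟨a, ⟨ha, hfa⟩, fun b hb => hf hb.1 ha (hb.2.trans hfa.symm)⟩

/-- Otherwise the cells of every possible selection have projections with disjoint interiors. Their
offsets lie in a range of length `(L - 1)` times the width, so a selection has at most `L` cells,
hence exactly `L`, and the top of the range is always occupied. Axis directions then give a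
degenerate model, all others a cell selected with certainty. -/
lemma exists_pair_abs_sub_lt {w : Config L → ℝ} (hw : IsUniformWeight w)
    (hV : ¬ ∀ A, 0 < w A → ∀ i : Fin L, ∃! j : Fin L, (i, j) ∈ A)
    (hH : ¬ ∀ A, 0 < w A → ∀ j : Fin L, ∃! i : Fin L, (i, j) ∈ A) {θ : ℝ}
    (hθ : θ ∈ Icc 0 Real.pi) : ∃ a b : Cell L, a ≠ b ∧ 0 < pairWeight w a b ∧
      |cellOffset θ a - cellOffset θ b| < projWidth θ := by
  by_contra! H
  have hL := hw.ne_zero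
  have hL1 : (1 : ℝ) ≤ L := by exact_mod_cast Nat.one_le_iff_ne_zero.2 hL
  have hs : 0 ≤ Real.sin θ := Real.sin_nonneg_of_mem_Icc hθ
  have hsep : ∀ A, 0 < w A → ∀ a ∈ A, ∀ b ∈ A, a ≠ b →
      projWidth θ ≤ |cellOffset θ a - cellOffset θ b| := by
    intro A hA a ha b hb hab
    refine H a b hab (hA.trans_le ?_)
    have := Finset.single_le_sum (f := fun A => if a ∈ A ∧ b ∈ A then w A else 0)
      (fun B _ => by split_ifs <;> simp [hw.nonneg]) (Finset.mem_univ A)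
    rwa [if_pos ⟨ha, hb⟩] at this
  have hcoord : ∀ i : Fin L, (0 : ℝ) ≤ (i : ℕ) ∧ ((i : ℕ) : ℝ) ≤ L - 1 := fun i =>
    ⟨Nat.cast_nonneg _, by rw [le_sub_iff_add_le]; exact_mod_cast i.2⟩
  have hlow : ∀ a : Cell L, ((L : ℝ) - 1) * projMin θ ≤ cellOffset θ a := by
    intro a
    have h1 := hcoord a.1
    have h2 := hcoord a.2
    unfold cellOffset proj projMin
    rw [min_eq_left (by linarith : -Real.sin θ ≤ 0)]
    have h3 := min_le_left (Real.cos θ) 0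
    have h4 := min_le_right (Real.cos θ) 0
    simp only
    nlinarith [mul_le_mul_of_nonneg_right h1.2 hs, mul_le_mul_of_nonneg_left h3 h2.1,
      mul_le_mul_of_nonpos_right h2.2 h4]
  have htop : ((L : ℝ) - 1) * projMin θ + ((L : ℝ) - 1) * projWidth θ =
      ((L : ℝ) - 1) * max (Real.cos θ) 0 := by
    rw [← mul_add, ← projMax_eq, projMax, max_eq_right (by linarith : -Real.sin θ ≤ 0), zero_add]
  have hupc : ∀ a : Cell L, ((a.2 : ℕ) : ℝ) * Real.cos θ ≤ ((L : ℝ) - 1) * max (Real.cos θ) 0 := by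
    intro a
    have h2 := hcoord a.2
    have h3 := le_max_left (Real.cos θ) 0
    have h4 := le_max_right (Real.cos θ) 0
    nlinarith [mul_le_mul_of_nonneg_left h3 h2.1, mul_le_mul_of_nonneg_right h2.2 h4]
  have hup : ∀ a : Cell L, cellOffset θ a ≤
      ((L : ℝ) - 1) * projMin θ + ((L : ℝ) - 1) * projWidth θ := by
    intro a
    rw [htop]
    unfold cellOffset proj
    have := mul_nonneg (hcoord a.1).1 hs
    have := hupc a
    simp only
    linarith
  have hfill := fun A (hA : 0 < w A) => card_le_of_separated (projWidth_pos θ) hL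
    (fun a _ => hlow a) (fun a _ => hup a) (hsep A hA)
  -- A cardinality which never exceeds its mean `L` equals it almost surely.
  have hcard : ∀ A, 0 < w A → A.card = L := by
    have hsum : ∑ A, w A * ((L : ℝ) - A.card) = 0 := by
      simp only [mul_sub]
      rw [Finset.sum_sub_distrib, hw.sum_mul_card, ← Finset.sum_mul, hw.sum_one, one_mul, sub_self]
    have hnn : ∀ A ∈ Finset.univ, 0 ≤ w A * ((L : ℝ) - A.card) := by
      intro A _
      rcases (hw.nonneg A).eq_or_lt with h | h
      · rw [← h, zero_mul]
      · have : (A.card : ℝ) ≤ L := by exact_mod_cast (hfill A h).1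
        exact mul_nonneg h.le (by linarith)
    intro A hA
    have := (Finset.sum_eq_zero_iff_of_nonneg hnn).1 hsum A (Finset.mem_univ A)
    rcases mul_eq_zero.1 this with h | h
    · exact absurd h hA.ne'
    · exact_mod_cast (sub_eq_zero.1 h).symm
  -- Here the offset depends only on the row, so separation puts the `L` cells in distinct rows:
  -- horizontal degeneracy. The case `cos θ = 0` is the same with columns.
  by_cases hs0 : Real.sin θ = 0
  · have hc1 : |Real.cos θ| ≤ 1 := Real.abs_cos_le_one θ
    refine hH fun A hA j => ?_
    have hinj : Set.InjOn (fun a : Cell L => a.2) A := by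
      intro a ha b hb hab
      by_contra hne
      have := hsep A hA a ha b hb hne
      simp only at hab
      rw [cellOffset, cellOffset, proj, proj, hab, hs0] at this
      simp only [mul_zero, zero_add, sub_self, abs_zero] at this
      exact absurd this (not_le.2 (projWidth_pos θ))
    obtain ⟨a, ⟨ha, haj⟩, hu⟩ := existsUnique_of_injOn hinj (hcard A hA) j
    refine ⟨a.1, ?_, fun i hi => ?_⟩
    · simp only
      rw [← haj]
      exact ha
    · have := hu (i, j) ⟨hi, rfl⟩
      rw [← this]
  by_cases hc0 : Real.cos θ = 0
  · refine hV fun A hA i => ?_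
    have hinj : Set.InjOn (fun a : Cell L => a.1) A := by
      intro a ha b hb hab
      by_contra hne
      have := hsep A hA a ha b hb hne
      simp only at hab
      rw [cellOffset, cellOffset, proj, proj, hab, hc0] at this
      simp only [mul_zero, add_zero, sub_self, abs_zero] at this
      exact absurd this (not_le.2 (projWidth_pos θ))
    obtain ⟨a, ⟨ha, hai⟩, hu⟩ := existsUnique_of_injOn hinj (hcard A hA) i
    refine ⟨a.2, ?_, fun j hj => ?_⟩
    · simp only
      rw [← hai]
      exact ha
    · have := hu (i, j) ⟨hj, rfl⟩
      rw [← this]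
  have hs1 : 0 < Real.sin θ := lt_of_le_of_ne hs (Ne.symm hs0)
  -- In an oblique direction only one corner cell attains the extreme offset; it would be selected
  -- with probability `1`, not `1 / L`.
  obtain ⟨c, hc⟩ : ∃ c : Cell L, ∀ a : Cell L,
      cellOffset θ a = ((L : ℝ) - 1) * max (Real.cos θ) 0 → a = c := by
    obtain ⟨j, hj⟩ : ∃ j : Fin L, ((j : ℕ) : ℝ) * Real.cos θ =
        ((L : ℝ) - 1) * max (Real.cos θ) 0 := by
      rcases le_total (Real.cos θ) 0 with h | h
      · exact ⟨⟨0, Nat.pos_of_ne_zero hL⟩, by simp [max_eq_right h]⟩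
      · refine ⟨⟨L - 1, by omega⟩, ?_⟩
        simp only
        rw [Nat.cast_sub (Nat.one_le_iff_ne_zero.2 hL), Nat.cast_one, max_eq_left h]
    refine ⟨(⟨0, Nat.pos_of_ne_zero hL⟩, j), fun a ha => ?_⟩
    have h1 := hupc a
    have h2 := mul_nonneg (hcoord a.1).1 hs
    unfold cellOffset proj at ha
    simp only at ha
    have h3 : ((a.1 : ℕ) : ℝ) * Real.sin θ = 0 := by linarith
    have h4 : ((a.2 : ℕ) : ℝ) * Real.cos θ = ((j : ℕ) : ℝ) * Real.cos θ := by linarith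
    refine Prod.ext (Fin.ext ?_) (Fin.ext ?_)
    · exact_mod_cast (mul_eq_zero.1 h3).resolve_right hs0
    · exact_mod_cast mul_right_cancel₀ hc0 h4
  have hall : ∀ A, 0 < w A → c ∈ A := by
    intro A hA
    obtain ⟨a, ha, hxa⟩ := (hfill A hA).2 (hcard A hA)
    rw [htop] at hxa
    rwa [← hc a hxa]
  have h1 := hw.marginal c
  have h2 : ∑ A, (if c ∈ A then w A else 0) = ∑ A, w A := by
    refine Finset.sum_congr rfl fun A _ => ?_
    split_ifs with h
    · rfl
    · rcases (hw.nonneg A).eq_or_lt with h0 | h0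
      · exact h0
      · exact absurd (hall A h0) h
  rw [h2, hw.sum_one] at h1
  have h3 : (2 : ℝ) ≤ L := by exact_mod_cast hw.two_le
  have : 1 / (L : ℝ) < 1 := by rw [div_lt_one (by linarith)]; linarith
  linarith

/-- The largest overlap among the finitely many pairs of positive probability is continuous and
positive in `θ`, so it is bounded below on the compact interval. The smallest pair probability
serves as `q`. -/
theorem exists_isLinked {w : Config L → ℝ} (hw : IsUniformWeight w)
    (hV : ¬ ∀ A, 0 < w A → ∀ i : Fin L, ∃! j : Fin L, (i, j) ∈ A)
    (hH : ¬ ∀ A, 0 < w A → ∀ j : Fin L, ∃! i : Fin L, (i, j) ∈ A) :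
    ∃ (q c : ℝ) (r : ℕ), 0 < q ∧ 0 < c ∧ ∀ θ ∈ Icc 0 Real.pi,
      IsLinked w (cellOffset θ) (unitChord θ) q c r := by
  classical
  set T : Finset (Cell L × Cell L) :=
    Finset.univ.filter fun z => z.1 ≠ z.2 ∧ 0 < pairWeight w z.1 z.2 with hT
  have hTm : ∀ z, z ∈ T ↔ z.1 ≠ z.2 ∧ 0 < pairWeight w z.1 z.2 := by simp [hT]
  have hne : T.Nonempty := by
    obtain ⟨a, b, h1, h2, _⟩ := exists_pair_abs_sub_lt hw hV hH
      (left_mem_Icc.2 Real.pi_pos.le)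
    exact ⟨(a, b), (hTm _).2 ⟨h1, h2⟩⟩
  obtain ⟨z₀, hz₀, hmin⟩ := T.exists_min_image (fun z => pairWeight w z.1 z.2) hne
  set G : ℝ → ℝ := fun θ => T.sup' hne fun z =>
    projWidth θ - |cellOffset θ z.1 - cellOffset θ z.2| with hG
  have hGc : Continuous G := by
    refine Continuous.finset_sup'_apply hne fun z _ => ?_
    unfold projWidth cellOffset proj
    fun_prop
  have hGpos : ∀ θ ∈ Icc 0 Real.pi, 0 < G θ := by
    intro θ hθ
    obtain ⟨a, b, h1, h2, h3⟩ := exists_pair_abs_sub_lt hw hV hH hθ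
    refine lt_of_lt_of_le (sub_pos.2 h3) ?_
    exact Finset.le_sup' (fun z : Cell L × Cell L =>
      projWidth θ - |cellOffset θ z.1 - cellOffset θ z.2|) ((hTm (a, b)).2 ⟨h1, h2⟩)
  obtain ⟨θ₀, hθ₀, hθmin⟩ := isCompact_Icc.exists_isMinOn
    (nonempty_Icc.2 Real.pi_pos.le) hGc.continuousOn
  set γ := G θ₀ with hγ
  have hγ0 : 0 < γ := hGpos θ₀ hθ₀
  have hL1 : (1 : ℝ) < L := by exact_mod_cast hw.two_le
  obtain ⟨r, hr⟩ := pow_unbounded_of_one_lt (16 / γ) hL1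
  refine ⟨pairWeight w z₀.1 z₀.2, γ / 4, r, ((hTm _).1 hz₀).2, by linarith, fun θ hθ => ?_⟩
  obtain ⟨z, hz, hzG⟩ := Finset.exists_mem_eq_sup' hne fun z : Cell L × Cell L =>
    projWidth θ - |cellOffset θ z.1 - cellOffset θ z.2|
  have hle : γ ≤ projWidth θ - |cellOffset θ z.1 - cellOffset θ z.2| := by
    rw [← hzG]
    exact hθmin hθ
  refine isLinked_of_abs_sub_le hw.ne_zero ((hTm z).1 hz).1 (hmin z hz) hγ0 (by linarith) ?_
  rw [div_lt_iff₀ hγ0] at hr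
  linarith

/-! ### Weights of a grid model -/

/-- Probability of a selection. -/
def GridModel.weight (M : GridModel L) (A : Config L) : ℝ := (M.law A).toReal

lemma GridModel.real_toMeasure (M : GridModel L) (s : Set (Config L)) [DecidablePred (· ∈ s)] :
    M.law.toMeasure.real s = ∑ A, if A ∈ s then M.weight A else 0 := by
  rw [Measure.real, PMF.toMeasure_apply_fintype, ENNReal.toReal_sum]
  · refine Finset.sum_congr rfl fun A _ => ?_
    unfold GridModel.weight
    by_cases h : A ∈ s <;> simp [h]
  · intro A _
    by_cases h : A ∈ s <;> simp [h, PMF.apply_ne_top]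

lemma GridModel.isUniformWeight (M : GridModel L) (h : M.Uniform) : IsUniformWeight M.weight where
  two_le := M.two_le
  nonneg A := ENNReal.toReal_nonneg
  sum_one := by
    classical
    have := M.real_toMeasure univ
    simpa using this.symm
  marginal c := by
    rw [← h c, M.real_toMeasure {A | c ∈ A}]
    rfl

lemma GridModel.ae_of_forall_pos (M : GridModel L) {Q : Config L → Prop}
    (h : ∀ A, 0 < M.weight A → Q A) : ∀ᵐ A ∂M.law.toMeasure, Q A := by
  classical
  rw [ae_iff, ← measureReal_eq_zero_iff, M.real_toMeasure]
  refine Finset.sum_eq_zero fun A _ => ?_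
  split_ifs with hA
  · by_contra hne
    exact hA (h A (lt_of_le_of_ne ENNReal.toReal_nonneg (Ne.symm hne)))
  · rfl

theorem GridModel.exists_isLinked (M : GridModel L) (hu : M.Uniform) (hnd : M.NonDegenerate) :
    ∃ (q c : ℝ) (r : ℕ), 0 < q ∧ 0 < c ∧ ∀ θ ∈ Icc 0 Real.pi,
      IsLinked M.weight (cellOffset θ) (unitChord θ) q c r :=
  RandomGrid.exists_isLinked (M.isUniformWeight hu) (fun h => hnd.1 (M.ae_of_forall_pos h))
    (fun h => hnd.2 (M.ae_of_forall_pos h))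

end

section

variable {L : ℕ}

/-! ### Random trees of selections -/

/-- A selection for every address. -/
abbrev Tree (L : ℕ) : Type := List (Cell L) → Config L

/-- The part of the tree `x` below the cell `a`. -/
def subtree (a : Cell L) (x : Tree L) : Tree L := fun w => x (a :: w)

/-- The tree with selection `A` at the root and the tree `y a` below each cell `a`. -/
def graft (z : Config L × (Cell L → Tree L)) : Tree L
  | [] => z.1
  | a :: w => z.2 a w

@[simp] lemma graft_nil (z : Config L × (Cell L → Tree L)) : graft z [] = z.1 := rfl

@[simp] lemma subtree_graft (a : Cell L) (z : Config L × (Cell L → Tree L)) :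
    subtree a (graft z) = z.2 a := rfl

lemma measurable_subtree (a : Cell L) : Measurable (subtree (L := L) a) :=
  measurable_pi_lambda _ fun _ => measurable_pi_apply _

lemma measurable_graft : Measurable (graft (L := L)) := by
  refine measurable_pi_lambda _ fun w => ?_
  cases w with
  | nil => exact measurable_fst
  | cons a w =>
    exact (measurable_pi_apply w).comp ((measurable_pi_apply a).comp measurable_snd)

/-- Words are sorted by their first letter, which splits a cylinder probability into a root factor
and one factor per subtree. -/
lemma prod_list_eq {β γ : Type*} [Fintype β] [CommMonoid γ] [DecidableEq β]
    (s : Finset (List β)) (f : List β → γ) :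
    ∏ w ∈ s, f w = (if [] ∈ s then f [] else 1) *
      ∏ a, ∏ w ∈ s.preimage (fun w => a :: w) (List.cons_injective.injOn), f (a :: w) := by
  rw [← Finset.prod_fiberwise s (fun w => w.head?) f, Fintype.prod_option]
  congr 1
  · split_ifs with h
    · have : s.filter (fun w => w.head? = none) = {[]} := by
        ext w
        simp only [Finset.mem_filter, List.head?_eq_none_iff, Finset.mem_singleton]
        exact ⟨fun h => h.2, fun hw => ⟨hw ▸ h, hw⟩⟩
      rw [this, Finset.prod_singleton]
    · have : s.filter (fun w => w.head? = none) = ∅ := by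
        ext w
        simp only [Finset.mem_filter, List.head?_eq_none_iff, Finset.notMem_empty, iff_false]
        rintro ⟨h1, rfl⟩
        exact h h1
      rw [this, Finset.prod_empty]
  · refine Finset.prod_congr rfl fun a _ => ?_
    have : s.filter (fun w => w.head? = some a) =
        (s.preimage (fun w => a :: w) (List.cons_injective.injOn)).image (fun w => a :: w) := by
      ext w
      simp only [Finset.mem_filter, Finset.mem_image, Finset.mem_preimage]
      constructor
      · rintro ⟨h1, h2⟩
        obtain ⟨w', rfl⟩ := List.head?_eq_some_iff.1 h2
        exact ⟨w', h1, rfl⟩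
      · rintro ⟨w', h1, rfl⟩
        exact ⟨h1, rfl⟩
    rw [this, Finset.prod_image (List.cons_injective.injOn)]

namespace GridModel

variable (M : GridModel L)

/-- Law of a tree of independent selections. -/
def treeLaw : Measure (Tree L) := Measure.infinitePi fun _ => M.law.toMeasure

instance : IsProbabilityMeasure M.treeLaw :=
  inferInstanceAs (IsProbabilityMeasure (Measure.infinitePi fun _ => M.law.toMeasure))

/-- Law of independent trees, one below each cell. -/
def forestLaw : Measure (Cell L → Tree L) := Measure.pi fun _ => M.treeLaw

instance : IsProbabilityMeasure M.forestLaw :=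
  inferInstanceAs (IsProbabilityMeasure (Measure.pi fun _ => M.treeLaw))

/-- The branching property: the root selection and the subtrees below the cells are independent, and
each subtree is distributed as the whole tree. It is checked on cylinders. -/
lemma map_graft : (M.law.toMeasure.prod M.forestLaw).map graft = M.treeLaw := by
  refine Measure.eq_infinitePi _ fun s t ht => ?_
  classical
  rw [Measure.map_apply measurable_graft (MeasurableSet.pi s.countable_toSet fun i _ => ht i)]
  have hpre : graft ⁻¹' (Set.pi s t) = (if [] ∈ s then t [] else univ) ×ˢ
      (Set.pi univ fun a => Set.pi (s.preimage (fun w => a :: w) (List.cons_injective.injOn) :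
        Finset (List (Cell L))) fun w => t (a :: w)) := by
    ext z
    simp only [mem_preimage, Set.mem_pi, mem_prod, Finset.coe_preimage, mem_univ, forall_const,
      Finset.mem_coe]
    constructor
    · intro h
      refine ⟨?_, fun a w hw => h (a :: w) hw⟩
      split_ifs with h0
      · exact h [] h0
      · trivial
    · rintro ⟨h1, h2⟩ w hw
      cases w with
      | nil => rw [if_pos hw] at h1; exact h1
      | cons a w => exact h2 a w hw
  rw [hpre, Measure.prod_prod, forestLaw, Measure.pi_pi, prod_list_eq s]
  congr 1
  · split_ifs <;> simp
  · refine Finset.prod_congr rfl fun a _ => ?_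
    exact Measure.infinitePi_pi _ fun w _ => ht _

variable {M}

lemma integral_treeLaw {F : Tree L → ℝ} (hF : Measurable F) {C : ℝ} (hC : ∀ x, |F x| ≤ C) :
    ∫ x, F x ∂M.treeLaw = ∑ A, M.weight A * ∫ y, F (graft (A, y)) ∂M.forestLaw := by
  have hm : Measurable fun z => F (graft z) := hF.comp measurable_graft
  rw [← M.map_graft, integral_map measurable_graft.aemeasurable hF.aestronglyMeasurable,
    integral_prod]
  · rw [PMF.integral_eq_sum]
    rfl
  · exact Integrable.of_bound hm.aestronglyMeasurable C (ae_of_all _ fun z => hC _)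

lemma integral_forestLaw_eval {F : Tree L → ℝ} (hF : Measurable F) (a : Cell L) :
    ∫ y, F (y a) ∂M.forestLaw = ∫ x, F x ∂M.treeLaw := by
  have h := measurePreserving_eval (fun _ : Cell L => M.treeLaw) a
  have h2 := integral_map (μ := M.forestLaw) h.measurable.aemeasurable
    (f := F) hF.aestronglyMeasurable
  rw [← h2]
  congr 1
  exact h.map_eq

lemma integral_forestLaw_prod (A : Config L) (F : Cell L → Tree L → ℝ) :
    ∫ y, ∏ a ∈ A, F a (y a) ∂M.forestLaw = ∏ a ∈ A, ∫ x, F a x ∂M.treeLaw := by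
  classical
  have h := integral_fintype_prod_eq_prod (μ := fun _ : Cell L => M.treeLaw) (𝕜 := ℝ)
    (fun a x => if a ∈ A then F a x else 1)
  have e1 : ∀ y : Cell L → Tree L, ∏ a ∈ A, F a (y a) = ∏ a, if a ∈ A then F a (y a) else 1 := by
    intro y
    rw [Finset.prod_ite_mem, Finset.univ_inter]
  simp only [e1]
  refine h.trans ?_
  rw [← Finset.univ_inter A, ← Finset.prod_ite_mem]
  refine Finset.prod_congr rfl fun a _ => ?_
  by_cases ha : a ∈ A <;> simp [ha]

end GridModel

/-! ### Squares and their projections along the tree -/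

/-- Generations are defined by appending a letter at the end, while the branching property acts on
the first letter; this reconciles the two. -/
lemma squares_succ (x : Tree L) (n : ℕ) : squares x (n + 1) =
    (x []).biUnion fun a => (squares (subtree a x) n).image (fun w => a :: w) := by
  induction n generalizing x with
  | zero =>
    ext w
    simp [squares, eq_comm]
  | succ n ih =>
    rw [squares, ih]
    ext w
    simp only [squares, Finset.mem_biUnion, Finset.mem_image, subtree]
    constructor
    · rintro ⟨_, ⟨a, ha, v, hv, rfl⟩, b, hb, rfl⟩
      exact ⟨a, ha, v ++ [b], ⟨v, hv, b, hb, rfl⟩, rfl⟩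
    · rintro ⟨a, ha, _, ⟨v, hv, b, hb, rfl⟩, rfl⟩
      exact ⟨a :: v, ⟨a, ha, v, hv, rfl⟩, b, hb, rfl⟩

lemma mem_square_cons (hL : L ≠ 0) (a : Cell L) (w : List (Cell L)) (z : ℝ × ℝ) :
    z ∈ square (a :: w) ↔ ((L : ℝ) * z.1 - (a.1 : ℕ), (L : ℝ) * z.2 - (a.2 : ℕ)) ∈ square w := by
  have hL0 : (0 : ℝ) < L := by exact_mod_cast Nat.pos_of_ne_zero hL
  have key : ∀ i c d u : ℝ, u ∈ Icc ((i + c) / L) ((i + c) / L + 1 / (L : ℝ) ^ (w.length + 1)) ↔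
      L * u - i ∈ Icc c (c + 1 / (L : ℝ) ^ w.length) := by
    intro i c d u
    have e : (i + c) / L + 1 / (L : ℝ) ^ (w.length + 1) =
        (i + (c + 1 / (L : ℝ) ^ w.length)) / L := by
      field_simp
      ring
    rw [e, mem_Icc, mem_Icc, div_le_iff₀ hL0, le_div_iff₀ hL0]
    constructor <;> rintro ⟨h1, h2⟩ <;> constructor <;> linarith
  simp only [square, mem_prod, corner, List.length_cons]
  rw [key _ _ 0, key _ _ 0]

lemma mem_stage_succ (hL : L ≠ 0) (x : Tree L) (n : ℕ) (z : ℝ × ℝ) : z ∈ stage x (n + 1) ↔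
    ∃ a ∈ x [], ((L : ℝ) * z.1 - (a.1 : ℕ), (L : ℝ) * z.2 - (a.2 : ℕ)) ∈
      stage (subtree a x) n := by
  simp only [stage, squares_succ, Finset.mem_biUnion, Finset.mem_image, mem_iUnion, exists_prop]
  constructor
  · rintro ⟨_, ⟨a, ha, w, hw, rfl⟩, hz⟩
    exact ⟨a, ha, w, hw, (mem_square_cons hL a w z).1 hz⟩
  · rintro ⟨a, ha, w, hw, hz⟩
    exact ⟨_, ⟨a, ha, w, hw, rfl⟩, (mem_square_cons hL a w z).2 hz⟩

lemma mem_proj_stage_succ (hL : L ≠ 0) (x : Tree L) (n : ℕ) (θ t : ℝ) :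
    t ∈ proj θ '' stage x (n + 1) ↔
      ∃ a ∈ x [], L * t - cellOffset θ a ∈ proj θ '' stage (subtree a x) n := by
  have hL0 : (L : ℝ) ≠ 0 := by exact_mod_cast hL
  constructor
  · rintro ⟨z, hz, rfl⟩
    obtain ⟨a, ha, h⟩ := (mem_stage_succ hL x n z).1 hz
    refine ⟨a, ha, _, h, ?_⟩
    simp only [proj, cellOffset]
    ring
  · rintro ⟨a, ha, z, hz, h⟩
    refine ⟨((z.1 + (a.1 : ℕ)) / L, (z.2 + (a.2 : ℕ)) / L), (mem_stage_succ hL x n _).2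
      ⟨a, ha, ?_⟩, ?_⟩
    · convert hz using 1
      refine Prod.ext ?_ ?_ <;> simp only <;> field_simp <;> ring
    · have : t = (proj θ z + cellOffset θ a) / L := by
        rw [h]
        field_simp
        ring
      rw [this]
      simp only [proj, cellOffset]
      field_simp
      ring

lemma stage_zero (x : Tree L) : stage x 0 = Icc 0 1 ×ˢ Icc 0 1 := by
  simp [stage, squares, square, corner]

lemma mem_proj_stage_zero (x : Tree L) (θ t : ℝ) :
    t ∈ proj θ '' stage x 0 ↔ t ∈ Icc (projMin θ) (projMax θ) := by
  rw [stage_zero]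
  constructor
  · rintro ⟨⟨u, v⟩, ⟨hu, hv⟩, rfl⟩
    simp only [mem_Icc] at hu hv
    have key : ∀ c u : ℝ, 0 ≤ u → u ≤ 1 → min c 0 ≤ u * c ∧ u * c ≤ max c 0 := by
      intro c u h0 h1
      rcases le_total c 0 with h | h
      · rw [min_eq_left h, max_eq_right h]
        exact ⟨by nlinarith, by nlinarith⟩
      · rw [min_eq_right h, max_eq_left h]
        exact ⟨by nlinarith, by nlinarith⟩
    have h1 := key (-Real.sin θ) u hu.1 hu.2
    have h2 := key (Real.cos θ) v hv.1 hv.2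
    simp only [proj, projMin, projMax, mem_Icc]
    constructor <;> linarith [h1.1, h1.2, h2.1, h2.2]
  · rintro ⟨h1, h2⟩
    obtain ⟨u, hu, v, hv, h⟩ := exists_proj_eq (θ := θ) (t := t) le_rfl (by linarith) (by linarith)
    rw [zero_div, sub_zero] at hu hv
    exact ⟨(u, v), ⟨hu, hv⟩, h⟩

end

section

variable {L : ℕ}

/-! ### Probability that a line is hit -/

lemma stage_succ_subset (hL : L ≠ 0) (x : Tree L) (n : ℕ) : stage x (n + 1) ⊆ stage x n := by
  have hL0 : (0 : ℝ) < L := by exact_mod_cast Nat.pos_of_ne_zero hL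
  induction n generalizing x with
  | zero =>
    intro z hz
    obtain ⟨a, ha, h⟩ := (mem_stage_succ hL x 0 z).1 hz
    rw [stage_zero] at h ⊢
    have key : ∀ (i : Fin L) (u : ℝ), (L : ℝ) * u - (i : ℕ) ∈ Icc (0 : ℝ) 1 →
        u ∈ Icc (0 : ℝ) 1 := by
      rintro i u ⟨h1, h2⟩
      have h3 : (0 : ℝ) ≤ (i : ℕ) := Nat.cast_nonneg _
      have h4 : ((i : ℕ) : ℝ) + 1 ≤ L := by exact_mod_cast i.2
      exact ⟨nonneg_of_mul_nonneg_right (by linarith : 0 ≤ (L : ℝ) * u) hL0, by nlinarith⟩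
    exact ⟨key _ _ h.1, key _ _ h.2⟩
  | succ n ih =>
    intro z hz
    obtain ⟨a, ha, h⟩ := (mem_stage_succ hL x (n + 1) z).1 hz
    exact (mem_stage_succ hL x n z).2 ⟨a, ha, ih _ h⟩

lemma stage_antitone (hL : L ≠ 0) (x : Tree L) : Antitone (stage x) :=
  antitone_nat_of_succ_le (stage_succ_subset hL x)

/-- Trees, directions and positions for which the line meets the `n`-th stage. -/
def hitSet (L n : ℕ) : Set (Tree L × ℝ × ℝ) := {z | z.2.2 ∈ proj z.2.1 '' stage z.1 n}

lemma measurableSet_mem_root (a : Cell L) : MeasurableSet {x : Tree L | a ∈ x []} :=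
  (measurable_pi_apply (X := fun _ : List (Cell L) => Config L) [])
    (MeasurableSet.of_discrete (s := {A : Config L | a ∈ A}))

lemma measurable_cellOffset (a : Cell L) : Measurable fun θ => cellOffset θ a := by
  unfold cellOffset proj
  fun_prop

/-- Joint measurability in tree, direction and position is what every later use of Fubini needs; it
follows from the recursion at the root. -/
lemma measurableSet_hitSet (hL : L ≠ 0) (n : ℕ) : MeasurableSet (hitSet L n) := by
  induction n with
  | zero =>
    have : hitSet L 0 = {z | projMin z.2.1 ≤ z.2.2} ∩ {z | z.2.2 ≤ projMax z.2.1} := by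
      ext z
      exact mem_proj_stage_zero z.1 z.2.1 z.2.2
    rw [this]
    refine (measurableSet_le ?_ (by fun_prop)).inter (measurableSet_le (by fun_prop) ?_)
    · unfold projMin
      fun_prop
    · unfold projMax
      fun_prop
  | succ n ih =>
    have : hitSet L (n + 1) = ⋃ a : Cell L, (Prod.fst ⁻¹' {x : Tree L | a ∈ x []}) ∩
        (fun z : Tree L × ℝ × ℝ =>
          (subtree a z.1, z.2.1, L * z.2.2 - cellOffset z.2.1 a)) ⁻¹' hitSet L n := by
      ext z
      simp only [mem_iUnion, mem_inter_iff, mem_preimage, mem_ofPred_eq]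
      exact mem_proj_stage_succ hL z.1 n z.2.1 z.2.2
    rw [this]
    refine MeasurableSet.iUnion fun a => (measurable_fst (measurableSet_mem_root a)).inter ?_
    refine Measurable.prodMk ((measurable_subtree a).comp measurable_fst) (Measurable.prodMk
      (by fun_prop) (Measurable.sub (by fun_prop)
        ((measurable_cellOffset a).comp (by fun_prop)))) ih

/-- Indicator that the line `ℓ(θ, t)` meets the `n`-th stage. -/
def hitInd (n : ℕ) (x : Tree L) (θ t : ℝ) : ℝ := indicator (hitSet L n) 1 (x, θ, t)

lemma hitInd_nonneg (n : ℕ) (x : Tree L) (θ t : ℝ) : 0 ≤ hitInd n x θ t :=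
  indicator_nonneg (fun _ _ => zero_le_one) _

lemma hitInd_le_one (n : ℕ) (x : Tree L) (θ t : ℝ) : hitInd n x θ t ≤ 1 :=
  indicator_le' (fun _ _ => le_rfl) (fun _ _ => zero_le_one) _

lemma abs_hitInd_le_one (n : ℕ) (x : Tree L) (θ t : ℝ) : |hitInd n x θ t| ≤ 1 := by
  rw [abs_of_nonneg (hitInd_nonneg n x θ t)]
  exact hitInd_le_one n x θ t

lemma projMin_projMax_mem (θ : ℝ) : -2 ≤ projMin θ ∧ projMax θ ≤ 2 := by
  have h1 := Real.sin_le_one θ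
  have h2 := Real.neg_one_le_sin θ
  have h3 := Real.cos_le_one θ
  have h4 := Real.neg_one_le_cos θ
  have a1 : -1 ≤ min (-Real.sin θ) 0 := le_min (by linarith) (by linarith)
  have a2 : -1 ≤ min (Real.cos θ) 0 := le_min (by linarith) (by linarith)
  have a3 : max (-Real.sin θ) 0 ≤ 1 := max_le (by linarith) (by linarith)
  have a4 : max (Real.cos θ) 0 ≤ 1 := max_le (by linarith) (by linarith)
  unfold projMin projMax
  constructor <;> linarith

lemma hitInd_le_window (hL : L ≠ 0) (n : ℕ) (x : Tree L) (θ t : ℝ) :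
    hitInd n x θ t ≤ window t := by
  by_cases ht : |t| ≤ 2
  · rw [window_of_mem ht]
    exact hitInd_le_one n x θ t
  · unfold hitInd
    rw [indicator_of_notMem]
    · exact window_nonneg t
    · intro h
      have h1 : t ∈ proj θ '' stage x 0 := image_mono (stage_antitone hL x (Nat.zero_le n)) h
      rw [mem_proj_stage_zero] at h1
      have h2 := projMin_projMax_mem θ
      exact ht (abs_le.2 ⟨by linarith [h1.1, h2.1], by linarith [h1.2, h2.2]⟩)

lemma measurable_hitInd (hL : L ≠ 0) (n : ℕ) :
    Measurable fun z : Tree L × ℝ × ℝ => hitInd n z.1 z.2.1 z.2.2 :=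
  measurable_one.indicator (measurableSet_hitSet hL n)

lemma measurable_hitInd_tree (hL : L ≠ 0) (n : ℕ) (θ t : ℝ) :
    Measurable fun x : Tree L => hitInd n x θ t :=
  (measurable_hitInd hL n).comp (f := fun x : Tree L => (x, θ, t)) measurable_prodMk_right

lemma measurable_hitInd_line (hL : L ≠ 0) (n : ℕ) (x : Tree L) (θ : ℝ) : Measurable (hitInd n x θ) :=
  (measurable_hitInd hL n).comp (f := fun t : ℝ => (x, θ, t))
    (measurable_prodMk_left.comp measurable_prodMk_left)

lemma projLength_stage (hL : L ≠ 0) (n : ℕ) (x : Tree L) (θ : ℝ) :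
    projLength θ (stage x n) = ∫ t, hitInd n x θ t := by
  have hm : MeasurableSet (proj θ '' stage x n) :=
    (measurable_prodMk_left.comp measurable_prodMk_left : Measurable fun t : ℝ => (x, θ, t))
      (measurableSet_hitSet hL n)
  unfold projLength
  rw [← integral_indicator_one hm]
  rfl

lemma integrable_hitInd_line (hL : L ≠ 0) (n : ℕ) (x : Tree L) (θ : ℝ) :
    Integrable (hitInd n x θ) := by
  refine integrable_window.mono' (measurable_hitInd_line hL n x θ).aestronglyMeasurable
    (ae_of_all _ fun t => ?_)
  rw [Real.norm_of_nonneg (hitInd_nonneg n x θ t)]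
  exact hitInd_le_window hL n x θ t

lemma measurable_projLength_stage (hL : L ≠ 0) (n : ℕ) :
    Measurable fun z : Tree L × ℝ => projLength z.2 (stage z.1 n) := by
  simp only [projLength_stage hL]
  have : StronglyMeasurable (Function.uncurry fun (z : Tree L × ℝ) (t : ℝ) =>
      hitInd n z.1 z.2 t) := by
    refine Measurable.stronglyMeasurable ?_
    exact (measurable_hitInd hL n).comp (f := fun z : (Tree L × ℝ) × ℝ => (z.1.1, z.1.2, z.2))
      (by fun_prop)
  exact this.integral_prod_right.measurable

lemma projLength_stage_nonneg (n : ℕ) (x : Tree L) (θ : ℝ) : 0 ≤ projLength θ (stage x n) :=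
  measureReal_nonneg

lemma projLength_stage_le (hL : L ≠ 0) (n : ℕ) (x : Tree L) (θ : ℝ) :
    projLength θ (stage x n) ≤ 4 := by
  rw [projLength_stage hL, ← integral_window]
  exact integral_mono (integrable_hitInd_line hL n x θ) integrable_window
    (hitInd_le_window hL n x θ)

lemma integrable_projLength_stage (hL : L ≠ 0) (n : ℕ) (x : Tree L) (μ : Measure ℝ)
    [IsFiniteMeasure μ] : Integrable (fun θ => projLength θ (stage x n)) μ := by
  refine Integrable.of_bound ((measurable_projLength_stage hL n).comp (f := fun θ : ℝ => (x, θ))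
    measurable_prodMk_left).aestronglyMeasurable 4 (ae_of_all _ fun θ => ?_)
  change ‖projLength θ (stage x n)‖ ≤ 4
  rw [Real.norm_of_nonneg (projLength_stage_nonneg n x θ)]
  exact projLength_stage_le hL n x θ

lemma Fav_eq (K : Set (ℝ × ℝ)) :
    Fav K = ∫ θ, projLength θ K ∂(volume.restrict (Ioc 0 Real.pi)) :=
  intervalIntegral.integral_of_le Real.pi_pos.le

lemma measurable_Fav_stage (hL : L ≠ 0) (n : ℕ) : Measurable fun x : Tree L => Fav (stage x n) := by
  simp only [Fav_eq]
  exact (measurable_projLength_stage hL n).stronglyMeasurable.integral_prod_right.measurable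

lemma Fav_stage_nonneg (n : ℕ) (x : Tree L) : 0 ≤ Fav (stage x n) := by
  rw [Fav_eq]
  exact integral_nonneg fun θ => projLength_stage_nonneg n x θ

lemma Fav_stage_le (hL : L ≠ 0) (n : ℕ) (x : Tree L) : Fav (stage x n) ≤ 4 * Real.pi := by
  rw [Fav_eq]
  calc _ ≤ ∫ _ : ℝ, (4 : ℝ) ∂(volume.restrict (Ioc 0 Real.pi)) :=
        integral_mono (integrable_projLength_stage hL n x _) (integrable_const _)
          fun θ => projLength_stage_le hL n x θ
    _ = 4 * Real.pi := by simp [Real.pi_pos.le, mul_comm]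

lemma projLength_stage_anti (hL : L ≠ 0) (x : Tree L) (θ : ℝ) :
    Antitone fun n => projLength θ (stage x n) := by
  intro m n hmn
  simp only [projLength_stage hL]
  refine integral_mono (integrable_hitInd_line hL n x θ) (integrable_hitInd_line hL m x θ)
    fun t => ?_
  unfold hitInd
  by_cases h : (x, θ, t) ∈ hitSet L n
  · have h' : (x, θ, t) ∈ hitSet L m := image_mono (stage_antitone hL x hmn) h
    rw [indicator_of_mem h, indicator_of_mem h']
  · rw [indicator_of_notMem h]
    exact hitInd_nonneg m x θ t

lemma Fav_stage_anti (hL : L ≠ 0) (x : Tree L) : Antitone fun n => Fav (stage x n) := by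
  intro m n hmn
  simp only [Fav_eq]
  exact integral_mono (integrable_projLength_stage hL n x _) (integrable_projLength_stage hL m x _)
    fun θ => projLength_stage_anti hL x θ hmn

namespace GridModel

variable {M : GridModel L}

variable (M) in
/-- Probability that the line `ℓ(θ, t)` meets the `n`-th stage. -/
def hitProb (n : ℕ) (θ t : ℝ) : ℝ := ∫ x, hitInd n x θ t ∂M.treeLaw

lemma ne_zero (M : GridModel L) : L ≠ 0 := by have := M.two_le; omega

lemma integrable_hitInd (n : ℕ) (θ t : ℝ) : Integrable (fun x => hitInd n x θ t) M.treeLaw :=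
  Integrable.of_bound (measurable_hitInd_tree M.ne_zero n θ t).aestronglyMeasurable 1
    (ae_of_all _ fun x => abs_hitInd_le_one n x θ t)

lemma hitInd_graft (hL : L ≠ 0) (n : ℕ) (A : Config L) (y : Cell L → Tree L) (θ t : ℝ) :
    hitInd (n + 1) (graft (A, y)) θ t =
      1 - ∏ a ∈ A, (1 - hitInd n (y a) θ (L * t - cellOffset θ a)) := by
  have h := mem_proj_stage_succ hL (graft (A, y)) n θ t
  simp only [graft_nil, subtree_graft] at h
  by_cases hA : ∃ a ∈ A, L * t - cellOffset θ a ∈ proj θ '' stage (y a) n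
  · have h1 : (graft (A, y), θ, t) ∈ hitSet L (n + 1) := h.2 hA
    obtain ⟨a, ha, hh⟩ := hA
    have h2 : (y a, θ, L * t - cellOffset θ a) ∈ hitSet L n := hh
    rw [hitInd, indicator_of_mem h1, Finset.prod_eq_zero ha, sub_zero, Pi.one_apply]
    rw [hitInd, indicator_of_mem h2, Pi.one_apply, sub_self]
  · have h1 : (graft (A, y), θ, t) ∉ hitSet L (n + 1) := fun h' => hA (h.1 h')
    rw [hitInd, indicator_of_notMem h1, Finset.prod_eq_one, sub_self]
    intro a ha
    have h2 : (y a, θ, L * t - cellOffset θ a) ∉ hitSet L n := fun h' => hA ⟨a, ha, h'⟩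
    rw [hitInd, indicator_of_notMem h2, sub_zero]

/-- Given the root selection, a line misses the next stage when it misses all the independent
subtrees, so the probabilities of missing multiply. -/
lemma hitProb_succ (n : ℕ) (θ : ℝ) :
    M.hitProb (n + 1) θ = hitOp M.weight (cellOffset θ) (M.hitProb n θ) := by
  funext t
  have hL := M.ne_zero
  rw [hitProb, integral_treeLaw (measurable_hitInd_tree hL (n + 1) θ t)
    (fun x => abs_hitInd_le_one (n + 1) x θ t)]
  refine Finset.sum_congr rfl fun A _ => ?_
  congr 1
  simp only [hitInd_graft hL]
  have hm : Measurable fun y : Cell L → Tree L =>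
      ∏ a ∈ A, (1 - hitInd n (y a) θ (L * t - cellOffset θ a)) :=
    Finset.measurable_prod _ fun a _ => measurable_const.sub
      ((measurable_hitInd_tree hL n θ _).comp (measurable_pi_apply a))
  have hi : Integrable (fun y : Cell L → Tree L =>
      ∏ a ∈ A, (1 - hitInd n (y a) θ (L * t - cellOffset θ a))) M.forestLaw := by
    refine Integrable.of_bound hm.aestronglyMeasurable 1 (ae_of_all _ fun y => ?_)
    rw [Real.norm_eq_abs, Finset.abs_prod]
    refine Finset.prod_le_one (fun _ _ => abs_nonneg _) fun a _ => abs_le.2 ⟨?_, ?_⟩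
    · linarith [hitInd_le_one n (y a) θ (L * t - cellOffset θ a)]
    · linarith [hitInd_nonneg n (y a) θ (L * t - cellOffset θ a)]
  rw [integral_sub (integrable_const _) hi, integral_const, probReal_univ, one_smul,
    integral_forestLaw_prod A fun a x => 1 - hitInd n x θ (L * t - cellOffset θ a)]
  congr 1
  refine Finset.prod_congr rfl fun a _ => ?_
  rw [integral_sub (integrable_const _) (integrable_hitInd n θ _), integral_const, probReal_univ,
    one_smul]
  rfl

lemma hitProb_eq_iterate (n : ℕ) (θ : ℝ) :
    M.hitProb n θ = (hitOp M.weight (cellOffset θ))^[n] (M.hitProb 0 θ) := by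
  induction n with
  | zero => rfl
  | succ n ih => rw [hitProb_succ, ih, Function.iterate_succ_apply']

lemma hitProb_zero (θ : ℝ) :
    M.hitProb 0 θ = indicator (Icc (projMin θ) (projMax θ)) 1 := by
  funext t
  have : ∀ x : Tree L, hitInd 0 x θ t = indicator (Icc (projMin θ) (projMax θ)) 1 t := by
    intro x
    by_cases h : t ∈ Icc (projMin θ) (projMax θ)
    · have h' : (x, θ, t) ∈ hitSet L 0 := (mem_proj_stage_zero x θ t).2 h
      rw [hitInd, indicator_of_mem h, indicator_of_mem h']
      rfl
    · have h' : (x, θ, t) ∉ hitSet L 0 := fun h'' => h ((mem_proj_stage_zero x θ t).1 h'')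
      rw [hitInd, indicator_of_notMem h, indicator_of_notMem h']
  unfold hitProb
  simp [this]

variable (M) in
lemma subWindow_hitProb_zero (θ : ℝ) : SubWindow (M.hitProb 0 θ) := by
  rw [hitProb_zero]
  refine ⟨measurable_one.indicator measurableSet_Icc, fun t =>
    ⟨indicator_nonneg (fun _ _ => zero_le_one) _, ?_⟩⟩
  have h := projMin_projMax_mem θ
  exact indicator_le_indicator_of_subset (Icc_subset_Icc h.1 h.2) (fun _ => zero_le_one) t

variable (M) in
lemma unitChord_div_two_le_hitProb (θ t : ℝ) : unitChord θ t / 2 ≤ M.hitProb 0 θ t := by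
  rw [hitProb_zero]
  by_cases ht : t ∈ Icc (projMin θ) (projMax θ)
  · rw [indicator_of_mem ht, Pi.one_apply]
    have h1 := unitChord_le_two_mul_window θ t
    have h2 := window_le_one t
    linarith
  · rw [indicator_of_notMem ht]
    have : ∀ s, squareInd (linePoint θ t s) = 0 := by
      intro s
      by_contra hne
      have h1 : (linePoint θ t s).1 ∈ Ico (0 : ℝ) 1 := by
        by_contra h'; exact hne (by rw [squareInd, unitInd_of_not_mem h', zero_mul])
      have h2 : (linePoint θ t s).2 ∈ Ico (0 : ℝ) 1 := by
        by_contra h'; exact hne (by rw [squareInd, unitInd_of_not_mem h', mul_zero])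
      refine ht ((mem_proj_stage_zero (fun _ => (∅ : Config L)) θ t).1 ?_)
      rw [stage_zero]
      refine ⟨linePoint θ t s, ⟨Ico_subset_Icc_self h1, Ico_subset_Icc_self h2⟩, ?_⟩
      simp only [proj, linePoint]
      linear_combination t * Real.sin_sq_add_cos_sq θ
    unfold unitChord
    simp [this]

lemma integral_projLength_stage (n : ℕ) (θ : ℝ) :
    ∫ x, projLength θ (stage x n) ∂M.treeLaw = ∫ t, M.hitProb n θ t := by
  have hL := M.ne_zero
  simp only [projLength_stage hL]
  refine integral_integral_swap ?_
  have hd : Integrable (fun z : Tree L × ℝ => (1 : ℝ) * window z.2) (M.treeLaw.prod volume) :=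
    (integrable_const (1 : ℝ)).mul_prod integrable_window
  refine hd.mono' ?_ (ae_of_all _ fun z => ?_)
  · refine Measurable.aestronglyMeasurable ?_
    exact (measurable_hitInd hL n).comp (f := fun z : Tree L × ℝ => (z.1, θ, z.2)) (by fun_prop)
  · rw [one_mul]
    change ‖hitInd n z.1 θ z.2‖ ≤ _
    rw [Real.norm_of_nonneg (hitInd_nonneg n z.1 θ z.2)]
    exact hitInd_le_window hL n z.1 θ z.2

variable (M) in
/-- Expected length of the projection of the `n`-th stage. -/
def meanProj (n : ℕ) (θ : ℝ) : ℝ := ∫ x, projLength θ (stage x n) ∂M.treeLaw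

variable (M) in
/-- Expected Favard length of the `n`-th stage. -/
def meanFav (n : ℕ) : ℝ := ∫ x, Fav (stage x n) ∂M.treeLaw

lemma meanProj_eq (n : ℕ) (θ : ℝ) :
    M.meanProj n θ = ∫ t, (hitOp M.weight (cellOffset θ))^[n] (M.hitProb 0 θ) t := by
  rw [meanProj, integral_projLength_stage, hitProb_eq_iterate]

lemma measurable_meanProj (n : ℕ) : Measurable (M.meanProj n) := by
  have h : Measurable (Function.uncurry fun (θ : ℝ) (x : Tree L) => projLength θ (stage x n)) :=
    (measurable_projLength_stage M.ne_zero n).comp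
      (f := fun z : ℝ × Tree L => (z.2, z.1)) (by fun_prop)
  exact (h.stronglyMeasurable.integral_prod_right (ν := M.treeLaw)).measurable

lemma meanProj_nonneg (n : ℕ) (θ : ℝ) : 0 ≤ M.meanProj n θ :=
  integral_nonneg fun x => projLength_stage_nonneg n x θ

lemma meanProj_le (n : ℕ) (θ : ℝ) : M.meanProj n θ ≤ 4 := by
  have hL := M.ne_zero
  have hm : Measurable fun x => projLength θ (stage x n) :=
    (measurable_projLength_stage hL n).comp (f := fun x : Tree L => (x, θ))
      measurable_prodMk_right
  have hi : Integrable (fun x => projLength θ (stage x n)) M.treeLaw := by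
    refine Integrable.of_bound hm.aestronglyMeasurable 4 (ae_of_all _ fun x => ?_)
    rw [Real.norm_of_nonneg (projLength_stage_nonneg n x θ)]
    exact projLength_stage_le hL n x θ
  calc _ ≤ ∫ _, (4 : ℝ) ∂M.treeLaw :=
        integral_mono hi (integrable_const _) fun x => projLength_stage_le hL n x θ
    _ = 4 := by simp

lemma meanFav_eq (n : ℕ) : M.meanFav n = ∫ θ in (0 : ℝ)..Real.pi, M.meanProj n θ := by
  have hL := M.ne_zero
  rw [intervalIntegral.integral_of_le Real.pi_pos.le]
  unfold meanFav meanProj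
  simp only [Fav_eq]
  refine integral_integral_swap ?_
  refine Integrable.of_bound (measurable_projLength_stage hL n).aestronglyMeasurable 4
    (ae_of_all _ fun z => ?_)
  change ‖projLength z.2 (stage z.1 n)‖ ≤ 4
  rw [Real.norm_of_nonneg (projLength_stage_nonneg n z.1 z.2)]
  exact projLength_stage_le hL n z.1 z.2

variable (M) in
/-- Half of the integrated variance. -/
def pairMass (θ : ℝ) : ℝ := ∫ t, pairOp M.weight (cellOffset θ) (unitChord θ) t

lemma exists_abs_mul_meanProj_sub_le (hu : M.Uniform) (hnd : M.NonDegenerate) {ε : ℝ}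
    (hε : 0 < ε) : ∃ N : ℕ, ∀ θ ∈ Icc 0 Real.pi, ∀ n ≥ N,
      |n * M.meanProj n θ - 1 / M.pairMass θ| ≤ ε := by
  obtain ⟨q, c, r, hq, hc, hl⟩ := M.exists_isLinked hu hnd
  obtain ⟨N, H⟩ := exists_abs_mul_integral_hitOp_sub_le L hq hc r hε
  refine ⟨N, fun θ hθ n hn => ?_⟩
  rw [meanProj_eq]
  exact H _ _ _ _ (M.isUniformWeight hu) (isSelfSimilarDensity_unitChord M.ne_zero θ) (hl θ hθ)
    (M.subWindow_hitProb_zero θ) (M.unitChord_div_two_le_hitProb θ) n hn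

lemma exists_pos_le_pairMass (hu : M.Uniform) (hnd : M.NonDegenerate) :
    ∃ m₀ : ℝ, 0 < m₀ ∧ ∀ θ ∈ Icc 0 Real.pi, m₀ ≤ M.pairMass θ := by
  obtain ⟨q, c, r, hq, hc, hl⟩ := M.exists_isLinked hu hnd
  obtain ⟨m₀, h0, H⟩ := exists_le_integral_pairOp L hq hc r
  exact ⟨m₀, h0, fun θ hθ => H _ _ _ (M.isUniformWeight hu)
    (isSelfSimilarDensity_unitChord M.ne_zero θ) (hl θ hθ)⟩

end GridModel

end

section

variable {L : ℕ}

/-! ### The integrated variance -/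

lemma squareInd_eq_sum (hL : L ≠ 0) (z : ℝ × ℝ) : squareInd z =
    ∑ a : Cell L, squareInd (L * z.1 - (a.1 : ℕ), L * z.2 - (a.2 : ℕ)) := by
  unfold squareInd
  rw [unitInd_eq_sum hL, unitInd_eq_sum hL z.2, Finset.sum_mul_sum, ← Finset.sum_product']
  rfl

/-- Coordinates of the lines of the `L × L` grid. -/
def gridCoord (L : ℕ) : Set ℝ := range fun i : ℕ => (i : ℝ) / L

/-- Off the grid lines, closed and half-open squares coincide. -/
lemma squareInd_eq_indicator (hL : L ≠ 0) {z : ℝ × ℝ} (h1 : z.1 ∉ gridCoord L)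
    (h2 : z.2 ∉ gridCoord L) (a : Cell L) :
    squareInd (L * z.1 - (a.1 : ℕ), L * z.2 - (a.2 : ℕ)) = indicator (square [a]) 1 z := by
  have hL0 : (L : ℝ) ≠ 0 := by exact_mod_cast hL
  have key : ∀ (u : ℝ) (i : Fin L), u ∉ gridCoord L →
      ((L : ℝ) * u - (i : ℕ) ∈ Icc (0 : ℝ) 1 ↔ (L : ℝ) * u - (i : ℕ) ∈ Ico (0 : ℝ) 1) := by
    intro u i hu
    refine ⟨fun h => ⟨h.1, lt_of_le_of_ne h.2 fun h' => hu ⟨(i : ℕ) + 1, ?_⟩⟩,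
      fun h => Ico_subset_Icc_self h⟩
    simp only
    rw [div_eq_iff hL0]
    push_cast
    linarith
  have hsq : z ∈ square [a] ↔ (L : ℝ) * z.1 - (a.1 : ℕ) ∈ Ico (0 : ℝ) 1 ∧
      (L : ℝ) * z.2 - (a.2 : ℕ) ∈ Ico (0 : ℝ) 1 := by
    rw [mem_square_cons hL, ← key _ _ h1, ← key _ _ h2]
    simp [square, corner]
    tauto
  by_cases h : z ∈ square [a]
  · rw [indicator_of_mem h, squareInd, unitInd_of_mem (hsq.1 h).1, unitInd_of_mem (hsq.1 h).2]
    simp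
  · rw [indicator_of_notMem h, squareInd]
    by_cases h3 : (L : ℝ) * z.1 - (a.1 : ℕ) ∈ Ico (0 : ℝ) 1
    · rw [unitInd_of_not_mem fun h4 => h (hsq.2 ⟨h3, h4⟩), mul_zero]
    · rw [unitInd_of_not_mem h3, zero_mul]

lemma mem_stage_one (x : Tree L) (z : ℝ × ℝ) : z ∈ stage x 1 ↔ ∃ a ∈ x [], z ∈ square [a] := by
  simp [stage, squares]

lemma indicator_stage_one (hL : L ≠ 0) (x : Tree L) {z : ℝ × ℝ} (h1 : z.1 ∉ gridCoord L)
    (h2 : z.2 ∉ gridCoord L) : indicator (stage x 1) 1 z =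
      ∑ a ∈ x [], squareInd (L * z.1 - (a.1 : ℕ), L * z.2 - (a.2 : ℕ)) := by
  by_cases h : z ∈ stage x 1
  · rw [indicator_of_mem h, Pi.one_apply]
    obtain ⟨a, ha, hza⟩ := (mem_stage_one x z).1 h
    refine le_antisymm ?_ ?_
    · have := Finset.single_le_sum (f := fun a : Cell L =>
        squareInd (L * z.1 - (a.1 : ℕ), L * z.2 - (a.2 : ℕ))) (fun b _ => squareInd_nonneg _) ha
      refine le_trans ?_ this
      rw [squareInd_eq_indicator hL h1 h2, indicator_of_mem hza]
      rfl
    · refine le_trans ?_ (squareInd_le_one z)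
      rw [squareInd_eq_sum hL z]
      exact Finset.sum_le_sum_of_subset_of_nonneg (Finset.subset_univ _)
        fun b _ _ => squareInd_nonneg _
  · rw [indicator_of_notMem h]
    refine (Finset.sum_eq_zero fun a ha => ?_).symm
    rw [squareInd_eq_indicator hL h1 h2, indicator_of_notMem]
    exact fun h' => h ((mem_stage_one x z).2 ⟨a, ha, h'⟩)

/-- The grid is null in the plane, hence on almost every line. Exceptional `t` do occur: in axis
directions a whole line may lie in the grid. -/
lemma ae_linePoint_notMem_gridCoord (L : ℕ) (θ : ℝ) : ∀ᵐ t : ℝ, ∀ᵐ s : ℝ,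
    (linePoint θ t s).1 ∉ gridCoord L ∧ (linePoint θ t s).2 ∉ gridCoord L := by
  have hc : ∀ᵐ u : ℝ, u ∉ gridCoord L := (countable_range _).ae_notMem _
  have h1 : ∀ᵐ z : ℝ × ℝ, z.1 ∉ gridCoord L ∧ z.2 ∉ gridCoord L := by
    rw [Measure.volume_eq_prod]
    exact (Measure.quasiMeasurePreserving_fst.ae hc).and
      (Measure.quasiMeasurePreserving_snd.ae hc)
  have h2 := (measurePreserving_linePoint θ).quasiMeasurePreserving.ae h1
  rw [Measure.volume_eq_prod] at h2
  exact Measure.ae_ae_of_ae_prod h2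

lemma measurableSet_stage (x : Tree L) (n : ℕ) : MeasurableSet (stage x n) :=
  Finset.measurableSet_biUnion _ fun _ _ => measurableSet_Icc.prod measurableSet_Icc

/-- The exceptional positions come from the grid alone, so one null set serves all trees; the
variance over trees can then be taken at a fixed `t`. -/
lemma ae_mul_chordLength_stage_one (hL : L ≠ 0) (θ : ℝ) : ∀ᵐ t : ℝ, ∀ x : Tree L,
    L * chordLength θ t (stage x 1) = ∑ a ∈ x [], unitChord θ (L * t - cellOffset θ a) := by
  have hL0 : (L : ℝ) ≠ 0 := by exact_mod_cast hL
  filter_upwards [ae_linePoint_notMem_gridCoord L θ] with t ht x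
  have hm : MeasurableSet {s : ℝ | linePoint θ t s ∈ stage x 1} :=
    ((measurable_linePoint θ).comp (f := fun s : ℝ => (t, s)) measurable_prodMk_left)
      (measurableSet_stage x 1)
  have h1 : chordLength θ t (stage x 1) = ∫ s, indicator (stage x 1) 1 (linePoint θ t s) := by
    unfold chordLength
    rw [← integral_indicator_one hm]
    rfl
  have h2 : ∫ s, indicator (stage x 1) 1 (linePoint θ t s) = ∫ s, ∑ a ∈ x [],
      squareInd (linePoint θ (L * t - cellOffset θ a)
        (L * s - ((a.1 : ℕ) * Real.cos θ + (a.2 : ℕ) * Real.sin θ))) := by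
    refine integral_congr_ae ?_
    filter_upwards [ht] with s hs
    rw [indicator_stage_one hL x hs.1 hs.2]
    refine Finset.sum_congr rfl fun a _ => ?_
    congr 1
    have h := Real.sin_sq_add_cos_sq θ
    refine Prod.ext ?_ ?_ <;> simp only [linePoint, cellOffset, proj]
    · linear_combination ((a.1 : ℕ) : ℝ) * h
    · linear_combination ((a.2 : ℕ) : ℝ) * h
  rw [h1, h2, integral_finsetSum _ fun a _ =>
    integrable_comp_affine hL (integrable_squareInd_linePoint θ (L * t - cellOffset θ a)) _,
    Finset.mul_sum]
  refine Finset.sum_congr rfl fun a _ => ?_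
  rw [integral_comp_affine (g := fun s => squareInd (linePoint θ (L * t - cellOffset θ a) s))]
  rw [← mul_assoc, mul_one_div_cancel hL0, one_mul]
  rfl

namespace GridModel

variable {M : GridModel L}

lemma variance_sum_law (hu : M.Uniform) (g : ℝ → ℝ) (p : Cell L → ℝ) (t : ℝ) :
    variance (fun A : Config L => ∑ a ∈ A, g (L * t - p a)) M.law.toMeasure =
      2 * pairOp M.weight p g t + avgOp p (fun s => g s ^ 2) t - avgOp p g t ^ 2 := by
  have hw := M.isUniformWeight hu
  have hmem : MemLp (fun A : Config L => ∑ a ∈ A, g (L * t - p a)) 2 M.law.toMeasure :=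
    MemLp.of_discrete
  rw [variance_eq_sub hmem, PMF.integral_eq_sum, PMF.integral_eq_sum, hw.avgOp_eq g,
    hw.avgOp_eq fun s => g s ^ 2, pairOp, Finset.mul_sum, ← Finset.sum_add_distrib]
  congr 1
  refine Finset.sum_congr rfl fun A _ => ?_
  simp only [Pi.pow_apply, smul_eq_mul]
  change M.weight A * _ = _
  ring

end GridModel

section Realization

variable {Ω : Type*} [MeasurableSpace Ω] {P : Measure Ω} {M : GridModel L}
  {X : List (Cell L) → Ω → Config L}

/-- The variance is twice the pair term plus `avgOp (h^2) - (avgOp h)^2`. As `avgOp h = h` and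
averaging preserves integrals, the last two terms cancel after integration in `t`. -/
lemma IsGridProcess.V_eq (hX : IsGridProcess M X P) (hu : M.Uniform) (θ : ℝ) :
    V X P θ = 2 * M.pairMass θ := by
  have hw := M.isUniformWeight hu
  have hh := isSelfSimilarDensity_unitChord M.ne_zero θ
  have h1 : V X P θ = ∫ t, (2 * pairOp M.weight (cellOffset θ) (unitChord θ) t +
      (avgOp (L := L) (cellOffset θ) (fun s => unitChord θ s ^ 2) t - unitChord θ t ^ 2)) := by
    refine integral_congr_ae ?_
    filter_upwards [ae_mul_chordLength_stage_one M.ne_zero θ] with t ht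
    have e : (fun ω => (L : ℝ) * chordLength θ t (S X 1 ω)) =
        (fun A : Config L => ∑ a ∈ A, unitChord θ (L * t - cellOffset θ a)) ∘ X [] := by
      funext ω
      exact ht fun w => X w ω
    rw [e, ← variance_map (Measurable.of_discrete).aemeasurable (hX.hasLaw []).aemeasurable,
      (hX.hasLaw []).map_eq, GridModel.variance_sum_law hu, hh.avgOp_eq M.ne_zero]
    ring
  have hsq : Integrable fun s => unitChord θ s ^ 2 := by
    simpa [sq] using hh.dominated.integrable_mul hh.dominated
  have hp : Integrable (pairOp M.weight (cellOffset θ) (unitChord θ)) :=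
    (dominated_pairOp hw hh).integrable
  have ha := integrable_avgOp (p := cellOffset θ) M.ne_zero hsq
  have hd : Integrable fun t => avgOp (cellOffset (L := L) θ) (fun s => unitChord θ s ^ 2) t -
      unitChord θ t ^ 2 := ha.sub hsq
  rw [h1, integral_add (hp.const_mul 2) hd, integral_sub ha hsq,
    integral_avgOp M.ne_zero hsq, sub_self, add_zero, integral_const_mul]
  rfl

lemma IsGridProcess.hasLaw_tree (hX : IsGridProcess M X P) :
    HasLaw (fun ω w => X w ω) M.treeLaw P :=
  hX.indep.hasLaw_infinitePi hX.hasLaw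
    (aemeasurable_pi_lambda _ fun w => (hX.hasLaw w).aemeasurable)

lemma IsGridProcess.integral_comp (hX : IsGridProcess M X P) {F : Tree L → ℝ}
    (hF : Measurable F) : ∫ ω, F (fun w => X w ω) ∂P = ∫ x, F x ∂M.treeLaw :=
  hX.hasLaw_tree.integral_comp hF.aestronglyMeasurable

lemma IsGridProcess.integral_projLength (hX : IsGridProcess M X P) (n : ℕ) (θ : ℝ) :
    ∫ ω, projLength θ (S X n ω) ∂P = M.meanProj n θ :=
  hX.integral_comp ((measurable_projLength_stage M.ne_zero n).comp
    (f := fun x : Tree L => (x, θ)) measurable_prodMk_right)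

lemma IsGridProcess.integral_Fav (hX : IsGridProcess M X P) (n : ℕ) :
    ∫ ω, Fav (S X n ω) ∂P = M.meanFav n :=
  hX.integral_comp (measurable_Fav_stage M.ne_zero n)

end Realization

namespace GridModel

variable {M : GridModel L}

lemma tendstoUniformlyOn_mul_meanProj (hu : M.Uniform) (hnd : M.NonDegenerate) :
    TendstoUniformlyOn (fun (n : ℕ) θ => n * M.meanProj n θ) (fun θ => 1 / M.pairMass θ) atTop
      (Icc 0 Real.pi) := by
  rw [Metric.tendstoUniformlyOn_iff]
  intro ε hε
  obtain ⟨N, H⟩ := exists_abs_mul_meanProj_sub_le hu hnd (half_pos hε)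
  filter_upwards [eventually_ge_atTop N] with n hn θ hθ
  rw [dist_comm, Real.dist_eq]
  exact (H θ hθ n hn).trans_lt (half_lt_self hε)

lemma measurable_pairMass : Measurable M.pairMass := by
  have : Measurable (Function.uncurry fun θ t : ℝ =>
      pairOp M.weight (cellOffset θ) (unitChord θ) t) := by
    unfold pairOp
    have h : ∀ a : Cell L, Measurable fun z : ℝ × ℝ =>
        unitChord z.1 (L * z.2 - cellOffset z.1 a) := fun a =>
      measurable_unitChord_uncurry.comp (Measurable.prodMk measurable_fst
        ((measurable_snd.const_mul _).sub ((measurable_cellOffset a).comp measurable_fst)))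
    refine Finset.measurable_sum _ fun A _ => Measurable.const_mul (Measurable.div_const ?_ _) _
    exact ((Finset.measurable_sum _ fun a _ => h a).pow_const 2).sub
      (Finset.measurable_sum _ fun a _ => (h a).pow_const 2)
  exact this.stronglyMeasurable.integral_prod_right.measurable

lemma intervalIntegrable_one_div_pairMass (hu : M.Uniform) (hnd : M.NonDegenerate) :
    IntervalIntegrable (fun θ => 1 / M.pairMass θ) volume 0 Real.pi := by
  obtain ⟨m₀, h0, H⟩ := exists_pos_le_pairMass hu hnd
  rw [intervalIntegrable_iff_integrableOn_Ioc_of_le Real.pi_pos.le]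
  refine Integrable.mono' (g := fun _ => 1 / m₀) (integrable_const _)
    (measurable_const.div measurable_pairMass).aestronglyMeasurable ?_
  refine (ae_restrict_iff' measurableSet_Ioc).2 (ae_of_all _ fun θ hθ => ?_)
  have h1 := H θ (Ioc_subset_Icc_self hθ)
  rw [Real.norm_of_nonneg (one_div_nonneg.2 (h0.le.trans h1))]
  exact one_div_le_one_div_of_le h0 h1

lemma intervalIntegrable_meanProj (n : ℕ) :
    IntervalIntegrable (M.meanProj n) volume 0 Real.pi := by
  rw [intervalIntegrable_iff_integrableOn_Ioc_of_le Real.pi_pos.le]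
  refine Integrable.of_bound (measurable_meanProj n).aestronglyMeasurable 4
    (ae_of_all _ fun θ => ?_)
  rw [Real.norm_of_nonneg (meanProj_nonneg n θ)]
  exact meanProj_le n θ

lemma tendsto_mul_meanFav (hu : M.Uniform) (hnd : M.NonDegenerate) :
    Tendsto (fun n : ℕ => n * M.meanFav n) atTop
      (𝓝 (∫ θ in (0 : ℝ)..Real.pi, 1 / M.pairMass θ)) := by
  rw [Metric.tendsto_atTop]
  intro ε hε
  obtain ⟨N, H⟩ := exists_abs_mul_meanProj_sub_le hu hnd (ε := ε / (2 * Real.pi))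
    (by have := Real.pi_pos; positivity)
  refine ⟨N, fun n hn => ?_⟩
  rw [Real.dist_eq, meanFav_eq, ← intervalIntegral.integral_const_mul,
    ← intervalIntegral.integral_sub ((intervalIntegrable_meanProj n).const_mul _)
      (intervalIntegrable_one_div_pairMass hu hnd)]
  have := intervalIntegral.norm_integral_le_of_norm_le_const (a := 0) (b := Real.pi)
    (f := fun θ => n * M.meanProj n θ - 1 / M.pairMass θ) (C := ε / (2 * Real.pi))
    fun θ hθ => H θ (Ioc_subset_Icc_self (uIoc_of_le Real.pi_pos.le ▸ hθ)) n hn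
  rw [sub_zero, abs_of_pos Real.pi_pos] at this
  have e : ε / (2 * Real.pi) * Real.pi = ε / 2 := by
    have := Real.pi_ne_zero
    field_simp
  rw [e] at this
  exact lt_of_le_of_lt this (half_lt_self hε)

end GridModel

end

section

variable {L : ℕ}

/-! ### Sums over a generation of the tree -/

/-- Sum of `φ` over the subtrees rooted at the squares of generation `k`. -/
def levelSum (φ : Tree L → ℝ) : ℕ → Tree L → ℝ
  | 0, x => φ x
  | k + 1, x => ∑ a ∈ x [], levelSum φ k (subtree a x)

lemma levelSum_add (φ : Tree L → ℝ) (k m : ℕ) (x : Tree L) :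
    levelSum φ (k + m) x = levelSum (levelSum φ m) k x := by
  induction k generalizing x with
  | zero => simp [levelSum]
  | succ k ih =>
    rw [Nat.succ_add]
    simp only [levelSum, ih]

lemma levelSum_sub (φ ψ : Tree L → ℝ) (k : ℕ) (x : Tree L) :
    levelSum (fun x => φ x - ψ x) k x = levelSum φ k x - levelSum ψ k x := by
  induction k generalizing x with
  | zero => rfl
  | succ k ih => simp only [levelSum, ih, Finset.sum_sub_distrib]

lemma levelSum_const (c : ℝ) (k : ℕ) (x : Tree L) :
    levelSum (fun _ => c) k x = c * levelSum (fun _ => 1) k x := by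
  induction k generalizing x with
  | zero => simp [levelSum]
  | succ k ih => simp only [levelSum, ih, Finset.mul_sum]

lemma levelSum_one (k : ℕ) (x : Tree L) :
    levelSum (fun _ => 1) k x = ((squares x k).card : ℝ) := by
  induction k generalizing x with
  | zero => simp [levelSum, squares]
  | succ k ih =>
    rw [squares_succ, Finset.card_biUnion]
    · simp only [levelSum, ih]
      push_cast
      refine Finset.sum_congr rfl fun a _ => ?_
      rw [Finset.card_image_of_injective _ List.cons_injective]
    · intro a _ b _ hab
      rw [Function.onFun, Finset.disjoint_left]
      intro w hw hw'
      obtain ⟨u, _, rfl⟩ := Finset.mem_image.1 hw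
      obtain ⟨v, _, h⟩ := Finset.mem_image.1 hw'
      exact hab (List.cons.inj h).1.symm

lemma measurable_levelSum {φ : Tree L → ℝ} (hφ : Measurable φ) (k : ℕ) :
    Measurable (levelSum φ k) := by
  induction k with
  | zero => exact hφ
  | succ k ih =>
    have : levelSum φ (k + 1) = fun x => ∑ a : Cell L,
        indicator {x : Tree L | a ∈ x []} (fun x => levelSum φ k (subtree a x)) x := by
      classical
      funext x
      simp only [levelSum, indicator_apply, mem_ofPred_eq]
      rw [Finset.sum_ite_mem, Finset.univ_inter]
    rw [this]
    exact Finset.measurable_sum _ fun a _ =>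
      (ih.comp (measurable_subtree a)).indicator (measurableSet_mem_root a)

lemma abs_levelSum_le {φ : Tree L → ℝ} {C : ℝ} (hC : ∀ x, |φ x| ≤ C) (k : ℕ) (x : Tree L) :
    |levelSum φ k x| ≤ ((L : ℝ) ^ 2) ^ k * C := by
  induction k generalizing x with
  | zero => simpa [levelSum] using hC x
  | succ k ih =>
    have h0 : 0 ≤ ((L : ℝ) ^ 2) ^ k * C := (abs_nonneg _).trans (ih x)
    calc |levelSum φ (k + 1) x| ≤ ∑ a ∈ x [], |levelSum φ k (subtree a x)| :=
          Finset.abs_sum_le_sum_abs _ _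
      _ ≤ ∑ a ∈ x [], ((L : ℝ) ^ 2) ^ k * C := Finset.sum_le_sum fun a _ => ih _
      _ = (x []).card * (((L : ℝ) ^ 2) ^ k * C) := by rw [Finset.sum_const, nsmul_eq_mul]
      _ ≤ (L : ℝ) ^ 2 * (((L : ℝ) ^ 2) ^ k * C) :=
          mul_le_mul_of_nonneg_right (card_config_le _) h0
      _ = _ := by ring

namespace GridModel

variable {M : GridModel L} {φ : Tree L → ℝ} {C : ℝ}

lemma integrable_of_abs_le {F : Tree L → ℝ} (hF : Measurable F) (hC : ∀ x, |F x| ≤ C) :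
    Integrable F M.treeLaw :=
  Integrable.of_bound hF.aestronglyMeasurable C (ae_of_all _ hC)

lemma integrable_eval {F : Tree L → ℝ} (hF : Measurable F) (hC : ∀ x, |F x| ≤ C) (a : Cell L) :
    Integrable (fun y : Cell L → Tree L => F (y a)) M.forestLaw :=
  Integrable.of_bound (hF.comp (measurable_pi_apply a)).aestronglyMeasurable C
    (ae_of_all _ fun y => hC (y a))

lemma integral_levelSum (hu : M.Uniform) (hφ : Measurable φ) (hC : ∀ x, |φ x| ≤ C) (k : ℕ) :
    ∫ x, levelSum φ k x ∂M.treeLaw = (L : ℝ) ^ k * ∫ x, φ x ∂M.treeLaw := by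
  induction k with
  | zero => simp [levelSum]
  | succ k ih =>
    rw [integral_treeLaw (measurable_levelSum hφ (k + 1)) (abs_levelSum_le hC (k + 1))]
    have : ∀ A : Config L, ∫ y, levelSum φ (k + 1) (graft (A, y)) ∂M.forestLaw =
        A.card * ((L : ℝ) ^ k * ∫ x, φ x ∂M.treeLaw) := by
      intro A
      simp only [levelSum, graft_nil, subtree_graft]
      rw [integral_finsetSum _ fun a _ =>
        integrable_eval (measurable_levelSum hφ k) (abs_levelSum_le hC k) a]
      simp only [integral_forestLaw_eval (measurable_levelSum hφ k), ih, Finset.sum_const,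
        nsmul_eq_mul]
    simp only [this, ← mul_assoc]
    rw [← Finset.sum_mul, ← Finset.sum_mul, (M.isUniformWeight hu).sum_mul_card]
    ring

lemma integral_forestLaw_mul {F : Tree L → ℝ} (h0 : ∫ x, F x ∂M.treeLaw = 0) {a b : Cell L}
    (hab : a ≠ b) : ∫ y, F (y a) * F (y b) ∂M.forestLaw = 0 := by
  classical
  have := integral_forestLaw_prod (M := M) {a, b} fun _ => F
  simpa [Finset.prod_pair hab, h0] using this

/-- Cross terms between distinct subtrees vanish by independence and centering. The second moment
grows only like `L^k`, so division by `L^k` leaves exponentially small fluctuations. -/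
lemma integral_sq_levelSum (hu : M.Uniform) (hφ : Measurable φ) (hC : ∀ x, |φ x| ≤ C)
    (h0 : ∫ x, φ x ∂M.treeLaw = 0) (k : ℕ) :
    ∫ x, levelSum φ k x ^ 2 ∂M.treeLaw = (L : ℝ) ^ k * ∫ x, φ x ^ 2 ∂M.treeLaw := by
  induction k with
  | zero => simp [levelSum]
  | succ k ih =>
    set F := levelSum φ k with hF
    have hm := measurable_levelSum hφ k
    have hb := abs_levelSum_le hC k
    set D := ((L : ℝ) ^ 2) ^ k * C with hD
    have hF0 : ∫ x, F x ∂M.treeLaw = 0 := by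
      rw [hF, integral_levelSum hu hφ hC, h0, mul_zero]
    have hbsq : ∀ x, |levelSum φ (k + 1) x ^ 2| ≤ (((L : ℝ) ^ 2) ^ (k + 1) * C) ^ 2 := fun x => by
      rw [abs_pow]
      exact pow_le_pow_left₀ (abs_nonneg _) (abs_levelSum_le hC (k + 1) x) 2
    rw [integral_treeLaw ((measurable_levelSum hφ (k + 1)).pow_const 2) hbsq]
    have hprod : ∀ a b : Cell L, Integrable (fun y : Cell L → Tree L => F (y a) * F (y b))
        M.forestLaw := by
      intro a b
      refine Integrable.of_bound ((hm.comp (measurable_pi_apply a)).mul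
        (hm.comp (measurable_pi_apply b))).aestronglyMeasurable (D * D) (ae_of_all _ fun y => ?_)
      rw [norm_mul]
      exact mul_le_mul (hb _) (hb _) (norm_nonneg _) ((abs_nonneg _).trans (hb (y a)))
    have : ∀ A : Config L, ∫ y, levelSum φ (k + 1) (graft (A, y)) ^ 2 ∂M.forestLaw =
        A.card * ((L : ℝ) ^ k * ∫ x, φ x ^ 2 ∂M.treeLaw) := by
      intro A
      simp only [levelSum, graft_nil, subtree_graft]
      have e : ∀ y : Cell L → Tree L, (∑ a ∈ A, levelSum φ k (y a)) ^ 2 =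
          ∑ a ∈ A, ∑ b ∈ A, F (y a) * F (y b) := fun y => by
        rw [sq, Finset.sum_mul_sum]
      simp only [e]
      rw [integral_finsetSum _ fun a _ => integrable_finsetSum _ fun b _ => hprod a b]
      have e2 : ∀ a ∈ A, ∫ y, ∑ b ∈ A, F (y a) * F (y b) ∂M.forestLaw =
          (L : ℝ) ^ k * ∫ x, φ x ^ 2 ∂M.treeLaw := by
        intro a ha
        rw [integral_finsetSum _ fun b _ => hprod a b, Finset.sum_eq_single_of_mem a ha
          fun b _ hba => integral_forestLaw_mul hF0 hba.symm, ← ih]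
        simp only [← sq]
        exact integral_forestLaw_eval (F := fun x => F x ^ 2) (hm.pow_const 2) a
      rw [Finset.sum_congr rfl e2, Finset.sum_const, nsmul_eq_mul]
    simp only [this, ← mul_assoc]
    rw [← Finset.sum_mul, ← Finset.sum_mul, (M.isUniformWeight hu).sum_mul_card]
    ring

end GridModel

/-! ### The Favard length and the first generations -/

/-- The projection of a union is at most the sum of the projections, each scaled by `1 / L`. -/
lemma projLength_stage_succ_le (hL : L ≠ 0) (n : ℕ) (x : Tree L) (θ : ℝ) :
    projLength θ (stage x (n + 1)) ≤
      (1 / (L : ℝ)) * ∑ a ∈ x [], projLength θ (stage (subtree a x) n) := by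
  have hi : ∀ a : Cell L, Integrable fun t : ℝ =>
      hitInd n (subtree a x) θ (L * t - cellOffset θ a) := fun a =>
    integrable_comp_affine hL (integrable_hitInd_line hL n (subtree a x) θ) _
  simp only [projLength_stage hL]
  calc _ ≤ ∫ t, ∑ a ∈ x [], hitInd n (subtree a x) θ (L * t - cellOffset θ a) := by
        refine integral_mono (integrable_hitInd_line hL _ x θ)
          (integrable_finsetSum _ fun a _ => hi a) fun t => ?_
        simp only
        by_cases h : (x, θ, t) ∈ hitSet L (n + 1)
        · obtain ⟨a, ha, hh⟩ := (mem_proj_stage_succ hL x n θ t).1 h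
          have h' : (subtree a x, θ, L * t - cellOffset θ a) ∈ hitSet L n := hh
          refine (hitInd_le_one _ _ _ _).trans ?_
          refine le_trans ?_ (Finset.single_le_sum
            (f := fun a => hitInd n (subtree a x) θ (L * t - cellOffset θ a))
            (fun b _ => hitInd_nonneg _ _ _ _) ha)
          rw [hitInd, indicator_of_mem h']
          exact le_rfl
        · rw [hitInd, indicator_of_notMem h]
          exact Finset.sum_nonneg fun b _ => hitInd_nonneg _ _ _ _
    _ = _ := by
        rw [integral_finsetSum _ fun a _ => hi a, Finset.mul_sum]
        exact Finset.sum_congr rfl fun a _ => integral_comp_affine _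

lemma Fav_stage_succ_le (hL : L ≠ 0) (n : ℕ) (x : Tree L) :
    Fav (stage x (n + 1)) ≤ (1 / (L : ℝ)) * ∑ a ∈ x [], Fav (stage (subtree a x) n) := by
  simp only [Fav_eq]
  rw [← integral_finsetSum _ fun a _ => integrable_projLength_stage hL n (subtree a x) _,
    ← integral_const_mul]
  exact integral_mono (integrable_projLength_stage hL _ x _)
    ((integrable_finsetSum _ fun a _ => integrable_projLength_stage hL n (subtree a x) _).const_mul
      _) fun θ => projLength_stage_succ_le hL n x θ

lemma Fav_stage_add_le (hL : L ≠ 0) (k m : ℕ) (x : Tree L) :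
    Fav (stage x (k + m)) ≤ (1 / (L : ℝ) ^ k) * levelSum (fun x => Fav (stage x m)) k x := by
  induction k generalizing x with
  | zero => simp [levelSum]
  | succ k ih =>
    rw [Nat.succ_add]
    refine (Fav_stage_succ_le hL (k + m) x).trans ?_
    have h1 : ∑ a ∈ x [], Fav (stage (subtree a x) (k + m)) ≤
        ∑ a ∈ x [], (1 / (L : ℝ) ^ k) * levelSum (fun x => Fav (stage x m)) k (subtree a x) :=
      Finset.sum_le_sum fun a _ => ih _
    calc _ ≤ (1 / (L : ℝ)) * ∑ a ∈ x [], (1 / (L : ℝ) ^ k) *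
          levelSum (fun x => Fav (stage x m)) k (subtree a x) := by gcongr
      _ = _ := by
          rw [← Finset.mul_sum, levelSum, pow_succ, ← mul_assoc]
          congr 1
          ring

namespace GridModel

variable {M : GridModel L}

/-- The mass lost in one generation is `∫ (avgOp f - hitOp f) ≤ L^2 ∫ f^2`, and the `L²` decay is
uniform in the direction. -/
lemma exists_meanFav_sub_le (hu : M.Uniform) (hnd : M.NonDegenerate) :
    ∃ C : ℝ, 0 ≤ C ∧ ∀ j : ℕ, 1 ≤ j → M.meanFav j - M.meanFav (j + 1) ≤ C / j ^ 2 := by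
  obtain ⟨q, c, r, hq, hc, hl⟩ := M.exists_isLinked hu hnd
  obtain ⟨C, hC, H⟩ := exists_integral_sq_hitOp_iterate_le L hq hc r
  have hw := M.isUniformWeight hu
  have hL := M.ne_zero
  refine ⟨(L : ℝ) ^ 2 * C * Real.pi, by have := Real.pi_pos.le; positivity, fun j hj => ?_⟩
  have key : ∀ θ ∈ Icc 0 Real.pi,
      M.meanProj j θ - M.meanProj (j + 1) θ ≤ (L : ℝ) ^ 2 * C / j ^ 2 := by
    intro θ hθ
    have hh := isSelfSimilarDensity_unitChord hL θ
    have hp := hh.offset_le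
    have hf0 := M.subWindow_hitProb_zero θ
    rw [meanProj_eq, meanProj_eq]
    set f := (hitOp M.weight (cellOffset θ))^[j] (M.hitProb 0 θ) with hf
    have hfw : SubWindow f := hf0.hitOp_iterate hw hp j
    rw [Function.iterate_succ_apply', ← hf]
    have hsq : Integrable fun s => f s ^ 2 := by
      simpa [sq] using hfw.dominated.integrable_mul hfw.dominated
    have hTi := integrable_avgOp (p := cellOffset θ) hL hfw.integrable
    have hAi := (hfw.hitOp hw hp).integrable
    have hwi := (subWindow_window.hitOp_iterate hw hp j)
    have hwsq : Integrable fun s => (hitOp M.weight (cellOffset θ))^[j] window s ^ 2 := by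
      simpa [sq] using hwi.dominated.integrable_mul hwi.dominated
    calc _ = ∫ t, (avgOp (cellOffset θ) f t - hitOp M.weight (cellOffset θ) f t) := by
          rw [integral_sub hTi hAi, integral_avgOp hL hfw.integrable]
      _ ≤ ∫ t, (L : ℝ) ^ 2 * avgOp (cellOffset (L := L) θ) (fun s => f s ^ 2) t :=
          integral_mono (hTi.sub hAi) ((integrable_avgOp hL hsq).const_mul _) fun t =>
            avgOp_sub_hitOp_le hw hfw.nonneg hfw.le_one t
      _ = (L : ℝ) ^ 2 * ∫ t, f t ^ 2 := by rw [integral_const_mul, integral_avgOp hL hsq]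
      _ ≤ (L : ℝ) ^ 2 * ∫ t, (hitOp M.weight (cellOffset θ))^[j] window t ^ 2 := by
          refine mul_le_mul_of_nonneg_left (integral_mono hsq hwsq fun t => ?_) (by positivity)
          exact pow_le_pow_left₀ (hfw.nonneg t) (hitOp_iterate_mono hw hp subWindow_window
            (fun t => (hf0.2 t).2) j t) 2
      _ ≤ (L : ℝ) ^ 2 * (C / j ^ 2) := by
          gcongr
          exact H _ _ _ hw hh (hl θ hθ) j hj
      _ = _ := by ring
  rw [meanFav_eq, meanFav_eq, ← intervalIntegral.integral_sub (intervalIntegrable_meanProj j)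
    (intervalIntegrable_meanProj (j + 1))]
  have := intervalIntegral.integral_mono_on Real.pi_pos.le
    ((intervalIntegrable_meanProj (M := M) j).sub (intervalIntegrable_meanProj (j + 1)))
    (intervalIntegrable_const (c := (L : ℝ) ^ 2 * C / (j : ℝ) ^ 2)) key
  refine this.trans (le_of_eq ?_)
  rw [intervalIntegral.integral_const, smul_eq_mul, sub_zero]
  ring

lemma meanFav_sub_le {C : ℝ} (hC : 0 ≤ C)
    (H : ∀ j : ℕ, 1 ≤ j → M.meanFav j - M.meanFav (j + 1) ≤ C / j ^ 2) {m : ℕ} (hm : 1 ≤ m)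
    (k : ℕ) : M.meanFav m - M.meanFav (k + m) ≤ k * (C / m ^ 2) := by
  induction k with
  | zero => simp
  | succ k ih =>
    have h1 := H (k + m) (by omega)
    have h2 : C / ((k + m : ℕ) : ℝ) ^ 2 ≤ C / (m : ℝ) ^ 2 := by
      have : (0 : ℝ) < m := by exact_mod_cast hm
      gcongr
      omega
    have e : k + 1 + m = k + m + 1 := by omega
    rw [e]
    push_cast at *
    linarith

end GridModel

end

section

variable {L : ℕ}

/-! ### Almost sure limits -/

/-- Tonelli: a finite sum of `L¹` norms makes the pointwise sum finite almost everywhere. It plays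
the role of Borel–Cantelli below. -/
lemma ae_summable_abs {α : Type*} [MeasurableSpace α] {μ : Measure α} {Y : ℕ → α → ℝ}
    (hi : ∀ n, Integrable (Y n) μ) {c : ℕ → ℝ} (hc : Summable c) (hb : ∀ n, ∫ x, |Y n x| ∂μ ≤ c n) :
    ∀ᵐ x ∂μ, Summable fun n => |Y n x| := by
  have h0 : ∀ n, 0 ≤ c n := fun n => (integral_nonneg fun x => abs_nonneg _).trans (hb n)
  have h1 : ∫⁻ x, ∑' n, ‖Y n x‖ₑ ∂μ ≠ ⊤ := by
    rw [lintegral_tsum fun n => (hi n).aestronglyMeasurable.enorm]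
    refine ne_top_of_le_ne_top (hc.tsum_ofReal_ne_top) (ENNReal.tsum_le_tsum fun n => ?_)
    rw [← ofReal_integral_norm_eq_lintegral_enorm (hi n)]
    exact ENNReal.ofReal_le_ofReal (hb n)
  have hm : AEMeasurable (fun x => ∑' n, ‖Y n x‖ₑ) μ :=
    AEMeasurable.tsum fun n => (hi n).aestronglyMeasurable.enorm
  filter_upwards [ae_lt_top' hm h1] with x hx
  simpa using ENNReal.summable_toReal hx.ne

namespace GridModel

variable {M : GridModel L}

lemma sq_div_pow_le (hL : 2 ≤ L) {K : ℝ} (hK : 0 ≤ K) (n : ℕ) :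
    (L : ℝ) ^ n * K / ((L : ℝ) ^ n) ^ 2 ≤ K * (1 / 2) ^ n := by
  have hL2 : (2 : ℝ) ≤ L := by exact_mod_cast hL
  have hp : (0 : ℝ) < (L : ℝ) ^ n := by positivity
  have e : (L : ℝ) ^ n * K / ((L : ℝ) ^ n) ^ 2 = K * (1 / (L : ℝ)) ^ n := by
    rw [one_div_pow]
    field_simp
  rw [e]
  gcongr

lemma card_squares_succ_sub (x : Tree L) (n : ℕ) :
    ((squares x (n + 1)).card : ℝ) - L * (squares x n).card =
      levelSum (fun x => ((x []).card : ℝ) - L) n x := by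
  rw [levelSum_sub, levelSum_const, levelSum_one, ← levelSum_one, levelSum_add]
  congr 2
  funext y
  simp [levelSum]

lemma measurable_card_root : Measurable fun x : Tree L => ((x []).card : ℝ) :=
  (Measurable.of_discrete (f := fun A : Config L => (A.card : ℝ))).comp
    (measurable_pi_apply (X := fun _ : List (Cell L) => Config L) [])

lemma integral_card_root (hu : M.Uniform) : ∫ x : Tree L, ((x []).card : ℝ) ∂M.treeLaw = L := by
  rw [integral_treeLaw measurable_card_root (C := (L : ℝ) ^ 2)]
  · simp [(M.isUniformWeight hu).sum_mul_card]
  · intro x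
    rw [Nat.abs_cast]
    exact card_config_le _

/-- The increments are normalized sums of centered offspring numbers, geometrically small in `L²`,
hence almost surely absolutely summable. -/
lemma ae_tendsto_card_squares (hu : M.Uniform) : ∀ᵐ x ∂M.treeLaw, ∃ z : ℝ,
    Tendsto (fun n => ((squares x n).card : ℝ) / (L : ℝ) ^ n) atTop (𝓝 z) := by
  have hL0 : (L : ℝ) ≠ 0 := by exact_mod_cast M.ne_zero
  set ψ : Tree L → ℝ := fun x => ((x []).card : ℝ) - L with hψ
  have hm : Measurable ψ := measurable_card_root.sub_const _
  have hb : ∀ x, |ψ x| ≤ (L : ℝ) ^ 2 + L := fun x => by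
    refine (abs_sub _ _).trans ?_
    rw [Nat.abs_cast, Nat.abs_cast]
    linarith [card_config_le (x [])]
  have hi1 : Integrable (fun x : Tree L => ((x []).card : ℝ)) M.treeLaw :=
    integrable_of_abs_le measurable_card_root (C := (L : ℝ) ^ 2) fun x => by
      rw [Nat.abs_cast]
      exact card_config_le _
  have h0 : ∫ x, ψ x ∂M.treeLaw = 0 := by
    rw [hψ, integral_sub hi1 (integrable_const _), integral_card_root hu]
    simp
  set K := ∫ x, ψ x ^ 2 ∂M.treeLaw with hK
  have hK0 : 0 ≤ K := integral_nonneg fun x => sq_nonneg _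
  set Y : ℕ → Tree L → ℝ := fun n x => levelSum ψ n x / (L : ℝ) ^ n with hY
  have hYm : ∀ n, Measurable (Y n) := fun n => (measurable_levelSum hm n).div_const _
  have hYb : ∀ n x, |Y n x| ≤ ((L : ℝ) ^ 2) ^ n * ((L : ℝ) ^ 2 + L) / |(L : ℝ) ^ n| := fun n x => by
    rw [hY, abs_div]
    exact div_le_div_of_nonneg_right (abs_levelSum_le hb n x) (abs_nonneg _)
  have hYi : ∀ n, Integrable (Y n) M.treeLaw := fun n => integrable_of_abs_le (hYm n) (hYb n)
  have hYsq : ∀ n, ∫ x, Y n x ^ 2 ∂M.treeLaw ≤ K * (1 / 2) ^ n := fun n => by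
    simp only [hY, div_pow]
    rw [integral_div, integral_sq_levelSum hu hm hb h0]
    have := sq_div_pow_le M.two_le hK0 n
    simpa using this
  -- Use `|y| ≤ (2/3)^n + (3/2)^n y^2`; against second moments of order `2^(-n)` both terms remain
  -- summable.
  have hYabs : ∀ n, ∫ x, |Y n x| ∂M.treeLaw ≤ (2 / 3) ^ n + K * (3 / 4) ^ n := fun n => by
    have hsqi : Integrable (fun x => Y n x ^ 2) M.treeLaw :=
      integrable_of_abs_le ((hYm n).pow_const 2) fun x => by
        rw [abs_pow]
        exact pow_le_pow_left₀ (abs_nonneg _) (hYb n x) 2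
    calc _ ≤ ∫ x, ((2 / 3 : ℝ) ^ n + (3 / 2) ^ n * Y n x ^ 2) ∂M.treeLaw := by
          refine integral_mono (hYi n).abs ((integrable_const _).add (hsqi.const_mul _))
            fun x => ?_
          have e : (2 / 3 : ℝ) ^ n * (3 / 2) ^ n = 1 := by rw [← mul_pow]; norm_num
          have h2 : (0 : ℝ) < (2 / 3) ^ n := by positivity
          have h3 : (0 : ℝ) < (3 / 2) ^ n := by positivity
          change |Y n x| ≤ (2 / 3 : ℝ) ^ n + (3 / 2) ^ n * Y n x ^ 2
          rw [← sq_abs (Y n x)]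
          nlinarith [sq_nonneg ((3 / 2 : ℝ) ^ n * |Y n x| - 1), abs_nonneg (Y n x),
            mul_nonneg h3.le (abs_nonneg (Y n x))]
      _ = (2 / 3 : ℝ) ^ n + (3 / 2) ^ n * ∫ x, Y n x ^ 2 ∂M.treeLaw := by
          rw [integral_add (integrable_const _) (hsqi.const_mul _), integral_const_mul]
          simp
      _ ≤ (2 / 3 : ℝ) ^ n + (3 / 2) ^ n * (K * (1 / 2) ^ n) := by
          gcongr
          exact hYsq n
      _ = _ := by
          rw [mul_left_comm, ← mul_pow]
          norm_num
  have hsum : Summable fun n : ℕ => (2 / 3 : ℝ) ^ n + K * (3 / 4) ^ n :=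
    (summable_geometric_of_lt_one (by norm_num) (by norm_num)).add
      ((summable_geometric_of_lt_one (by norm_num) (by norm_num)).mul_left K)
  filter_upwards [ae_summable_abs hYi hsum hYabs] with x hx
  refine cauchySeq_tendsto_of_complete (cauchySeq_of_summable_dist ?_)
  refine (hx.mul_left (1 / (L : ℝ))).congr fun n => ?_
  have h := card_squares_succ_sub x n
  have e : ((squares x (n + 1)).card : ℝ) / (L : ℝ) ^ (n + 1) -
      ((squares x n).card : ℝ) / (L : ℝ) ^ n = 1 / (L : ℝ) * Y n x := by
    rw [hY]
    simp only
    rw [← h]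
    field_simp
    ring
  rw [dist_comm, Real.dist_eq, Nat.succ_eq_add_one, e, abs_mul,
    abs_of_nonneg (by positivity : (0 : ℝ) ≤ 1 / L)]

lemma half_pow_four_le_pow_four_sub {i : ℕ} (hi : 2 ≤ i) :
    i ≤ i ^ 4 ∧ 1 ≤ i ^ 4 - i ∧ (i : ℝ) ^ 4 / 2 ≤ ((i ^ 4 - i : ℕ) : ℝ) := by
  have h1 : 2 * i ≤ i ^ 4 := by
    calc 2 * i ≤ i ^ 3 * i := Nat.mul_le_mul_right _ (by nlinarith [Nat.pow_le_pow_left hi 3])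
      _ = i ^ 4 := by ring
  refine ⟨by omega, by omega, ?_⟩
  rw [Nat.cast_sub (by omega)]
  have : (2 * i : ℝ) ≤ (i : ℝ) ^ 4 := by exact_mod_cast h1
  push_cast
  linarith

lemma integrable_Fav_stage (n : ℕ) : Integrable (fun x : Tree L => Fav (stage x n)) M.treeLaw :=
  integrable_of_abs_le (measurable_Fav_stage M.ne_zero n) (C := 4 * Real.pi) fun x => by
    rw [abs_of_nonneg (Fav_stage_nonneg n x)]
    exact Fav_stage_le M.ne_zero n x

lemma meanFav_nonneg (n : ℕ) : 0 ≤ M.meanFav n := integral_nonneg fun x => Fav_stage_nonneg n x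

lemma meanFav_le (n : ℕ) : M.meanFav n ≤ 4 * Real.pi := by
  calc _ ≤ ∫ _, 4 * Real.pi ∂M.treeLaw :=
        integral_mono (integrable_Fav_stage n) (integrable_const _)
          fun x => Fav_stage_le M.ne_zero n x
    _ = 4 * Real.pi := by simp

lemma meanFav_anti : Antitone M.meanFav := fun m n hmn =>
  integral_mono (integrable_Fav_stage n) (integrable_Fav_stage m)
    fun x => Fav_stage_anti M.ne_zero x hmn

/-- Excess over `Fav` of the bound obtained from the subtrees of generation `k`. -/
lemma integral_levelSum_Fav_sub (hu : M.Uniform) (k m : ℕ) :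
    ∫ x, (levelSum (fun x => Fav (stage x m)) k x / (L : ℝ) ^ k - Fav (stage x (k + m)))
      ∂M.treeLaw = M.meanFav m - M.meanFav (k + m) := by
  have hL0 : (L : ℝ) ≠ 0 := by exact_mod_cast M.ne_zero
  have hb : ∀ x : Tree L, |Fav (stage x m)| ≤ 4 * Real.pi := fun x => by
    rw [abs_of_nonneg (Fav_stage_nonneg m x)]
    exact Fav_stage_le M.ne_zero m x
  have hm := measurable_Fav_stage M.ne_zero m
  have hi : Integrable (levelSum (fun x : Tree L => Fav (stage x m)) k) M.treeLaw :=
    integrable_of_abs_le (measurable_levelSum hm k) (abs_levelSum_le hb k)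
  rw [integral_sub (hi.div_const _) (integrable_Fav_stage _), integral_div,
    integral_levelSum hu hm hb, mul_div_cancel_left₀ _ (pow_ne_zero k hL0)]
  rfl

lemma integral_sq_levelSum_Fav_sub_le (hu : M.Uniform) (k m : ℕ) :
    ∫ x, (levelSum (fun x => Fav (stage x m)) k x / (L : ℝ) ^ k -
      M.meanFav m * (((squares x k).card : ℝ) / (L : ℝ) ^ k)) ^ 2 ∂M.treeLaw ≤
        (4 * Real.pi) ^ 2 * (1 / 2) ^ k := by
  have hpi := Real.pi_pos
  have hm := measurable_Fav_stage M.ne_zero m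
  set φ : Tree L → ℝ := fun x => Fav (stage x m) - M.meanFav m with hφ
  have hφm : Measurable φ := hm.sub_const _
  have hb : ∀ x, |φ x| ≤ 4 * Real.pi := fun x => abs_le.2
    ⟨by linarith [Fav_stage_nonneg m x, meanFav_le (M := M) m],
      by linarith [Fav_stage_le M.ne_zero m x, meanFav_nonneg (M := M) m]⟩
  have h0 : ∫ x, φ x ∂M.treeLaw = 0 := by
    rw [hφ, integral_sub (integrable_Fav_stage m) (integrable_const _)]
    simp [meanFav]
  have e : ∀ x : Tree L, (levelSum (fun x => Fav (stage x m)) k x / (L : ℝ) ^ k -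
      M.meanFav m * (((squares x k).card : ℝ) / (L : ℝ) ^ k)) ^ 2 =
        levelSum φ k x ^ 2 / ((L : ℝ) ^ k) ^ 2 := fun x => by
    rw [hφ, levelSum_sub, levelSum_const, levelSum_one, ← div_pow]
    congr 1
    ring
  simp only [e]
  rw [integral_div, integral_sq_levelSum hu hφm hb h0]
  have hK0 : 0 ≤ ∫ x, φ x ^ 2 ∂M.treeLaw := integral_nonneg fun x => sq_nonneg _
  refine (sq_div_pow_le M.two_le hK0 k).trans ?_
  gcongr
  have hsqi : Integrable (fun x => φ x ^ 2) M.treeLaw :=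
    integrable_of_abs_le (C := (4 * Real.pi) ^ 2) (hφm.pow_const 2) fun x => by
      rw [abs_pow]
      exact pow_le_pow_left₀ (abs_nonneg _) (hb x) 2
  calc _ ≤ ∫ _, (4 * Real.pi) ^ 2 ∂M.treeLaw := by
        refine integral_mono hsqi (integrable_const _) fun x => ?_
        simp only
        rw [← sq_abs]
        exact pow_le_pow_left₀ (abs_nonneg _) (hb x) 2
    _ = _ := by simp

variable (M) in
/-- Gain in the mean between the generations `i ^ 4 - i` and `i ^ 4`. -/
def meanGain (i : ℕ) : ℝ := (i : ℝ) ^ 4 * (M.meanFav (i ^ 4 - i) - M.meanFav (i ^ 4))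

/-- Average of the Favard lengths of the subtrees of generation `i`, followed for `i ^ 4 - i`
generations. -/
def subtreeFav (i : ℕ) (x : Tree L) : ℝ :=
  levelSum (fun x => Fav (stage x (i ^ 4 - i))) i x / (L : ℝ) ^ i

lemma abs_Fav_stage_le (hL : L ≠ 0) (n : ℕ) (x : Tree L) : |Fav (stage x n)| ≤ 4 * Real.pi := by
  rw [abs_of_nonneg (Fav_stage_nonneg n x)]
  exact Fav_stage_le hL n x

lemma measurable_subtreeFav (hL : L ≠ 0) (i : ℕ) : Measurable (subtreeFav (L := L) i) :=
  (measurable_levelSum (measurable_Fav_stage hL _) i).div_const _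

lemma abs_subtreeFav_le (hL : L ≠ 0) (i : ℕ) (x : Tree L) :
    |subtreeFav i x| ≤ ((L : ℝ) ^ 2) ^ i * (4 * Real.pi) / |(L : ℝ) ^ i| := by
  rw [subtreeFav, abs_div]
  exact div_le_div_of_nonneg_right (abs_levelSum_le (abs_Fav_stage_le hL _) i x) (abs_nonneg _)

lemma meanGain_nonneg (i : ℕ) : 0 ≤ M.meanGain i :=
  mul_nonneg (by positivity) (sub_nonneg.2 (meanFav_anti (Nat.sub_le _ _)))

lemma exists_summable_meanGain_le (hu : M.Uniform) (hnd : M.NonDegenerate) :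
    ∃ c : ℕ → ℝ, Summable c ∧ ∀ j, M.meanGain (j + 2) ≤ c j := by
  obtain ⟨C, hC, H⟩ := exists_meanFav_sub_le hu hnd
  -- The gain is at most `i^4 * i * C / (i^4 / 2)^2 = 4 C / i^3`. The index starts at `2` because
  -- `i^4 - i ≥ i^4 / 2` fails at `1`.
  refine ⟨fun j => 4 * C * (1 / ((j + 2 : ℕ) : ℝ) ^ 3), ((summable_nat_add_iff 2).2
    (Real.summable_one_div_nat_pow.2 (by norm_num : 1 < 3))).mul_left _, fun j => ?_⟩
  set i := j + 2 with hi
  obtain ⟨h0, h1, h2⟩ := half_pow_four_le_pow_four_sub (i := i) (by omega)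
  have h3 := meanFav_sub_le hC H h1 i
  rw [show i + (i ^ 4 - i) = i ^ 4 by omega] at h3
  have hi0 : (0 : ℝ) < i := by exact_mod_cast (by omega : 0 < i)
  calc M.meanGain i ≤ (i : ℝ) ^ 4 * (i * (C / ((i ^ 4 - i : ℕ) : ℝ) ^ 2)) :=
        mul_le_mul_of_nonneg_left h3 (by positivity)
    _ ≤ (i : ℝ) ^ 4 * (i * (C / ((i : ℝ) ^ 4 / 2) ^ 2)) := by gcongr
    _ = _ := by field_simp; ring

lemma tendsto_meanGain (hu : M.Uniform) (hnd : M.NonDegenerate) :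
    Tendsto M.meanGain atTop (𝓝 0) := by
  obtain ⟨c, hc, hle⟩ := exists_summable_meanGain_le hu hnd
  rw [← tendsto_add_atTop_iff_nat 2]
  exact squeeze_zero (fun j => meanGain_nonneg _) hle hc.tendsto_atTop_zero

/-- Subadditivity makes the excess nonnegative, so its `L¹` norm is its mean, the gain, which is
summable. -/
lemma ae_tendsto_subtreeFav_sub_Fav (hu : M.Uniform) (hnd : M.NonDegenerate) :
    ∀ᵐ x ∂M.treeLaw, Tendsto (fun i : ℕ => (i : ℝ) ^ 4 *
      (subtreeFav i x - Fav (stage x (i ^ 4)))) atTop (𝓝 0) := by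
  have hL := M.ne_zero
  obtain ⟨c, hc, hle⟩ := exists_summable_meanGain_le hu hnd
  set A : ℕ → Tree L → ℝ := fun i x => (i : ℝ) ^ 4 * (subtreeFav i x - Fav (stage x (i ^ 4)))
    with hA
  have hAint : ∀ i, 2 ≤ i → ∫ x, |A i x| ∂M.treeLaw = M.meanGain i := by
    intro i hi
    have hadd : i + (i ^ 4 - i) = i ^ 4 := by
      have := (half_pow_four_le_pow_four_sub hi).1
      omega
    have hnn : ∀ x, 0 ≤ A i x := fun x => by
      have := Fav_stage_add_le hL i (i ^ 4 - i) x
      rw [hadd, one_div_mul_eq_div] at this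
      exact mul_nonneg (by positivity) (sub_nonneg.2 this)
    have := integral_levelSum_Fav_sub hu i (i ^ 4 - i)
    rw [hadd] at this
    simp only [abs_of_nonneg (hnn _)]
    simp only [hA, subtreeFav, meanGain]
    rw [integral_const_mul, this]
  have hAi : ∀ i, Integrable (A i) M.treeLaw := fun i =>
    ((integrable_of_abs_le (measurable_subtreeFav hL i) (abs_subtreeFav_le hL i)).sub
      (integrable_Fav_stage _)).const_mul _
  filter_upwards [ae_summable_abs (fun j => hAi (j + 2)) hc fun j =>
    (hAint (j + 2) (by omega)).le.trans (hle j)] with x hx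
  rw [← tendsto_add_atTop_iff_nat 2]
  exact (tendsto_zero_iff_abs_tendsto_zero _).2 hx.tendsto_atTop_zero

/-- The second moment of the fluctuation is of order `2^(-i)` whatever the depth of the subtrees, so
it absorbs the factor `i^8`. -/
lemma ae_tendsto_subtreeFav_sub_mul (hu : M.Uniform) :
    ∀ᵐ x ∂M.treeLaw, Tendsto (fun i : ℕ => (i : ℝ) ^ 4 * (subtreeFav i x -
      M.meanFav (i ^ 4 - i) * (((squares x i).card : ℝ) / (L : ℝ) ^ i))) atTop (𝓝 0) := by
  have hL := M.ne_zero
  set E : ℕ → Tree L → ℝ := fun i x => subtreeFav i x -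
    M.meanFav (i ^ 4 - i) * (((squares x i).card : ℝ) / (L : ℝ) ^ i) with hE
  have hcm : ∀ i, Measurable fun x : Tree L => ((squares x i).card : ℝ) := fun i => by
    simp only [← levelSum_one]
    exact measurable_levelSum measurable_const i
  have hcb : ∀ i (x : Tree L), |((squares x i).card : ℝ)| ≤ ((L : ℝ) ^ 2) ^ i * 1 := fun i x => by
    rw [← levelSum_one]
    exact abs_levelSum_le (fun _ => by simp) i x
  have hEm : ∀ i, Measurable (E i) := fun i =>
    (measurable_subtreeFav hL i).sub (((hcm i).div_const _).const_mul _)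
  have hEb : ∀ i x, |E i x| ≤ ((L : ℝ) ^ 2) ^ i * (4 * Real.pi) / |(L : ℝ) ^ i| +
      |M.meanFav (i ^ 4 - i)| * (((L : ℝ) ^ 2) ^ i * 1 / |(L : ℝ) ^ i|) := fun i x => by
    refine (abs_sub _ _).trans (add_le_add (abs_subtreeFav_le hL i x) ?_)
    rw [abs_mul, abs_div]
    gcongr
    exact hcb i x
  have hEi : ∀ i, Integrable (fun x => E i x ^ 2) M.treeLaw := fun i => by
    obtain ⟨c, hc⟩ : ∃ c, ∀ x, |E i x| ≤ c := ⟨_, hEb i⟩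
    refine integrable_of_abs_le (C := c ^ 2) ((hEm i).pow_const 2) fun x => ?_
    rw [abs_pow]
    exact pow_le_pow_left₀ (abs_nonneg _) (hc x) 2
  have hhalf : ‖(1 / 2 : ℝ)‖ < 1 := by norm_num
  have hsum : Summable fun i : ℕ => (4 * Real.pi) ^ 2 * ((i : ℝ) ^ 8 * (1 / 2) ^ i) :=
    (summable_pow_mul_geometric_of_norm_lt_one 8 hhalf).mul_left _
  have hb : ∀ i : ℕ, ∫ x, |(i : ℝ) ^ 8 * E i x ^ 2| ∂M.treeLaw ≤
      (4 * Real.pi) ^ 2 * ((i : ℝ) ^ 8 * (1 / 2) ^ i) := by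
    intro i
    have h1 : ∫ x, E i x ^ 2 ∂M.treeLaw ≤ (4 * Real.pi) ^ 2 * (1 / 2) ^ i :=
      integral_sq_levelSum_Fav_sub_le hu i (i ^ 4 - i)
    have e : ∀ x, |(i : ℝ) ^ 8 * E i x ^ 2| = (i : ℝ) ^ 8 * E i x ^ 2 := fun x =>
      abs_of_nonneg (by positivity)
    simp only [e]
    rw [integral_const_mul, mul_left_comm]
    exact mul_le_mul_of_nonneg_left h1 (by positivity)
  filter_upwards [ae_summable_abs (fun i => (hEi i).const_mul _) hsum hb] with x hx
  have h2 := (Real.continuous_sqrt.tendsto 0).comp hx.tendsto_atTop_zero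
  rw [Real.sqrt_zero] at h2
  refine (tendsto_zero_iff_abs_tendsto_zero _).2 (h2.congr fun i => ?_)
  have e : |(i : ℝ) ^ 8 * E i x ^ 2| = ((i : ℝ) ^ 4 * E i x) ^ 2 := by
    rw [abs_of_nonneg (by positivity)]
    ring
  simp only [Function.comp, e, Real.sqrt_sq_eq_abs]
  rfl

lemma ae_tendsto_pow_four_mul_Fav (hu : M.Uniform) (hnd : M.NonDegenerate) :
    ∀ᵐ x ∂M.treeLaw, ∀ z : ℝ,
      Tendsto (fun n => ((squares x n).card : ℝ) / (L : ℝ) ^ n) atTop (𝓝 z) →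
      Tendsto (fun i : ℕ => (i : ℝ) ^ 4 * Fav (stage x (i ^ 4))) atTop
        (𝓝 (z * ∫ θ in (0 : ℝ)..Real.pi, 1 / M.pairMass θ)) := by
  have hG : Tendsto (fun i : ℕ => (i : ℝ) ^ 4 * M.meanFav (i ^ 4)) atTop
      (𝓝 (∫ θ in (0 : ℝ)..Real.pi, 1 / M.pairMass θ)) := by
    have := (tendsto_mul_meanFav hu hnd).comp (tendsto_pow_atTop (α := ℕ) (n := 4) (by norm_num))
    refine this.congr fun i => ?_
    simp [Function.comp]
  filter_upwards [ae_tendsto_subtreeFav_sub_Fav hu hnd, ae_tendsto_subtreeFav_sub_mul hu]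
    with x hA hD z hz
  -- The gain replaces the mean at generation `i^4 - i` by the mean at `i^4`, whose asymptotics are
  -- known.
  have key := (hD.sub hA).add (hz.mul (hG.add (tendsto_meanGain hu hnd)))
  rw [sub_zero, zero_add, add_zero] at key
  refine key.congr fun i => ?_
  simp only [meanGain]
  ring

/-- A decreasing sequence which is asymptotic to `l / n` along fourth powers is asymptotic to
`l / n`. -/
lemma tendsto_mul_of_tendsto_pow_four {F : ℕ → ℝ} {l : ℝ} (hF : Antitone F) (h0 : ∀ n, 0 ≤ F n)
    (h : Tendsto (fun i : ℕ => (i : ℝ) ^ 4 * F (i ^ 4)) atTop (𝓝 l)) :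
    Tendsto (fun n : ℕ => n * F n) atTop (𝓝 l) := by
  set r : ℕ → ℕ := fun n => Nat.sqrt (Nat.sqrt n) with hr
  have hr1 : ∀ n, r n ^ 4 ≤ n := fun n => by
    calc r n ^ 4 = (r n ^ 2) ^ 2 := by ring
      _ ≤ (Nat.sqrt n) ^ 2 := Nat.pow_le_pow_left (Nat.sqrt_le' _) 2
      _ ≤ n := Nat.sqrt_le' _
  have hr2 : ∀ n, n ≤ (r n + 1) ^ 4 := fun n => by
    have h1 := Nat.lt_succ_sqrt' n
    have h2 := Nat.lt_succ_sqrt' (Nat.sqrt n)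
    calc n ≤ (Nat.sqrt n + 1) ^ 2 := h1.le
      _ ≤ ((r n + 1) ^ 2) ^ 2 := Nat.pow_le_pow_left h2 2
      _ = (r n + 1) ^ 4 := by ring
  have hrt : Tendsto r atTop atTop := by
    refine tendsto_atTop.2 fun b => ?_
    filter_upwards [eventually_ge_atTop (b ^ 4)] with n hn
    by_contra hlt
    have h1 : r n + 1 ≤ b := by omega
    have h2 := Nat.lt_succ_sqrt' n
    have h3 := Nat.lt_succ_sqrt' (Nat.sqrt n)
    have h4 : (Nat.sqrt n + 1) ^ 2 ≤ ((r n + 1) ^ 2) ^ 2 := Nat.pow_le_pow_left h3 2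
    have h5 : (r n + 1) ^ 4 ≤ b ^ 4 := Nat.pow_le_pow_left h1 4
    have h6 : ((r n + 1) ^ 2) ^ 2 = (r n + 1) ^ 4 := by ring
    have h7 : n < (Nat.sqrt n + 1) ^ 2 := h2
    omega
  have hs : Tendsto (fun i : ℕ => ((i + 1 : ℕ) : ℝ) ^ 4 * F ((i + 1) ^ 4)) atTop (𝓝 l) :=
    h.comp (tendsto_add_atTop_nat 1)
  have hratio : Tendsto (fun i : ℕ => (i : ℝ) / ((i + 1 : ℕ) : ℝ)) atTop (𝓝 1) := by
    have := tendsto_natCast_div_add_atTop (𝕜 := ℝ) (1 : ℝ)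
    simpa using this
  have hlow : Tendsto (fun i : ℕ => (i : ℝ) ^ 4 * F ((i + 1) ^ 4)) atTop (𝓝 l) := by
    have := (hratio.pow 4).mul hs
    rw [one_pow, one_mul] at this
    refine this.congr fun i => ?_
    have : ((i + 1 : ℕ) : ℝ) ≠ 0 := Nat.cast_ne_zero.2 (Nat.succ_ne_zero i)
    field_simp
  have hup : Tendsto (fun i : ℕ => ((i + 1 : ℕ) : ℝ) ^ 4 * F (i ^ 4)) atTop (𝓝 l) := by
    have := ((hratio.inv₀ one_ne_zero).pow 4).mul h
    rw [inv_one, one_pow, one_mul] at this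
    refine this.congr' ?_
    filter_upwards [eventually_ge_atTop 1] with i hi
    have h1 : (i : ℝ) ≠ 0 := Nat.cast_ne_zero.2 (by omega)
    rw [inv_div, div_pow]
    field_simp
  refine tendsto_of_tendsto_of_tendsto_of_le_of_le (hlow.comp hrt) (hup.comp hrt)
    (fun n => ?_) fun n => ?_
  · have h1 : ((r n : ℕ) : ℝ) ^ 4 ≤ n := by exact_mod_cast hr1 n
    exact mul_le_mul h1 (hF (hr2 n)) (h0 _) (Nat.cast_nonneg n)
  · have h1 : (n : ℝ) ≤ ((r n + 1 : ℕ) : ℝ) ^ 4 := by exact_mod_cast hr2 n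
    exact mul_le_mul h1 (hF (hr1 n)) (h0 _) (by positivity)

lemma ae_tendsto_mul_Fav (hu : M.Uniform) (hnd : M.NonDegenerate) :
    ∀ᵐ x ∂M.treeLaw, ∃ z : ℝ,
      Tendsto (fun n => ((squares x n).card : ℝ) / (L : ℝ) ^ n) atTop (𝓝 z) ∧
      Tendsto (fun n : ℕ => n * Fav (stage x n)) atTop
        (𝓝 (z * ∫ θ in (0 : ℝ)..Real.pi, 1 / M.pairMass θ)) := by
  filter_upwards [ae_tendsto_card_squares hu, ae_tendsto_pow_four_mul_Fav hu hnd] with x hx hF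
  obtain ⟨z, hz⟩ := hx
  exact ⟨z, hz, tendsto_mul_of_tendsto_pow_four (Fav_stage_anti M.ne_zero x)
    (fun n => Fav_stage_nonneg n x) (hF z hz)⟩

end GridModel

end

end

end RandomGrid

/-! ### The theorem for an arbitrary realization of the process. -/

open RandomGrid in
theorem theorem5p1 {L : ℕ} (M : RandomGrid.GridModel L) (hunif : M.Uniform)
    (hnd : M.NonDegenerate) {Ω : Type*} [MeasurableSpace Ω] (P : Measure Ω)
    [IsProbabilityMeasure P] (X : List (RandomGrid.Cell L) → Ω → RandomGrid.Config L)
    (hX : RandomGrid.IsGridProcess M X P) :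
    (∀ θ ∈ Set.Icc (0 : ℝ) Real.pi, 0 < RandomGrid.V X P θ) ∧
    TendstoUniformlyOn
      (fun (n : ℕ) (θ : ℝ) => (n : ℝ) * ∫ ω, RandomGrid.projLength θ (RandomGrid.S X n ω) ∂P)
      (fun θ => 2 / RandomGrid.V X P θ) atTop (Set.Icc (0 : ℝ) Real.pi) ∧
    IntervalIntegrable (fun θ => 2 / RandomGrid.V X P θ) volume 0 Real.pi ∧
    Tendsto (fun n : ℕ => (n : ℝ) * ∫ ω, RandomGrid.Fav (RandomGrid.S X n ω) ∂P) atTop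
      (𝓝 (∫ θ in (0 : ℝ)..Real.pi, 2 / RandomGrid.V X P θ)) ∧
    ∀ᵐ ω ∂P,
      Tendsto (fun n : ℕ => RandomGrid.Zseq X n ω) atTop (𝓝 (RandomGrid.Zlim X ω)) ∧
      Tendsto (fun n : ℕ => (n : ℝ) * RandomGrid.Fav (RandomGrid.S X n ω)) atTop
        (𝓝 (RandomGrid.Zlim X ω * ∫ θ in (0 : ℝ)..Real.pi, 2 / RandomGrid.V X P θ)) := by
  have hV : ∀ θ, V X P θ = 2 * M.pairMass θ := hX.V_eq hunif
  have hV2 : ∀ θ, 2 / V X P θ = 1 / M.pairMass θ := fun θ => by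
    rw [hV, ← div_div, div_self two_ne_zero]
  simp only [hV2, hX.integral_projLength, hX.integral_Fav]
  refine ⟨fun θ hθ => ?_, GridModel.tendstoUniformlyOn_mul_meanProj hunif hnd,
    GridModel.intervalIntegrable_one_div_pairMass hunif hnd,
    GridModel.tendsto_mul_meanFav hunif hnd, ?_⟩
  · obtain ⟨m₀, h0, H⟩ := GridModel.exists_pos_le_pairMass hunif hnd
    rw [hV]
    linarith [H θ hθ]
  · have h := GridModel.ae_tendsto_mul_Fav hunif hnd
    -- The almost sure statement was proved for the canonical law on trees; it is pulled back along
    -- the random tree of selections.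
    rw [← hX.hasLaw_tree.map_eq] at h
    filter_upwards [ae_of_ae_map hX.hasLaw_tree.aemeasurable h] with ω hω
    obtain ⟨z, hz, hF⟩ := hω
    have hlim : Zlim X ω = z := hz.limUnder_eq
    rw [hlim]
    exact ⟨hz, hF⟩
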